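/- A list assignment $L$ for a graph $G=(V,E)$ gives each vertex $v$ a finite set $L(v)\subseteq\mathbb{N}$ of colors. The graph $G$ is $L$-colorable if there is a function $f:V\to\mathbb{N}$ with $f(v)\in L(v)$ for all $v\in V$ and $f(x)\ne f(y)$ whenever $xy\in E$. It is $n$-choosable if it is $L$-colorable for every list assignment $L$ with $|L(v)|=n$ for all $v\in V$. The choice number $\mathrm{ch}(G)$ is the smallest $n$ such that $G$ is $n$-choosable. Theorem. Let $K_{4*k}$ denote the complete $k$-partite graph with four vertices in each part. For every positive integer $k$, $$\mathrm{ch}(K_{4*k})=\left\lceil\frac{3k-1}{2}\right\rceil.$$ -/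

import Mathlib

namespace SimpleGraph

/-- Given a list assignment `L`, which gives every vertex a finite set of colors (natural
numbers), `G` is `L`-colorable if it has a proper coloring in which the color of every vertex
belongs to the list of that vertex. -/
def ListColorable {V : Type*} (G : SimpleGraph V) (L : V → Finset ℕ) : Prop :=
  ∃ f : V → ℕ, (∀ v, f v ∈ L v) ∧ ∀ x y, G.Adj x y → f x ≠ f y

/-- `G` is `n`-choosable if it is `L`-colorable for all list assignments `L` whose lists all have
exactly `n` elements. -/
def Choosable {V : Type*} (G : SimpleGraph V) (n : ℕ) : Prop :=
  ∀ L : V → Finset ℕ, (∀ v, (L v).card = n) → G.ListColorable L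

/-- The choice number (list chromatic number) of `G`: the smallest `n` such that `G` is
`n`-choosable. As for Mathlib's chromatic number, it is `⊤` if there is no such `n`. -/
noncomputable def choiceNumber {V : Type*} (G : SimpleGraph V) : ℕ∞ :=
  ⨅ n ∈ {n : ℕ | G.Choosable n}, (n : ℕ∞)

end SimpleGraph

namespace K4

open Finset

/-! The value is `⌊3k/2⌋`. For the lower bound, take `2k - 1` colors and let list `i` of every part
avoid the residue class `i` mod 4: no single color serves a whole part, so `k` parts would need `2k`
colors (`le_of_choosable`).

For the upper bound, some lists of a part are merged into their intersection, a block. A system of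
distinct representatives for all blocks is a coloring, so Hall's condition is what must be checked
(`partColorable_of_hall`). Induction on `k` removes a part that can be colored with so few colors
that the shorter remaining lists still suffice; moreover, all lists together may be assumed to have
fewer than `4k` colors (`partColorable_of_small_pot`). Hence no color lies in all four lists of a
part, and the lists overlap enough to make merging useful.

If `k = 2g`, the lists have `3g` colors and no two colors cover a part. Then the overlaps of a part
live on three of its lists, and merging two of these suffices (`partColorable_even`).

If `k = 2h - 1`, the lists have `3h - 2` colors. Parts with two large complementary intersections
become two blocks. A largest set of further parts has three lists merged, subject to a scheduling
condition and to distinct representing colors; among these sets the total weight is maximal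
(`exists_selection`). Each remaining part gets its own level and greedily a choice of blocks that
suits the level and avoids earlier representatives. `level_count` shows that parts suited to their
levels satisfy Hall's condition. That a suitable choice exists follows from exchange arguments on
the maximal selection (`IsSelection.leftover`) and from linear inequalities between the numbers of
colors lying in exactly two or exactly three lists of a part. If nothing is selected, there are no
triples and these inequalities are simpler. -/

/-- `L` assigns four lists to every part; a proper coloring gives the vertices of different parts
different colors. -/
def PartColorable {ι : Type*} (L : ι → Fin 4 → Finset ℕ) : Prop :=
  ∃ f : ι → Fin 4 → ℕ, (∀ X i, f X i ∈ L X i) ∧ ∀ X Y i j, X ≠ Y → f X i ≠ f Y j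

/-! ### Hall's condition for merged lists, and the count by levels -/

/-- A vertex receives the representative of a block inside its list. Vertices of one part may share
a block, which is harmless; different parts have different blocks, hence different colors. -/
theorem partColorable_of_hall {ι : Type*} [Fintype ι] [DecidableEq ι]
    {L : ι → Fin 4 → Finset ℕ} (N : ι → ℕ) (M : ∀ X, Fin (N X) → Finset ℕ)
    (fits : ∀ X i, ∃ j, M X j ⊆ L X i)
    (hall : ∀ J : ∀ X, Finset (Fin (N X)),
      ∑ X, #(J X) ≤ #(univ.biUnion fun X => (J X).biUnion (M X))) :
    PartColorable L := by
  have key := (Finset.all_card_le_biUnion_card_iff_exists_injective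
    (fun b : Σ X, Fin (N X) => M b.1 b.2)).1 (by
      intro S
      have h := hall fun X => univ.filter fun j => (⟨X, j⟩ : Σ X, Fin (N X)) ∈ S
      have hS : S = univ.sigma fun X => univ.filter fun j => (⟨X, j⟩ : Σ X, Fin (N X)) ∈ S := by
        ext ⟨X, j⟩; simp
      have hc : #S = ∑ X, #(univ.filter fun j => (⟨X, j⟩ : Σ X, Fin (N X)) ∈ S) := by
        conv_lhs => rw [hS]
        rw [card_sigma]
      rw [hc]
      refine h.trans (card_le_card ?_)
      intro c hc
      simp only [mem_biUnion, mem_univ, true_and, mem_filter] at hc ⊢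
      obtain ⟨X, j, hj, hc⟩ := hc
      exact ⟨⟨X, j⟩, hj, hc⟩)
  obtain ⟨g, ginj, hg⟩ := key
  choose j hj using fits
  refine ⟨fun X i => g ⟨X, j X i⟩, fun X i => hj X i (hg ⟨X, j X i⟩), fun X Y i i' hXY h => ?_⟩
  exact hXY (congrArg Sigma.fst (ginj h))

theorem sum_le_card_filters {ι : Type*} [DecidableEq ι] (s : Finset ι) (r : ι → ℕ)
    (hr : ∀ X ∈ s, r X ≤ 4) :
    ∑ X ∈ s, r X ≤ #s + #(s.filter (2 ≤ r ·)) + #(s.filter (3 ≤ r ·)) + #(s.filter (4 ≤ r ·)) := by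
  rw [card_eq_sum_ones s, card_filter, card_filter, card_filter, ← sum_add_distrib,
    ← sum_add_distrib, ← sum_add_distrib]
  refine sum_le_sum fun X hX => ?_
  have := hr X hX
  split_ifs <;> omega

/-- The counting core of Hall's condition: `l` is the number of colors of a union of blocks and `r
X` the number of these blocks that come from `X`. One block per part costs `2h - 1`, so it remains
to bound the numbers of parts with a second, third and fourth block. Distinct levels make each of
these bounds in `B` grow by one with each color of `l`. -/
theorem level_count {ι : Type*} [DecidableEq ι] {h : ℕ} (hh : 2 ≤ h) {A B : Finset ι}
    (hAB : #A + #B = 2 * h - 1) (w lev r : ι → ℕ) (l : ℕ) (hl : 3 * h - 2 ≤ l)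
    (sched : ∀ F ⊆ A, h ≤ #F → ∃ Y ∈ F, #F + 1 ≤ h + w Y)
    (rA : ∀ X ∈ A, r X ≤ 2) (rA' : ∀ X ∈ A, 2 ≤ r X → 3 * h - 2 + w X ≤ l)
    (rB : ∀ X ∈ B, r X ≤ 4) (levlt : ∀ X ∈ B, lev X < #B) (levinj : Set.InjOn lev B)
    (h2 : h ≤ #(A.filter (h ≤ w ·)) ∨ ∀ X ∈ B, 2 ≤ r X →
      4 * h - 2 ≤ l + max (lev X) 1 ∧ (4 * h - 2 ≤ l + lev X ∨ ∃ Y ∈ A, r Y ≤ 1))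
    (h3 : ∀ X ∈ B, 3 ≤ r X → 4 * h - 2 + lev X + 1 ≤ l)
    (h4 : ∀ X ∈ B, 4 ≤ r X → 4 * h - 2 + #B + lev X + 1 ≤ l) :
    ∑ X ∈ A, r X + ∑ X ∈ B, r X ≤ l := by
  have sA : ∑ X ∈ A, r X ≤ #A + #(A.filter (2 ≤ r ·)) := by
    rw [card_eq_sum_ones A, card_filter, ← sum_add_distrib]
    refine sum_le_sum fun X hX => ?_
    have := rA X hX
    split_ifs <;> omega
  have sB := sum_le_card_filters B r rB
  -- From `h` parts on, `sched` supplies one whose weight, and therefore `l`, is large enough; fewer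
  -- than `h` parts are fine since `(3h - 2) - (2h - 1) = h - 1`.
  have cA : #(A.filter (2 ≤ r ·)) ≤ l - (2 * h - 1) := by
    by_cases hF : h ≤ #(A.filter (2 ≤ r ·))
    · obtain ⟨Y, hY, hw⟩ := sched _ (filter_subset _ _) hF
      rw [mem_filter] at hY
      have := rA' Y hY.1 hY.2
      omega
    · omega
  have cA' : #(A.filter (2 ≤ r ·)) ≤ #A := card_filter_le _ _
  have cB : #(B.filter (2 ≤ r ·)) ≤ #B := card_filter_le _ _
  have cB' : #(B.filter (3 ≤ r ·)) ≤ #B := card_filter_le _ _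
  have inj : ∀ P : ι → Prop, ∀ [DecidablePred P], Set.InjOn lev (B.filter P) := by
    intro P _
    exact levinj.mono (by intro x hx; simp at hx ⊢; exact hx.1)
  have c3 : #(B.filter (3 ≤ r ·)) ≤ l - (4 * h - 2) := by
    rw [← card_image_of_injOn (inj _), ← card_range (l - (4 * h - 2))]
    refine card_le_card fun m hm => ?_
    simp only [mem_image, mem_filter, mem_range] at hm ⊢
    obtain ⟨X, ⟨hX, hr⟩, rfl⟩ := hm
    have := h3 X hX hr
    omega
  have c4 : #(B.filter (4 ≤ r ·)) ≤ l - (4 * h - 2 + #B) := by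
    rw [← card_image_of_injOn (inj _), ← card_range (l - (4 * h - 2 + #B))]
    refine card_le_card fun m hm => ?_
    simp only [mem_image, mem_filter, mem_range] at hm ⊢
    obtain ⟨X, ⟨hX, hr⟩, rfl⟩ := hm
    have := h4 X hX hr
    omega
  by_cases hl2 : 4 * h - 2 ≤ l
  · omega
  have c30 : #(B.filter (3 ≤ r ·)) = 0 := by omega
  have c40 : #(B.filter (4 ≤ r ·)) = 0 := by omega
  rcases h2 with h2 | h2
  -- Below `4h - 2` colors a part of weight at least `h` cannot contribute two blocks. This leaves
  -- at most `h - 1` second blocks, even if all of `B` contributes two.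
  · have : #(A.filter (2 ≤ r ·)) + #(A.filter (h ≤ w ·)) ≤ #A := by
      rw [← card_union_of_disjoint]
      · exact card_le_card (union_subset (filter_subset _ _) (filter_subset _ _))
      · rw [disjoint_left]
        intro Y hY hY'
        rw [mem_filter] at hY hY'
        have := rA' Y hY.1 hY.2
        omega
    omega
  -- One color below `4h - 2`, the term `max (lev X) 1` admits two blocks even at level `0`. It is
  -- enough that some part of `A` or `B` contributes at most one block.
  by_cases hl1 : l = 4 * h - 3
  · by_contra hcon
    have hA2 : #(A.filter (2 ≤ r ·)) = #A := by omega
    have hB2 : #(B.filter (2 ≤ r ·)) = #B := by omega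
    have hA3 := filter_eq_self.1 (eq_of_subset_of_card_le (filter_subset _ _) hA2.ge)
    have hB3 := filter_eq_self.1 (eq_of_subset_of_card_le (filter_subset _ _) hB2.ge)
    have : ∀ X ∈ B, lev X ≠ 0 := by
      intro X hX h0
      rcases (h2 X hX (hB3 X hX)).2 with h5 | ⟨Y, hY, h5⟩
      · omega
      · have := hA3 Y hY
        omega
    have hB4 : #B ≤ #B - 1 := by
      conv_lhs => rw [← card_image_of_injOn levinj]
      rw [← Nat.card_Ico 1 #B]
      refine card_le_card fun m hm => ?_
      simp only [mem_image, mem_Ico] at hm ⊢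
      obtain ⟨X, hX, rfl⟩ := hm
      have := this X hX
      have := levlt X hX
      omega
    omega
  -- Parts with two blocks have levels from `4h - 2 - l` on.
  · have c2 : #(B.filter (2 ≤ r ·)) ≤ #B - (4 * h - 2 - l) := by
      rw [← card_image_of_injOn (inj _), ← Nat.card_Ico (4 * h - 2 - l) #B]
      refine card_le_card fun m hm => ?_
      simp only [mem_image, mem_filter, mem_Ico] at hm ⊢
      obtain ⟨X, ⟨hX, hr⟩, rfl⟩ := hm
      have := (h2 X hX hr).1
      have := levlt X hX
      omega
    omega

/-- A family of blocks containing one of size at least `3h - 2` falls under `level_count`; families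
of smaller blocks only are left to `small`. -/
theorem partColorable_of_levels {ι : Type*} [Fintype ι] [DecidableEq ι] {h : ℕ} (hh : 2 ≤ h)
    (hι : Fintype.card ι = 2 * h - 1) {L : ι → Fin 4 → Finset ℕ} (A : Finset ι) (w lev : ι → ℕ)
    (N : ι → ℕ) (M : ∀ X, Fin (N X) → Finset ℕ)
    (fits : ∀ X i, ∃ j, M X j ⊆ L X i)
    (sched : ∀ F ⊆ A, h ≤ #F → ∃ Y ∈ F, #F + 1 ≤ h + w Y)
    (NA : ∀ X ∈ A, N X ≤ 2)
    (hA : ∀ X ∈ A, w X = 0 ∨ 3 * h - 2 + w X ≤ #(univ.biUnion (M X)))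
    (NB : ∀ X ∉ A, N X ≤ 4) (levlt : ∀ X ∉ A, lev X < 2 * h - 1 - #A)
    (levinj : Set.InjOn lev (Aᶜ : Finset ι))
    (h2 : h ≤ #(A.filter (h ≤ w ·)) ∨ ∀ X ∉ A, ∀ J : Finset (Fin (N X)), 2 ≤ #J →
      4 * h - 2 ≤ #(J.biUnion (M X)) + max (lev X) 1 ∧
      4 * h - 2 ≤ #(J.biUnion (M X) ∪ A.biUnion fun Y => univ.biUnion (M Y)) + lev X)
    (h3 : ∀ X ∉ A, ∀ J : Finset (Fin (N X)), 3 ≤ #J → 4 * h - 2 + lev X + 1 ≤ #(J.biUnion (M X)))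
    (h4 : ∀ X ∉ A, ∀ J : Finset (Fin (N X)), 4 ≤ #J →
      4 * h - 2 + (2 * h - 1 - #A) + lev X + 1 ≤ #(J.biUnion (M X)))
    (small : ∀ J : ∀ X, Finset (Fin (N X)), (∀ X, ∀ j ∈ J X, #(M X j) < 3 * h - 2) →
      ∑ X, #(J X) ≤ #(univ.biUnion fun X => (J X).biUnion (M X))) :
    PartColorable L := by
  refine partColorable_of_hall N M fits fun J => ?_
  by_cases hs : ∀ X, ∀ j ∈ J X, #(M X j) < 3 * h - 2
  · exact small J hs
  push Not at hs
  obtain ⟨X₀, j₀, hj₀, hbig⟩ := hs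
  set U := univ.biUnion fun X => (J X).biUnion (M X) with hU
  have sub : ∀ X, (J X).biUnion (M X) ⊆ U := fun X =>
    subset_biUnion_of_mem (fun X => (J X).biUnion (M X)) (mem_univ X)
  have hl : 3 * h - 2 ≤ #U :=
    hbig.trans (card_le_card ((subset_biUnion_of_mem (M X₀) hj₀).trans (sub X₀)))
  have cB : #A + #Aᶜ = 2 * h - 1 := by rw [card_add_card_compl, hι]
  have cB' : #Aᶜ = 2 * h - 1 - #A := by omega
  have full : ∀ X ∈ A, 2 ≤ #(J X) → J X = univ := by
    intro X hX h2
    refine eq_univ_of_card _ (le_antisymm (card_le_univ _) ?_)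
    rw [Fintype.card_fin]
    exact (NA X hX).trans h2
  have cj : ∀ X, #(J X) ≤ N X := fun X => by simpa using card_le_univ (J X)
  have := level_count hh cB w lev (fun X => #(J X)) #U hl sched
    (fun X hX => (cj X).trans (NA X hX))
    (fun X hX hr => by
      rcases hA X hX with h0 | h0
      · omega
      · refine h0.trans (card_le_card ?_)
        rw [← full X hX hr]
        exact sub X)
    (fun X hX => (cj X).trans (NB X (by simpa using hX)))
    (fun X hX => by rw [cB']; exact levlt X (by simpa using hX)) levinj
    (by
      rcases h2 with h2 | h2
      · exact Or.inl h2
      · refine Or.inr fun X hX hr => ?_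
        obtain ⟨h5, h6⟩ := h2 X (by simpa using hX) (J X) hr
        refine ⟨h5.trans (Nat.add_le_add_right (card_le_card (sub X)) _), ?_⟩
        -- If every part of `A` contributes two blocks, it contributes all of its blocks, so the
        -- union contains all the colors of the blocks of `A`.
        by_contra! hcon
        obtain ⟨hc1, hc2⟩ := hcon
        refine absurd (h6.trans (Nat.add_le_add_right (card_le_card (union_subset (sub X) ?_)) _))
          (not_le.2 hc1)
        refine biUnion_subset.2 fun Y hY => ?_
        rw [← full Y hY (hc2 Y hY)]
        exact sub Y)
    (fun X hX hr => (h3 X (by simpa using hX) _ hr).trans (card_le_card (sub X)))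
    (fun X hX hr => by
      rw [cB']
      exact (h4 X (by simpa using hX) _ hr).trans (card_le_card (sub X)))
  rwa [sum_add_sum_compl] at this

/-! ### The classes of colors lying in exactly two or three lists of a part -/

section

/-- The four indices are the elements of `Fin 4`, in some order. -/
def Quad (i j k l : Fin 4) : Prop := i ≠ j ∧ i ≠ k ∧ i ≠ l ∧ j ≠ k ∧ j ≠ l ∧ k ≠ l

instance (i j k l : Fin 4) : Decidable (Quad i j k l) := by unfold Quad; infer_instance

theorem Quad.cover {i j k l : Fin 4} (q : Quad i j k l) (m : Fin 4) :
    m = i ∨ m = j ∨ m = k ∨ m = l := by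
  revert i j k l m; decide

theorem Quad.map {i j k l : Fin 4} (q : Quad i j k l) (σ : Equiv.Perm (Fin 4)) :
    Quad (σ i) (σ j) (σ k) (σ l) := by
  simpa [Quad] using q

theorem Quad.forall {i j k l : Fin 4} (q : Quad i j k l) {P : Fin 4 → Prop} :
    (∀ m, P m) ↔ P i ∧ P j ∧ P k ∧ P l := by
  constructor
  · exact fun h => ⟨h _, h _, h _, h _⟩
  · rintro ⟨h1, h2, h3, h4⟩ m
    rcases q.cover m with rfl | rfl | rfl | rfl <;> assumption

/-- The colors in all lists but `l`. -/
def tri (A : Fin 4 → Finset ℕ) (l : Fin 4) : Finset ℕ :=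
  (univ.biUnion A).filter fun c => ∀ m, c ∈ A m ↔ m ≠ l

/-- The colors in the lists `i` and `j` only. -/
def dbl (A : Fin 4 → Finset ℕ) (i j : Fin 4) : Finset ℕ :=
  (univ.biUnion A).filter fun c => ∀ m, c ∈ A m ↔ m = i ∨ m = j

variable {A : Fin 4 → Finset ℕ}

theorem mem_tri {i j k l : Fin 4} (q : Quad i j k l) {c : ℕ} :
    c ∈ tri A l ↔ c ∈ A i ∧ c ∈ A j ∧ c ∈ A k ∧ c ∉ A l := by
  obtain ⟨h1, h2, h3, h4, h5, h6⟩ := id q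
  simp only [tri, mem_filter, mem_biUnion, mem_univ, true_and, q.forall]
  constructor
  · rintro ⟨-, a, b, c, d⟩; simp_all
  · rintro ⟨a, b, c, d⟩; exact ⟨⟨i, a⟩, by simp_all⟩

theorem mem_dbl {i j k l : Fin 4} (q : Quad i j k l) {c : ℕ} :
    c ∈ dbl A i j ↔ c ∈ A i ∧ c ∈ A j ∧ c ∉ A k ∧ c ∉ A l := by
  obtain ⟨h1, h2, h3, h4, h5, h6⟩ := id q
  simp only [dbl, mem_filter, mem_biUnion, mem_univ, true_and, q.forall]
  constructor
  · rintro ⟨-, a, b, c, d⟩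
    refine ⟨a.2 (by simp), b.2 (by simp), fun h => ?_, fun h => ?_⟩
    · rcases c.1 h with h | h <;> simp_all
    · rcases d.1 h with h | h <;> simp_all
  · rintro ⟨a, b, c, d⟩
    refine ⟨⟨i, a⟩, ⟨by simp [a], by simp [b], ?_, ?_⟩⟩
    · simp [c, h2.symm, h4.symm]
    · simp [d, h3.symm, h5.symm]

theorem dbl_comm (i j : Fin 4) : dbl A i j = dbl A j i := by
  simp only [dbl, or_comm]

/-- As no color is in all four lists, shared colors fall into six classes `dbl` and four classes
`tri`. The formulas below express the size of any union of blocks linearly in these ten numbers, by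
inclusion and exclusion. -/
theorem inter_inter_eq_tri (hq : ∀ c, ∃ i, c ∉ A i) {i j k l : Fin 4} (q : Quad i j k l) :
    A i ∩ A j ∩ A k = tri A l := by
  ext c
  rw [mem_tri q]
  simp only [mem_inter]
  constructor
  · rintro ⟨⟨a, b⟩, d⟩
    refine ⟨a, b, d, fun e => ?_⟩
    obtain ⟨m, hm⟩ := hq c
    rcases q.cover m with rfl | rfl | rfl | rfl <;> contradiction
  · rintro ⟨a, b, d, -⟩
    exact ⟨⟨a, b⟩, d⟩

theorem inter_eq_union (hq : ∀ c, ∃ i, c ∉ A i) {i j k l : Fin 4} (q : Quad i j k l) :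
    A i ∩ A j = dbl A i j ∪ (tri A k ∪ tri A l) := by
  have q' : Quad i j l k := by simp_all [Quad, eq_comm]
  ext c
  simp only [mem_union, mem_inter, mem_dbl q, mem_tri q, mem_tri q']
  have : ¬ (c ∈ A i ∧ c ∈ A j ∧ c ∈ A k ∧ c ∈ A l) := fun h => by
    obtain ⟨m, hm⟩ := hq c
    exact hm ((q.forall (P := fun m => c ∈ A m)).2 h m)
  tauto

theorem disjoint_tri {i j : Fin 4} (h : i ≠ j) : Disjoint (tri A i) (tri A j) := by
  rw [disjoint_left]
  intro c hc hc'
  rw [tri, mem_filter] at hc hc'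
  exact (hc.2 i).1 ((hc'.2 i).2 h) rfl

theorem disjoint_dbl_tri {i j l : Fin 4} : Disjoint (dbl A i j) (tri A l) := by
  rw [disjoint_left]
  intro c hc hc'
  rw [tri, mem_filter] at hc'
  rw [dbl, mem_filter] at hc
  have h : ∀ m, (m = i ∨ m = j) ↔ m ≠ l := fun m => (hc.2 m).symm.trans (hc'.2 m)
  clear hc hc'
  revert i j l
  decide

theorem card_inter (hq : ∀ c, ∃ i, c ∉ A i) {i j k l : Fin 4} (q : Quad i j k l) :
    #(A i ∩ A j) = #(dbl A i j) + #(tri A k) + #(tri A l) := by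
  rw [inter_eq_union hq q, card_union_of_disjoint
    (disjoint_union_right.2 ⟨disjoint_dbl_tri, disjoint_dbl_tri⟩),
    card_union_of_disjoint (disjoint_tri q.2.2.2.2.2)]
  ring

theorem card_union_two {n : ℕ} (hn : ∀ i, #(A i) = n) (hq : ∀ c, ∃ i, c ∉ A i) {i j k l : Fin 4}
    (q : Quad i j k l) :
    #(A i ∪ A j) + (#(dbl A i j) + #(tri A k) + #(tri A l)) = 2 * n := by
  have := card_union_add_card_inter (A i) (A j)
  rw [card_inter hq q, hn, hn] at this
  omega

theorem card_pair_union {n : ℕ} (hn : ∀ i, #(A i) = n) (hq : ∀ c, ∃ i, c ∉ A i)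
    {i j k l : Fin 4} (q : Quad i j k l) :
    #(A i ∩ A j ∪ A k) = n + #(dbl A i j) + #(tri A k) := by
  have := card_union_add_card_inter (A i ∩ A j) (A k)
  rw [inter_inter_eq_tri hq q, card_inter hq q, hn] at this
  omega

theorem card_pair_union_union {n : ℕ} (hn : ∀ i, #(A i) = n) (hq : ∀ c, ∃ i, c ∉ A i)
    {i j k l : Fin 4} (q : Quad i j k l) :
    #(A i ∩ A j ∪ A k ∪ A l) + (#(dbl A k l) + #(tri A i) + #(tri A j)) =
      2 * n + #(dbl A i j) := by
  have q' : Quad i j l k := by simp_all [Quad, eq_comm]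
  have q'' : Quad k l i j := by simp_all [Quad, eq_comm]
  have h1 := card_union_add_card_inter (A i ∩ A j ∪ A k) (A l)
  have hd : Disjoint (tri A k) (A k ∩ A l) := by
    rw [disjoint_left]
    intro c hc hc'
    rw [mem_tri q'] at hc
    exact hc.2.2.2 (mem_inter.1 hc').1
  rw [card_pair_union hn hq q, hn, union_inter_distrib_right, inter_inter_eq_tri hq q',
    card_union_of_disjoint hd, card_inter hq q''] at h1
  omega

theorem card_union_three {n : ℕ} (hn : ∀ i, #(A i) = n) (hq : ∀ c, ∃ i, c ∉ A i)
    {i j k l : Fin 4} (q : Quad i j k l) :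
    #(A i ∪ A j ∪ A k) + (#(dbl A i j) + #(dbl A i k) + #(dbl A j k) + #(tri A i) + #(tri A j) +
      #(tri A k) + 2 * #(tri A l)) = 3 * n := by
  have q1 : Quad i k j l := by simp_all [Quad, eq_comm]
  have q2 : Quad j k i l := by simp_all [Quad, eq_comm]
  have h1 := card_union_add_card_inter (A i ∪ A j) (A k)
  have h2 := card_union_add_card_inter (A i ∩ A k) (A j ∩ A k)
  have h3 := card_union_two hn hq q
  rw [union_inter_distrib_right, hn] at h1
  rw [← inter_inter_distrib_right, inter_inter_eq_tri hq q, card_inter hq q1,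
    card_inter hq q2] at h2
  omega

theorem card_union_all {n : ℕ} (hn : ∀ i, #(A i) = n) (hq : ∀ c, ∃ i, c ∉ A i)
    {i j k l : Fin 4} (q : Quad i j k l) :
    #(univ.biUnion A) + (#(dbl A i j) + #(dbl A i k) + #(dbl A i l) + #(dbl A j k) + #(dbl A j l) +
      #(dbl A k l)) + 2 * (#(tri A i) + #(tri A j) + #(tri A k) + #(tri A l)) = 4 * n := by
  have q1 : Quad i l j k := by simp_all [Quad, eq_comm]
  have q2 : Quad j l i k := by simp_all [Quad, eq_comm]
  have q3 : Quad k l i j := by simp_all [Quad, eq_comm]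
  have e1 : Quad i j l k := by simp_all [Quad, eq_comm]
  have e2 : Quad i k l j := by simp_all [Quad, eq_comm]
  have e3 : Quad j k l i := by simp_all [Quad, eq_comm]
  have hU : univ.biUnion A = A i ∪ A j ∪ A k ∪ A l := by
    ext c
    simp only [mem_biUnion, mem_univ, true_and, mem_union]
    constructor
    · rintro ⟨m, hm⟩
      rcases q.cover m with rfl | rfl | rfl | rfl <;> simp [hm]
    · rintro (((h | h) | h) | h) <;> exact ⟨_, h⟩
  have h1 := card_union_add_card_inter (A i ∪ A j ∪ A k) (A l)
  have h2 := card_union_three hn hq q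
  have h3 : (A i ∪ A j ∪ A k) ∩ A l = A i ∩ A l ∪ A j ∩ A l ∪ A k ∩ A l := by
    rw [union_inter_distrib_right, union_inter_distrib_right]
  have h4 := card_union_add_card_inter (A i ∩ A l ∪ A j ∩ A l) (A k ∩ A l)
  have h5 := card_union_add_card_inter (A i ∩ A l) (A j ∩ A l)
  have h6 : (A i ∩ A l ∪ A j ∩ A l) ∩ (A k ∩ A l) = tri A j ∪ tri A i := by
    rw [← inter_inter_eq_tri hq e2, ← inter_inter_eq_tri hq e3]
    ext c; simp only [mem_inter, mem_union]; tauto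
  rw [← inter_inter_distrib_right, inter_inter_eq_tri hq e1, card_inter hq q1,
    card_inter hq q2] at h5
  rw [h6, card_union_of_disjoint (disjoint_tri q.1.symm), card_inter hq q3] at h4
  rw [h3, hn] at h1
  rw [hU]
  omega

/-- A color belongs to at most one of the ten classes. For a set `C` of forbidden colors this limits
how many classes can be blocked entirely. -/
theorem card_classes_inter_le {i j k l : Fin 4} (q : Quad i j k l) (C : Finset ℕ) :
    #(dbl A i j ∩ C) + #(dbl A i k ∩ C) + #(dbl A i l ∩ C) + #(dbl A j k ∩ C) + #(dbl A j l ∩ C) +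
      #(dbl A k l ∩ C) + #(tri A i ∩ C) + #(tri A j ∩ C) + #(tri A k ∩ C) + #(tri A l ∩ C)
      ≤ #C := by
  have e1 : Quad i k j l := by simp_all [Quad, eq_comm]
  have e2 : Quad i l j k := by simp_all [Quad, eq_comm]
  have e3 : Quad j k i l := by simp_all [Quad, eq_comm]
  have e4 : Quad j l i k := by simp_all [Quad, eq_comm]
  have e5 : Quad k l i j := by simp_all [Quad, eq_comm]
  have f1 : Quad i j l k := by simp_all [Quad, eq_comm]
  have f2 : Quad i k l j := by simp_all [Quad, eq_comm]
  have f3 : Quad j k l i := by simp_all [Quad, eq_comm]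
  have key : ∀ S : Finset ℕ, #(S ∩ C) = ∑ c ∈ C, if c ∈ S then 1 else 0 := by
    intro S
    rw [← card_filter, inter_comm, filter_mem_eq_inter]
  simp only [key, ← sum_add_distrib]
  rw [card_eq_sum_ones]
  refine sum_le_sum fun c _ => ?_
  simp only [mem_dbl q, mem_dbl e1, mem_dbl e2, mem_dbl e3, mem_dbl e4, mem_dbl e5, mem_tri q,
    mem_tri f1, mem_tri f2, mem_tri f3]
  by_cases h1 : c ∈ A i <;> by_cases h2 : c ∈ A j <;> by_cases h3 : c ∈ A k <;>
    by_cases h4 : c ∈ A l <;> simp [h1, h2, h3, h4]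

theorem card_classes_le {i j k l : Fin 4} (q : Quad i j k l) :
    #(dbl A i j) + #(dbl A i k) + #(dbl A i l) + #(tri A j) + #(tri A k) + #(tri A l)
      ≤ #(A i) := by
  have e1 : Quad i k j l := by simp_all [Quad, eq_comm]
  have e2 : Quad i l j k := by simp_all [Quad, eq_comm]
  have f1 : Quad i j l k := by simp_all [Quad, eq_comm]
  have f2 : Quad i k l j := by simp_all [Quad, eq_comm]
  have h := card_classes_inter_le (A := A) q (A i)
  have s1 : dbl A i j ∩ A i = dbl A i j := inter_eq_left.2 fun c hc => ((mem_dbl q).1 hc).1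
  have s2 : dbl A i k ∩ A i = dbl A i k := inter_eq_left.2 fun c hc => ((mem_dbl e1).1 hc).1
  have s3 : dbl A i l ∩ A i = dbl A i l := inter_eq_left.2 fun c hc => ((mem_dbl e2).1 hc).1
  have s4 : tri A l ∩ A i = tri A l := inter_eq_left.2 fun c hc => ((mem_tri q).1 hc).1
  have s5 : tri A k ∩ A i = tri A k := inter_eq_left.2 fun c hc => ((mem_tri f1).1 hc).1
  have s6 : tri A j ∩ A i = tri A j := inter_eq_left.2 fun c hc => ((mem_tri f2).1 hc).1
  rw [s1, s2, s3, s4, s5, s6] at h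
  omega

end

/-! ### Choices of blocks that suit a level -/

section

theorem le_card_biUnion_two {N e : ℕ} {M : Fin N → Finset ℕ} {D : Finset ℕ}
    (H : ∀ a b, a < b → e ≤ #(M a ∪ M b ∪ D)) (J : Finset (Fin N)) (hJ : 2 ≤ #J) :
    e ≤ #(J.biUnion M ∪ D) := by
  obtain ⟨a, ha, b, hb, hab⟩ := one_lt_card.1 hJ
  have hs : ∀ {a}, a ∈ J → M a ⊆ J.biUnion M := fun h => subset_biUnion_of_mem M h
  rcases lt_or_gt_of_ne hab with h | h
  · exact (H a b h).trans (card_le_card (union_subset_union_left (union_subset (hs ha) (hs hb))))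
  · exact (H b a h).trans (card_le_card (union_subset_union_left (union_subset (hs hb) (hs ha))))

theorem le_card_biUnion_three {N e : ℕ} {M : Fin N → Finset ℕ}
    (H : ∀ a b c, a < b → b < c → e ≤ #(M a ∪ M b ∪ M c)) (J : Finset (Fin N)) (hJ : 3 ≤ #J) :
    e ≤ #(J.biUnion M) := by
  obtain ⟨s, hs, hc⟩ := exists_subset_card_eq hJ
  let f := s.orderEmbOfFin hc
  have hf : ∀ x, M (f x) ⊆ J.biUnion M := fun x =>
    subset_biUnion_of_mem M (hs (s.orderEmbOfFin_mem hc x))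
  refine (H (f 0) (f 1) (f 2) (f.lt_iff_lt.2 (by decide)) (f.lt_iff_lt.2 (by decide))).trans
    (card_le_card (union_subset (union_subset (hf 0) (hf 1)) (hf 2)))

/-- A choice of blocks for a part with lists `A`, merging some lists to their intersection, that
suits level `m` out of `b`: merged blocks are represented by a color outside `C`, and `D` is the set
of colors known to be taken. -/
def GoodAt (h b m : ℕ) (relax : Prop) (A : Fin 4 → Finset ℕ) (C D : Finset ℕ) (N : ℕ)
    (M : Fin N → Finset ℕ) (R : Finset ℕ) : Prop :=
  N ≤ 4 ∧ (∀ i, ∃ j, M j ⊆ A i) ∧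
  -- A higher level asks for fewer colors in two blocks and more in three or four, as in
  -- `level_count`. At level `0` two blocks may miss `4h - 2` by one color, provided that they do
  -- not miss it together with `D`.
  (relax ∨ ∀ J : Finset (Fin N), 2 ≤ #J → 4 * h - 2 ≤ #(J.biUnion M) + max m 1 ∧
    4 * h - 2 ≤ #(J.biUnion M ∪ D) + m) ∧
  (∀ J : Finset (Fin N), 3 ≤ #J → 4 * h - 2 + m + 1 ≤ #(J.biUnion M)) ∧
  (∀ J : Finset (Fin N), 4 ≤ #J → 4 * h - 2 + b + m + 1 ≤ #(J.biUnion M)) ∧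
  (∀ J : Finset (Fin N), (∀ j ∈ J, #(M j) < 3 * h - 2) → #J ≤ #(J.biUnion M ∩ R)) ∧
  #R ≤ 1 ∧ Disjoint R C

/-- There is a choice of blocks that suits level `m` out of `b`. -/
def Good (h b m : ℕ) (relax : Prop) (A : Fin 4 → Finset ℕ) (C D : Finset ℕ) : Prop :=
  ∃ (N : ℕ) (M : Fin N → Finset ℕ) (R : Finset ℕ), GoodAt h b m relax A C D N M R

variable {A : Fin 4 → Finset ℕ} {h b m : ℕ} {relax : Prop} {C D : Finset ℕ}

/-- Nothing is merged, so no block is small and no representative is needed; the hypotheses are the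
size conditions in terms of the classes. -/
theorem good_of_four (hh : 2 ≤ h) (hn : ∀ i, #(A i) = 3 * h - 2) (hq : ∀ c, ∃ i, c ∉ A i)
    (h2 : relax ∨ ∀ i j k l, Quad i j k l →
      #(dbl A i j) + #(tri A k) + #(tri A l) ≤ 2 * h - 2 + m)
    (h3 : ∀ i j k l, Quad i j k l → #(dbl A i j) + #(dbl A i k) + #(dbl A j k) + #(tri A i) +
      #(tri A j) + #(tri A k) + 2 * #(tri A l) + m + 5 ≤ 5 * h)
    (h4 : ∀ i j k l, Quad i j k l → #(dbl A i j) + #(dbl A i k) + #(dbl A i l) + #(dbl A j k) +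
      #(dbl A j l) + #(dbl A k l) + 2 * (#(tri A i) + #(tri A j) + #(tri A k) + #(tri A l)) +
      b + m + 7 ≤ 8 * h) :
    Good h b m relax A C D := by
  have ex2 : ∀ i j : Fin 4, i < j → ∃ k l, Quad i j k l := by decide
  have ex3 : ∀ i j k : Fin 4, i < j → j < k → ∃ l, Quad i j k l := by decide
  refine ⟨4, A, ∅, le_rfl, fun i => ⟨i, subset_rfl⟩, ?_, ?_, ?_, ?_, by simp, by simp⟩
  · rcases h2 with h2 | h2
    · exact Or.inl h2
    · have key : ∀ J : Finset (Fin 4), 2 ≤ #J → ∀ D : Finset ℕ,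
          4 * h - 2 - m ≤ #(J.biUnion A ∪ D) := by
        intro J hJ D
        refine le_card_biUnion_two (fun i j hij => ?_) J hJ
        obtain ⟨k, l, q⟩ := ex2 i j hij
        have h5 := card_union_two hn hq q
        have h6 := h2 i j k l q
        refine le_trans ?_ (card_le_card subset_union_left)
        omega
      refine Or.inr fun J hJ => ⟨?_, ?_⟩
      · have := key J hJ ∅
        rw [union_empty] at this
        omega
      · have := key J hJ D
        omega
  · refine le_card_biUnion_three fun i j k hij hjk => ?_
    obtain ⟨l, q⟩ := ex3 i j k hij hjk
    have h5 := card_union_three hn hq q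
    have h6 := h3 i j k l q
    omega
  · intro J hJ
    have hJ : J = univ := eq_univ_of_card _ (le_antisymm (card_le_univ _) (by simpa using hJ))
    have q : Quad 0 1 2 3 := by decide
    have h5 := card_union_all hn hq q
    have h6 := h4 _ _ _ _ q
    rw [hJ]
    omega
  · intro J hJ
    have : J = ∅ := by
      refine eq_empty_of_forall_notMem fun j hj => ?_
      have := hJ j hj
      rw [hn] at this
      omega
    simp [this]

/-- With three blocks the condition on four is void. Only the merged block can be small, and a
common color outside `C` represents it; `h3` is the condition on three blocks. -/
theorem good_of_pair' (hn : ∀ i, #(A i) = 3 * h - 2) (hq : ∀ c, ∃ i, c ∉ A i)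
    {i j k l : Fin 4} (q : Quad i j k l) (hC : ¬ A i ∩ A j ⊆ C)
    (h2 : relax ∨ (4 * h - 2 ≤ #(A i ∩ A j ∪ A k) + max m 1 ∧
      4 * h - 2 ≤ #(A i ∩ A j ∪ A l) + max m 1 ∧ 4 * h - 2 ≤ #(A k ∪ A l) + max m 1 ∧
      4 * h - 2 ≤ #(A i ∩ A j ∪ A k ∪ D) + m ∧ 4 * h - 2 ≤ #(A i ∩ A j ∪ A l ∪ D) + m ∧
      4 * h - 2 ≤ #(A k ∪ A l ∪ D) + m))
    (h3 : #(dbl A k l) + #(tri A i) + #(tri A j) + m + 3 ≤ #(dbl A i j) + 2 * h) :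
    Good h b m relax A C D := by
  obtain ⟨c, hc, hcC⟩ := not_subset.1 hC
  refine ⟨3, ![A i ∩ A j, A k, A l], {c}, by norm_num, ?_, ?_, ?_, ?_, ?_, by simp, by simpa using hcC⟩
  · rw [q.forall]
    exact ⟨⟨0, inter_subset_left⟩, ⟨0, inter_subset_right⟩, ⟨1, subset_rfl⟩, ⟨2, subset_rfl⟩⟩
  · rcases h2 with h2 | ⟨a1, a2, a3, a4, a5, a6⟩
    · exact Or.inl h2
    · refine Or.inr fun J hJ => ⟨?_, ?_⟩
      · have := le_card_biUnion_two (e := 4 * h - 2 - max m 1) (D := ∅)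
          (M := ![A i ∩ A j, A k, A l]) (by
          intro x y hxy
          fin_cases x <;> fin_cases y <;> simp at hxy ⊢ <;> omega) J hJ
        rw [union_empty] at this
        omega
      · have := le_card_biUnion_two (e := 4 * h - 2 - m) (D := D)
          (M := ![A i ∩ A j, A k, A l]) (by
          intro x y hxy
          fin_cases x <;> fin_cases y <;> simp [-union_assoc] at hxy ⊢ <;> omega) J hJ
        omega
  · intro J hJ
    have hJ : J = univ := eq_univ_of_card _ (le_antisymm (card_le_univ _) (by simpa using hJ))
    have h5 := card_pair_union_union hn hq q
    have : J.biUnion ![A i ∩ A j, A k, A l] = A i ∩ A j ∪ A k ∪ A l := by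
      rw [hJ]
      ext x
      simp [Fin.exists_fin_succ]
    rw [this]
    omega
  · intro J hJ
    have := card_le_univ J
    simp at this
    omega
  · intro J hJ
    have : J ⊆ {0} := by
      intro x hx
      have h6 := hJ x hx
      fin_cases x
      · simp
      · simp [hn] at h6
      · simp [hn] at h6
    rcases subset_singleton_iff.1 this with rfl | rfl
    · simp
    · have h7 : c ∈ A i ∧ c ∈ A j := mem_inter.1 hc
      simp [h7, inter_singleton_of_mem]

theorem good_of_pair (hh : 2 ≤ h) (hn : ∀ i, #(A i) = 3 * h - 2) (hq : ∀ c, ∃ i, c ∉ A i)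
    {i j k l : Fin 4} (q : Quad i j k l) (hC : ¬ A i ∩ A j ⊆ C)
    (h2 : relax ∨ (h ≤ #(dbl A i j) + #(tri A k) + m ∧ h ≤ #(dbl A i j) + #(tri A l) + m ∧
      #(dbl A k l) + #(tri A i) + #(tri A j) ≤ 2 * h - 2 + m))
    (h3 : #(dbl A k l) + #(tri A i) + #(tri A j) + m + 3 ≤ #(dbl A i j) + 2 * h) :
    Good h b m relax A C D := by
  refine good_of_pair' hn hq q hC ?_ h3
  rcases h2 with h2 | ⟨a1, a2, a3⟩
  · exact Or.inl h2
  · have q' : Quad i j l k := by simp_all [Quad, eq_comm]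
    have q'' : Quad k l i j := by simp_all [Quad, eq_comm]
    have e1 := card_pair_union hn hq q
    have e2 := card_pair_union hn hq q'
    have e3 := card_union_two hn hq q''
    have f1 := card_le_card (subset_union_left (s₁ := A i ∩ A j ∪ A k) (s₂ := D))
    have f2 := card_le_card (subset_union_left (s₁ := A i ∩ A j ∪ A l) (s₂ := D))
    have f3 := card_le_card (subset_union_left (s₁ := A k ∪ A l) (s₂ := D))
    refine Or.inr ⟨?_, ?_, ?_, ?_, ?_, ?_⟩ <;> omega

/-- At level `0` it is enough that two blocks miss `2k` by at most one, and do not together with `D`. -/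
theorem good_of_pair_zero (hh : 2 ≤ h) (hn : ∀ i, #(A i) = 3 * h - 2) (hq : ∀ c, ∃ i, c ∉ A i)
    {i j k l : Fin 4} (q : Quad i j k l) (hC : ¬ A i ∩ A j ⊆ C)
    (h2 : h - 1 ≤ #(dbl A i j) + #(tri A k) ∧ h - 1 ≤ #(dbl A i j) + #(tri A l) ∧
      #(dbl A k l) + #(tri A i) + #(tri A j) ≤ 2 * h - 2)
    (hD : 4 * h - 2 ≤ #(A i ∩ A j ∪ A k ∪ D) ∧ 4 * h - 2 ≤ #(A i ∩ A j ∪ A l ∪ D))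
    (h3 : #(dbl A k l) + #(tri A i) + #(tri A j) + 3 ≤ #(dbl A i j) + 2 * h) :
    Good h b 0 relax A C D := by
  obtain ⟨a1, a2, a3⟩ := h2
  obtain ⟨d1, d2⟩ := hD
  refine good_of_pair' hn hq q hC (Or.inr ?_) (by omega)
  have q' : Quad i j l k := by simp_all [Quad, eq_comm]
  have q'' : Quad k l i j := by simp_all [Quad, eq_comm]
  have e1 := card_pair_union hn hq q
  have e2 := card_pair_union hn hq q'
  have e3 := card_union_two hn hq q''
  have f3 := card_le_card (subset_union_left (s₁ := A k ∪ A l) (s₂ := D))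
  refine ⟨?_, ?_, ?_, ?_, ?_, ?_⟩ <;> omega

theorem card_union_tri (hn : ∀ i, #(A i) = 3 * h - 2) (i : Fin 4) :
    #(A i ∪ tri A i) = 3 * h - 2 + #(tri A i) := by
  rw [card_union_of_disjoint, hn]
  rw [disjoint_left]
  intro c hc hc'
  rw [tri, mem_filter] at hc'
  exact (hc'.2 i).1 hc rfl

theorem tri_subset {i j : Fin 4} (hij : j ≠ i) : tri A i ⊆ A j := by
  intro c hc
  rw [tri, mem_filter] at hc
  exact (hc.2 j).2 hij

/-- The block choice merging the three lists other than `i`. -/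
theorem tri_fits (i m : Fin 4) : ∃ j, ![A i, tri A i] j ⊆ A m := by
  by_cases h : m = i
  · exact ⟨0, by simp [h]⟩
  · exact ⟨1, by simpa using tri_subset h⟩

theorem tri_small (hn : ∀ i, #(A i) = 3 * h - 2) {i : Fin 4} {c : ℕ} (hc : c ∈ tri A i)
    (J : Finset (Fin 2)) (hJ : ∀ j ∈ J, #(![A i, tri A i] j) < 3 * h - 2) :
    #J ≤ #(J.biUnion ![A i, tri A i] ∩ {c}) := by
  have : J ⊆ {1} := by
    intro x hx
    have h6 := hJ x hx
    fin_cases x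
    · simp [hn] at h6
    · simp
  rcases subset_singleton_iff.1 this with rfl | rfl
  · simp
  · simp [hc, inter_singleton_of_mem]

/-- The two blocks are disjoint and have at least `(3h - 2) + (h - 1) = 4h - 3` colors, one less
than `4h - 2`, which level `0` tolerates because of `hD`. -/
theorem good_of_tri (hn : ∀ i, #(A i) = 3 * h - 2) {i : Fin 4} (hC : ¬ tri A i ⊆ C) (h2 : h - 1 ≤ #(tri A i))
    (hD : 4 * h - 2 ≤ #(A i ∪ tri A i ∪ D)) :
    Good h b 0 relax A C D := by
  obtain ⟨c, hc, hcC⟩ := not_subset.1 hC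
  have e1 := card_union_tri hn i
  have key : ∀ J : Finset (Fin 2), 2 ≤ #J → J.biUnion ![A i, tri A i] = A i ∪ tri A i := by
    intro J hJ
    have hJ : J = univ := eq_univ_of_card _ (le_antisymm (card_le_univ _) (by simpa using hJ))
    rw [hJ]
    ext x
    simp [Fin.exists_fin_succ]
  have no : ∀ J : Finset (Fin 2), ¬ 3 ≤ #J := by
    intro J hJ
    have := card_le_univ J
    simp at this
    omega
  refine ⟨2, ![A i, tri A i], {c}, by norm_num, tri_fits i, Or.inr fun J hJ => ?_,
    fun J hJ => absurd hJ (no J), fun J hJ => absurd (le_trans (by norm_num) hJ) (no J),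
    tri_small hn hc, by simp, by simpa using hcC⟩
  rw [key J hJ]
  omega

end

/-! ### The linear inequalities that make merging possible -/

set_option maxHeartbeats 4000000 in
/-- If three lists overlap too much, merging two of them is possible. Here `tx` is the number of colors
missing only in the list `x`, `xy` the number of colors in the lists `x` and `y` only, and `ex`, `cxy`
the numbers of forbidden ones among them. -/
theorem three_blocks_arith (h a m τ tx ty tz tw xy xz yz xw yw zw cxy cxz cyz cxw cyw czw ex ey ez ew : ℤ)
  (hh : 2 ≤ h) (ha : 1 ≤ a) (hm0 : 0 ≤ m) (hm : m + a + 2 ≤ 2*h) (hex : m = 0 → a + 3 ≤ 2*h)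
  (hτ : (h - 1 ≤ a ∧ τ = a - h + 1) ∨ (a ≤ h - 1 ∧ τ = 0))
  (nx : 0 ≤ tx) (ux : tx ≤ h-1) (nex : 0 ≤ ex) (fx : tx - ex ≤ τ)
  (uy : ty ≤ h-1) (ney : 0 ≤ ey) (fy : ty - ey ≤ τ)
  (uz : tz ≤ h-1) (nez : 0 ≤ ez) (fz : tz - ez ≤ τ)
  (nw : 0 ≤ tw) (uw : tw ≤ h-1) (new : 0 ≤ ew) (fw : tw - ew ≤ τ)
  (nxy : 0 ≤ xy) (ncxy : 0 ≤ cxy)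
  (nzw : 0 ≤ zw) (nczw : 0 ≤ czw)
  (nxz : 0 ≤ xz) (ncxz : 0 ≤ cxz)
  (nyw : 0 ≤ yw) (ncyw : 0 ≤ cyw)
  (ncyz : 0 ≤ cyz)
  (nxw : 0 ≤ xw) (ncxw : 0 ≤ cxw)
  (sxy : tx + ty ≤ a)
  (szw : tz + tw ≤ a)
  (sxz : tx + tz ≤ a)
  (syw : ty + tw ≤ a)
  (syz : ty + tz ≤ a)
  (sxw : tx + tw ≤ a)
  (hC : cxy + cxz + cyz + cxw + cyw + czw + ex + ey + ez + ew ≤ a + m)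
  (Lx : xy + xz + xw + ty + tz + tw ≤ 3*h-2)
  (Ly : xy + yz + yw + tx + tz + tw ≤ 3*h-2)
  (Lz : xz + yz + zw + tx + ty + tw ≤ 3*h-2)
  (Lw : xw + yw + zw + tx + ty + tz ≤ 3*h-2)
  (trip : 5*h-4-m ≤ xy + xz + yz + tx + ty + tz + 2*tw)
  (b0 : xy + tz ≤ h-1-m ∨ xy + tw ≤ h-1-m ∨ (xy + 2*h-2-m ≤ zw + tx + ty ∧ zw = czw ∧ ex = tx ∧
      ey = ty) ∨ (xy = cxy ∧ ez = tz ∧ ew = tw))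
  (b1 : xz + ty ≤ h-1-m ∨ xz + tw ≤ h-1-m ∨ (xz + 2*h-2-m ≤ yw + tx + tz ∧ yw = cyw ∧ ex = tx ∧
      ez = tz) ∨ (xz = cxz ∧ ey = ty ∧ ew = tw))
  (b2 : yz + tx ≤ h-1-m ∨ yz + tw ≤ h-1-m ∨ (yz + 2*h-2-m ≤ xw + ty + tz ∧ xw = cxw ∧ ey = ty ∧
      ez = tz) ∨ (yz = cyz ∧ ex = tx ∧ ew = tw))
  : False := by
  -- Twice `trip` minus the bounds `Lx`, `Ly`, `Lz` on the three lists.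
  have tw0 : h - 2 - 2 * m ≤ tw := by linarith
  all_goals (rcases b0 with b0 | b0 | ⟨b0,b0',_,_⟩ | ⟨b0,_,_⟩ <;> try (exfalso; linarith))
  all_goals (rcases b1 with b1 | b1 | ⟨b1,b1',_,_⟩ | ⟨b1,_,_⟩ <;> try (exfalso; linarith))
  all_goals (rcases b2 with b2 | b2 | ⟨b2,b2',_,_⟩ | ⟨b2,_,_⟩ <;> try (exfalso; linarith))
  all_goals (rcases hτ with ⟨_, rfl⟩ | ⟨_, rfl⟩ <;> try linarith)
  all_goals omega

set_option maxHeartbeats 4000000 in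
/-- If the four lists overlap too much, merging two of them is possible. -/
theorem four_blocks_arith (h a m τ tx ty tz tw xy xz yz xw yw zw cxy cxz cyz cxw cyw czw ex ey ez ew : ℤ)
  (hh : 2 ≤ h) (ha : 1 ≤ a) (hm : m + a + 2 ≤ 2*h) (hm0 : 1 ≤ m)
  (hτ : (h - 1 ≤ a ∧ τ = a - h + 1) ∨ (a ≤ h - 1 ∧ τ = 0))
  (t4 : 0 ≤ tw) (u1 : tx ≤ h-1)
  (s1 : tx + ty ≤ a) (q1 : tx + ty + tz + tw + 1 ≤ 2 * a)
  (nxy : 0 ≤ xy) (ncxy : 0 ≤ cxy)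
  (nzw : 0 ≤ zw) (nczw : 0 ≤ czw)
  (nxz : 0 ≤ xz) (ncxz : 0 ≤ cxz)
  (nyw : 0 ≤ yw) (ncyw : 0 ≤ cyw)
  (nyz : 0 ≤ yz) (ncyz : 0 ≤ cyz)
  (nxw : 0 ≤ xw) (ncxw : 0 ≤ cxw)
  (nex : 0 ≤ ex) (fx : tx - ex ≤ τ)
  (ney : 0 ≤ ey) (fy : ty - ey ≤ τ)
  (nez : 0 ≤ ez) (fz : tz - ez ≤ τ)
  (new : 0 ≤ ew) (fw : tw - ew ≤ τ)
  (hC : cxy + cxz + cyz + cxw + cyw + czw + ex + ey + ez + ew ≤ a + m)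
  (Lx : xy + xz + xw + ty + tz + tw ≤ 3*h-2)
  (Ly : xy + yz + yw + tx + tz + tw ≤ 3*h-2)
  (Lz : xz + yz + zw + tx + ty + tw ≤ 3*h-2)
  (Lw : xw + yw + zw + tx + ty + tz ≤ 3*h-2)
  (quad : 6*h-5+a-m ≤ xy+xz+yz+xw+yw+zw+2*(tx+ty+tz+tw))
  (o1 : ty ≤ tx) (o2 : tz ≤ ty) (o3 : tw ≤ tz)
  (b0 : (xy + tw ≤ h-1-m ∧ zw + ty ≤ h-1-m) ∨ (xy + tw ≤ h-1-m ∧ zw = czw ∧ ex = tx ∧ ey = ty) ∨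
      (xy = cxy ∧ ez = tz ∧ ew = tw ∧ zw + ty ≤ h-1-m) ∨ (xy = cxy ∧ ez = tz ∧ ew = tw ∧
      zw = czw ∧ ex = tx ∧ ey = ty) ∨ (xy + 2*h-2-m ≤ zw + tx + ty ∧ zw = czw ∧ ex = tx ∧
      ey = ty) ∨ (xy = cxy ∧ ez = tz ∧ ew = tw ∧ zw + 2*h-2-m ≤ xy + tz + tw))
  (b1 : (xz + tw ≤ h-1-m ∧ yw + tz ≤ h-1-m) ∨ (xz + tw ≤ h-1-m ∧ yw = cyw ∧ ex = tx ∧ ez = tz) ∨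
      (xz = cxz ∧ ey = ty ∧ ew = tw ∧ yw + tz ≤ h-1-m) ∨ (xz = cxz ∧ ey = ty ∧ ew = tw ∧
      yw = cyw ∧ ex = tx ∧ ez = tz) ∨ (xz + 2*h-2-m ≤ yw + tx + tz ∧ yw = cyw ∧ ex = tx ∧
      ez = tz) ∨ (xz = cxz ∧ ey = ty ∧ ew = tw ∧ yw + 2*h-2-m ≤ xz + ty + tw))
  (b2 : (yz + tw ≤ h-1-m ∧ xw + tz ≤ h-1-m) ∨ (yz + tw ≤ h-1-m ∧ xw = cxw ∧ ey = ty ∧ ez = tz) ∨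
      (yz = cyz ∧ ex = tx ∧ ew = tw ∧ xw + tz ≤ h-1-m) ∨ (yz = cyz ∧ ex = tx ∧ ew = tw ∧
      xw = cxw ∧ ey = ty ∧ ez = tz) ∨ (yz + 2*h-2-m ≤ xw + ty + tz ∧ xw = cxw ∧ ey = ty ∧
      ez = tz) ∨ (yz = cyz ∧ ex = tx ∧ ew = tw ∧ xw + 2*h-2-m ≤ yz + tx + tw))
  : False := by
  -- Twice `quad` minus the bounds on all four lists.
  have T0 : 2 * a - 2 - 2 * m ≤ tx+ty+tz+tw := by linarith
  rcases hτ with ⟨_, rfl⟩ | ⟨_, rfl⟩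
  all_goals (rcases b0 with ⟨b0,b0'⟩|⟨b0,b0',_,_⟩|⟨⟨b0,_,_⟩,b0'⟩|⟨⟨b0,_,_⟩,b0',_,_⟩|⟨b0,b0',_,_⟩|⟨⟨b0,_,_⟩,b0'⟩)
  all_goals (rcases b1 with ⟨b1,b1'⟩|⟨b1,b1',_,_⟩|⟨⟨b1,_,_⟩,b1'⟩|⟨⟨b1,_,_⟩,b1',_,_⟩|⟨b1,b1',_,_⟩|⟨⟨b1,_,_⟩,b1'⟩)
  all_goals (rcases b2 with ⟨b2,b2'⟩|⟨b2,b2',_,_⟩|⟨⟨b2,_,_⟩,b2'⟩|⟨⟨b2,_,_⟩,b2',_,_⟩|⟨b2,b2',_,_⟩|⟨⟨b2,_,_⟩,b2'⟩ <;>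
    try (exfalso; linarith))

/-- At level `0` there are two exceptional configurations. -/
theorem four_blocks_zero_arith (h a tx ty tz tw xy xz yz xw yw zw cxy cxz cyz cxw cyw czw ex ey ez ew : ℤ)
  (hh : 2 ≤ h) (ha : 1 ≤ a) (hb : a + 3 ≤ 2*h) (n : 0 ≤ tw) (u : tx ≤ h-1) (o1 : ty ≤ tx)
      (o2 : tz ≤ ty) (o3 : tw ≤ tz)
  (nex : 0 ≤ ex) (fx : ex = tx ∨ tx ≤ a - h ∨ (tx ≤ a - h + 1 ∧ tx ≤ a - h + 1))
  (ney : 0 ≤ ey) (fy : ey = ty ∨ ty ≤ a - h ∨ (ty ≤ a - h + 1 ∧ tx ≤ a - h + 1))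
  (nez : 0 ≤ ez) (fz : ez = tz ∨ tz ≤ a - h ∨ (tz ≤ a - h + 1 ∧ tx ≤ a - h + 1))
  (new : 0 ≤ ew) (fw : ew = tw ∨ tw ≤ a - h ∨ (tw ≤ a - h + 1 ∧ tx ≤ a - h + 1))
  (ncxy : 0 ≤ cxy)
  (nzw : 0 ≤ zw) (nczw : 0 ≤ czw)
  (ncxz : 0 ≤ cxz)
  (nyw : 0 ≤ yw) (ncyw : 0 ≤ cyw)
  (ncyz : 0 ≤ cyz)
  (nxw : 0 ≤ xw) (ncxw : 0 ≤ cxw)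
  (hC : cxy + cxz + cyz + cxw + cyw + czw + ex + ey + ez + ew ≤ a)
  (Lx : xy + xz + xw + ty + tz + tw ≤ 3*h-2)
  (Ly : xy + yz + yw + tx + tz + tw ≤ 3*h-2)
  (Lz : xz + yz + zw + tx + ty + tw ≤ 3*h-2)
  (Lw : xw + yw + zw + tx + ty + tz ≤ 3*h-2)
  (quad : 6*h-5+a ≤ xy+xz+yz+xw+yw+zw+2*(tx+ty+tz+tw))
  (bxy : (xy + tw ≤ h-1) ∨ (xy = cxy ∧ ez = tz ∧ ew = tw))
  (bzw : (zw + ty ≤ h-1) ∨ (zw = czw ∧ ex = tx ∧ ey = ty))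
  (bxz : (xz + tw ≤ h-1) ∨ (xz = cxz ∧ ey = ty ∧ ew = tw))
  (byw : (yw + tz ≤ h-1) ∨ (yw = cyw ∧ ex = tx ∧ ez = tz))
  (byz : (yz + tw ≤ h-1) ∨ (yz = cyz ∧ ex = tx ∧ ew = tw))
  (bxw : (xw + tz ≤ h-1) ∨ (xw = cxw ∧ ey = ty ∧ ez = tz))
  : (a = 1 ∧ tx = 1 ∧ ty = 0 ∧ tz = 0 ∧ tw = 0 ∧ ex = 1 ∧ xy = h-1 ∧ xz = h-1 ∧ yz = h-1 ∧
      xw = h-1 ∧ yw = h-1 ∧ zw = h-1) ∨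
    (a = 2 ∧ tx = 1 ∧ ty = 1 ∧ tz = 0 ∧ tw = 0 ∧ ex = 1 ∧ ey = 1 ∧ xy = h-1 ∧ xz = h-1 ∧
        yz = h-1 ∧ xw = h-1 ∧ yw = h-1 ∧ zw = h-2) := by
  have T0 : 2 * a - 2 ≤ tx+ty+tz+tw := by linarith
  have hE : ex + ey + ez + ew ≤ a := by linarith
  -- Otherwise `a = 2h - 3` and all triples have `h - 2` colors. Then each pair class has at most
  -- one color, too few for `quad`.
  have ha2 : a ≤ h - 1 := by
    by_contra hcon
    have h1 : tx ≤ a - h + 1 := by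
      by_contra h1
      clear hC bxy bzw bxz byw byz bxw Lx Ly Lz Lw quad
      have w : ∀ t e : ℤ, e = t ∨ t ≤ a - h ∨ (t ≤ a - h + 1 ∧ tx ≤ a - h + 1) →
          e = t ∨ t ≤ a - h := by
        rintro t e (h | h | ⟨-, h⟩)
        · exact Or.inl h
        · exact Or.inr h
        · exact absurd h h1
      rcases w _ _ fx with hx | hx <;> rcases w _ _ fy with hy | hy <;>
        rcases w _ _ fz with hz | hz <;> rcases w _ _ fw with hw | hw <;>
        clear fx fy fz fw <;> omega
    clear fx fy fz fw
    have h2 : a = 2 * h - 3 := by clear bxy bzw bxz byw byz bxw; omega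
    have h3 : tx = h - 2 ∧ ty = h - 2 ∧ tz = h - 2 ∧ tw = h - 2 := by
      clear bxy bzw bxz byw byz bxw; omega
    obtain ⟨rfl, rfl, rfl, rfl⟩ := h3
    subst h2
    have k : ∀ p c e f : ℤ, p + (h - 2) ≤ h - 1 ∨ (p = c ∧ e = h - 2 ∧ f = h - 2) →
        c + e + f ≤ 2 * h - 3 → p ≤ 1 := by
      rintro p c e f (h | h) <;> omega
    have := k _ _ _ _ bxy (by linarith)
    have := k _ _ _ _ bxz (by linarith)
    have := k _ _ _ _ byz (by linarith)
    have := k _ _ _ _ bxw (by linarith)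
    have := k _ _ _ _ byw (by linarith)
    have := k _ _ _ _ bzw (by linarith)
    linarith
  -- For `a ≤ h - 1` a triple not consisting of forbidden colors is empty. So the triples have at
  -- most `a` colors in total, and `T0` leaves only `a ≤ 2`.
  have w : ∀ t e : ℤ, 0 ≤ t → e = t ∨ t ≤ a - h ∨ (t ≤ a - h + 1 ∧ tx ≤ a - h + 1) → 0 ≤ e →
      t ≤ e := by
    rintro t e h0 (h | h | h) h3 <;> omega
  have gx := w _ _ (by linarith) fx nex
  have gy := w _ _ (by linarith) fy ney
  have gz := w _ _ (by linarith) fz nez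
  have gw := w _ _ (by linarith) fw new
  clear fx fy fz fw w
  have hl : a ≤ 2 := by linarith
  have hC' : tx + ty + tz + tw ≤ a := by linarith
  have hx1 : tz = 0 ∧ tw = 0 ∧ ty ≤ 1 := by clear bxy bxz byz bxw byw bzw; omega
  have e1 : xy ≤ h - 1 := by rcases bxy with b | ⟨b, -, -⟩ <;> linarith
  have e2 : xz ≤ h - 1 := by rcases bxz with b | ⟨b, -, -⟩ <;> linarith
  have e3 : yz ≤ h - 1 := by rcases byz with b | ⟨b, -, -⟩ <;> linarith
  have e4 : xw ≤ h - 1 := by rcases bxw with b | ⟨b, -, -⟩ <;> linarith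
  have e5 : yw ≤ h - 1 := by rcases byw with b | ⟨b, -, -⟩ <;> linarith
  have e6 : zw + ty ≤ h - 1 := by rcases bzw with b | ⟨b, b', b''⟩ <;> linarith
  clear bxy bxz byz bxw byw bzw
  have : a = 1 ∨ a = 2 := by omega
  rcases this with rfl | rfl
  · left; omega
  · right; omega

set_option maxHeartbeats 4000000 in
/-- The only leftover part, in which the list `w` may consist of known colors. -/
theorem last_level_arith (h tx ty tz tw xy xz yz xw yw zw cxy cxz cyz cxw cyw czw ex ey ez ew : ℤ)
  (hh : 2 ≤ h)
  (nx : 0 ≤ tx) (ux : tx ≤ h-1)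
  (ny : 0 ≤ ty) (uy : ty ≤ h-1)
  (nz : 0 ≤ tz) (uz : tz ≤ h-1)
  (nw : 0 ≤ tw) (uw : tw ≤ h-1)
  (nxy : 0 ≤ xy) (ncxy : 0 ≤ cxy)
  (nzw : 0 ≤ zw) (nczw : 0 ≤ czw)
  (nxz : 0 ≤ xz) (ncxz : 0 ≤ cxz)
  (nyw : 0 ≤ yw) (ncyw : 0 ≤ cyw)
  (nyz : 0 ≤ yz) (ncyz : 0 ≤ cyz)
  (nxw : 0 ≤ xw) (ncxw : 0 ≤ cxw)
  (nex : 0 ≤ ex)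
  (ney : 0 ≤ ey)
  (nez : 0 ≤ ez)
  (new : 0 ≤ ew)
  (hC : cxy + cxz + cyz + cxw + cyw + czw + ex + ey + ez + ew ≤ 2*h-2)
  (Lx : xy + xz + xw + ty + tz + tw ≤ 3*h-2)
  (Ly : xy + yz + yw + tx + tz + tw ≤ 3*h-2)
  (Lz : xz + yz + zw + tx + ty + tw ≤ 3*h-2)
  (Lw : xw + yw + zw + tx + ty + tz ≤ 3*h-2)
  (o1 : ty ≤ tx) (o2 : tz ≤ ty)
  (Tx : tx ≤ h-2 ∨ ex = tx)
  (Ty : ty ≤ h-2 ∨ ey = ty)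
  (Tz : tz ≤ h-2 ∨ ez = tz)
  (bxw : xw + tz ≤ h-2 ∨ (xw = 0 ∧ yz + tx + tw = 2*h-2) ∨ (xw = cxw ∧ ey = ty ∧ ez = tz))
  (byw : yw + tz ≤ h-2 ∨ (yw = 0 ∧ xz + ty + tw = 2*h-2) ∨ (yw = cyw ∧ ex = tx ∧ ez = tz))
  (bzw : zw + ty ≤ h-2 ∨ (zw = 0 ∧ xy + tz + tw = 2*h-2) ∨ (zw = czw ∧ ex = tx ∧ ey = ty))
  (bxy : xy + tz ≤ h-2 ∨ xy + tw ≤ h-1 ∨ (xy = 0 ∧ zw + tx + ty = 2*h-2) ∨ (xy = cxy ∧ ez = tz ∧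
      ew = tw))
  (bxz : xz + ty ≤ h-2 ∨ xz + tw ≤ h-1 ∨ (xz = 0 ∧ yw + tx + tz = 2*h-2) ∨ (xz = cxz ∧ ey = ty ∧
      ew = tw))
  (byz : yz + tx ≤ h-2 ∨ yz + tw ≤ h-1 ∨ (yz = 0 ∧ xw + ty + tz = 2*h-2) ∨ (yz = cyz ∧ ex = tx ∧
      ew = tw))
  (U : 8*h-7 ≤ xy+xz+yz+xw+yw+zw+2*(tx+ty+tz+tw) ∨
    5*h-4 ≤ xy+xz+yz+tx+ty+tz+tw+tw ∨
    5*h-4 ≤ xy+xw+yw+tx+ty+tz+tw+tz ∨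
    5*h-4 ≤ xz+xw+zw+tx+ty+tz+tw+ty ∨
    5*h-4 ≤ yz+yw+zw+tx+ty+tz+tw+tx) : False := by
  rcases U with quad | trip | trip | trip | trip
  -- The triples miss their maximum `4(h - 1)` by at most two in total. Three triples of size `h -
  -- 1` among `x`, `y`, `z` would all be forbidden, more than `2h - 2` colors. A few patterns of
  -- deficits remain.
  · have T0 : 4*h-6 ≤ tx+ty+tz+tw := by linarith
    have hz : tz ≤ h-2 := by
      by_contra hc
      rcases Tx with Tx | Tx <;> rcases Ty with Ty | Ty <;>
        rcases Tz with Tz | Tz <;> linarith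
    obtain ⟨dx, rfl⟩ : ∃ d, tx = h-1-d := ⟨h-1-tx, by ring⟩
    obtain ⟨dy, rfl⟩ : ∃ d, ty = h-1-d := ⟨h-1-ty, by ring⟩
    obtain ⟨dz, rfl⟩ : ∃ d, tz = h-1-d := ⟨h-1-tz, by ring⟩
    obtain ⟨dw, rfl⟩ : ∃ d, tw = h-1-d := ⟨h-1-tw, by ring⟩
    have : (dx = 0 ∧ dy = 0 ∧ dz = 1 ∧ dw = 0) ∨
        (dx = 0 ∧ dy = 0 ∧ dz = 1 ∧ dw = 1) ∨
        (dx = 0 ∧ dy = 0 ∧ dz = 2 ∧ dw = 0) ∨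
        (dx = 0 ∧ dy = 1 ∧ dz = 1 ∧ dw = 0) := by omega
    have hx : dx = 0 := by omega
    subst hx
    rcases Tx with Tx | Tx
    · omega
    rcases this with ⟨_, rfl, rfl, rfl⟩ | ⟨_, rfl, rfl, rfl⟩ |
        ⟨_, rfl, rfl, rfl⟩ | ⟨_, rfl, rfl, rfl⟩
    · omega
    · omega
    · omega
    · omega
  · have t0 : h-2 ≤ tw := by linarith
    all_goals (rcases bxy with bxy | bxy | ⟨bxy, bxy'⟩ | ⟨bxy, bxy', _⟩ <;>
      try (exfalso; linarith))
    all_goals (rcases bxz with bxz | bxz | ⟨bxz, bxz'⟩ | ⟨bxz, bxz', _⟩ <;>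
      try (exfalso; linarith))
    all_goals (rcases byz with byz | byz | ⟨byz, byz'⟩ | ⟨byz, byz', _⟩ <;>
      try (exfalso; linarith))
    all_goals (rcases Tx with Tx | Tx <;> rcases Ty with Ty | Ty <;> rcases Tz with Tz | Tz <;>
      try (exfalso; linarith))
  · have t0 : h-2 ≤ tz := by linarith
    all_goals (rcases bxy with bxy | bxy | ⟨bxy, bxy'⟩ | ⟨bxy, bxy', _⟩ <;>
      try (exfalso; linarith))
    all_goals (rcases bxw with bxw | ⟨bxw, bxw'⟩ | ⟨bxw, bxw', _⟩ <;>
      try (exfalso; linarith))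
    all_goals (rcases byw with byw | ⟨byw, byw'⟩ | ⟨byw, byw', _⟩ <;>
      try (exfalso; linarith))
  · have t0 : h-2 ≤ ty := by linarith
    all_goals (rcases bxz with bxz | bxz | ⟨bxz, bxz'⟩ | ⟨bxz, bxz', _⟩ <;>
      try (exfalso; linarith))
    all_goals (rcases bxw with bxw | ⟨bxw, bxw'⟩ | ⟨bxw, bxw', _⟩ <;>
      try (exfalso; linarith))
    all_goals (rcases bzw with bzw | ⟨bzw, bzw'⟩ | ⟨bzw, bzw', _⟩ <;>
      try (exfalso; linarith))
  · have t0 : h-2 ≤ tx := by linarith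
    all_goals (rcases byz with byz | byz | ⟨byz, byz'⟩ | ⟨byz, byz', _⟩ <;>
      try (exfalso; linarith))
    all_goals (rcases byw with byw | ⟨byw, byw'⟩ | ⟨byw, byw', _⟩ <;>
      try (exfalso; linarith))
    all_goals (rcases bzw with bzw | ⟨bzw, bzw'⟩ | ⟨bzw, bzw', _⟩ <;>
      try (exfalso; linarith))

set_option maxHeartbeats 4000000 in
/-- Merging two lists of a part without triples. -/
theorem no_triples_arith (h m xy xz yz xw yw zw cxy cxz cyz cxw cyw czw : ℤ)
  (hh : 2 ≤ h) (hm0 : 0 ≤ m) (hm : m + 3 ≤ 2*h)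
  (nxy : 0 ≤ xy) (ncxy : 0 ≤ cxy)
  (nzw : 0 ≤ zw) (nczw : 0 ≤ czw)
  (nxz : 0 ≤ xz) (ncxz : 0 ≤ cxz)
  (nyw : 0 ≤ yw) (ncyw : 0 ≤ cyw)
  (nyz : 0 ≤ yz) (ncyz : 0 ≤ cyz)
  (nxw : 0 ≤ xw) (ncxw : 0 ≤ cxw)
  (sxy : xy ≤ 2*h-2 ∨ zw ≤ 2*h-2)
  (sxz : xz ≤ 2*h-2 ∨ yw ≤ 2*h-2)
  (syz : yz ≤ 2*h-2 ∨ xw ≤ 2*h-2)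
  (hC : cxy + cxz + cyz + cxw + cyw + czw ≤ m + 2)
  (Lx : xy + xz + xw ≤ 3*h-2)
  (Ly : xy + yz + yw ≤ 3*h-2)
  (Lz : xz + yz + zw ≤ 3*h-2)
  (Lw : xw + yw + zw ≤ 3*h-2)
  (bxy : xy + m + 1 ≤ h ∨ 2*h-1+m ≤ zw ∨ xy + 2*h-2 ≤ zw + m ∨ xy = cxy)
  (bzw : zw + m + 1 ≤ h ∨ 2*h-1+m ≤ xy ∨ zw + 2*h-2 ≤ xy + m ∨ zw = czw)
  (bxz : xz + m + 1 ≤ h ∨ 2*h-1+m ≤ yw ∨ xz + 2*h-2 ≤ yw + m ∨ xz = cxz)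
  (byw : yw + m + 1 ≤ h ∨ 2*h-1+m ≤ xz ∨ yw + 2*h-2 ≤ xz + m ∨ yw = cyw)
  (byz : yz + m + 1 ≤ h ∨ 2*h-1+m ≤ xw ∨ yz + 2*h-2 ≤ xw + m ∨ yz = cyz)
  (bxw : xw + m + 1 ≤ h ∨ 2*h-1+m ≤ yz ∨ xw + 2*h-2 ≤ yz + m ∨ xw = cxw)
  (U : 2*h-1+m ≤ xy ∨ 2*h-1+m ≤ zw ∨ 2*h-1+m ≤ xz ∨ 2*h-1+m ≤ yw ∨ 2*h-1+m ≤ yz ∨ 2*h-1+m ≤ xw ∨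
      5*h ≤ xy+xz+yz + m + 4 ∨ 5*h ≤ xy+xw+yw + m + 4 ∨ 5*h ≤ xz+xw+zw + m + 4 ∨
      5*h ≤ yz+yw+zw + m + 4 ∨ 6*h ≤ xy+xz+yz+xw+yw+zw+m+4)
  : False := by
  rcases U with U|U|U|U|U|U|U|U|U|U|U
  · rcases sxy with s1 | s1 <;> rcases bxy with bxy|bxy|bxy|bxy <;> linarith
  · rcases sxy with s1 | s1 <;> rcases bzw with bzw|bzw|bzw|bzw <;> linarith
  · rcases sxz with s1 | s1 <;> rcases bxz with bxz|bxz|bxz|bxz <;> linarith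
  · rcases sxz with s1 | s1 <;> rcases byw with byw|byw|byw|byw <;> linarith
  · rcases syz with s1 | s1 <;> rcases byz with byz|byz|byz|byz <;> linarith
  · rcases syz with s1 | s1 <;> rcases bxw with bxw|bxw|bxw|bxw <;> linarith
  · all_goals (rcases bxy with bxy|bxy|bxy|bxy <;> try (exfalso; linarith))
    all_goals (rcases bxz with bxz|bxz|bxz|bxz <;> try (exfalso; linarith))
    all_goals (rcases byz with byz|byz|byz|byz <;> try (exfalso; linarith))
  · all_goals (rcases bxy with bxy|bxy|bxy|bxy <;> try (exfalso; linarith))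
    all_goals (rcases bxw with bxw|bxw|bxw|bxw <;> try (exfalso; linarith))
    all_goals (rcases byw with byw|byw|byw|byw <;> try (exfalso; linarith))
  · all_goals (rcases bxz with bxz|bxz|bxz|bxz <;> try (exfalso; linarith))
    all_goals (rcases bxw with bxw|bxw|bxw|bxw <;> try (exfalso; linarith))
    all_goals (rcases bzw with bzw|bzw|bzw|bzw <;> try (exfalso; linarith))
  · all_goals (rcases byz with byz|byz|byz|byz <;> try (exfalso; linarith))
    all_goals (rcases byw with byw|byw|byw|byw <;> try (exfalso; linarith))
    all_goals (rcases bzw with bzw|bzw|bzw|bzw <;> try (exfalso; linarith))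
  · by_cases hU : 2*h-1+m ≤ xy ∨ 2*h-1+m ≤ zw ∨ 2*h-1+m ≤ xz ∨ 2*h-1+m ≤ yw ∨ 2*h-1+m ≤ yz ∨
      2*h-1+m ≤ xw
    · rcases hU with hU | hU | hU | hU | hU | hU
      · rcases sxy with s1 | s1 <;> rcases bxy with bxy|bxy|bxy|bxy <;> linarith
      · rcases sxy with s1 | s1 <;> rcases bzw with bzw|bzw|bzw|bzw <;> linarith
      · rcases sxz with s1 | s1 <;> rcases bxz with bxz|bxz|bxz|bxz <;> linarith
      · rcases sxz with s1 | s1 <;> rcases byw with byw|byw|byw|byw <;> linarith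
      · rcases syz with s1 | s1 <;> rcases byz with byz|byz|byz|byz <;> linarith
      · rcases syz with s1 | s1 <;> rcases bxw with bxw|bxw|bxw|bxw <;> linarith
    push Not at hU
    obtain ⟨h1, h2, h3, h4, h5, h6⟩ := hU
    -- Two complementary pairs are summarized by bounds on the sum of their classes; adding three
    -- such bounds contradicts `U`.
    have k : ∀ p q c d : ℤ, 0 ≤ p → 0 ≤ q → p < 2*h-1+m → q < 2*h-1+m → c ≤ m + 2 → d ≤ m + 2 →
        (p + m + 1 ≤ h ∨ 2*h-1+m ≤ q ∨ p + 2*h-2 ≤ q + m ∨ p = c) →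
        (q + m + 1 ≤ h ∨ 2*h-1+m ≤ p ∨ q + 2*h-2 ≤ p + m ∨ q = d) →
        p + q ≤ 2*h-2-2*m ∨ p + q ≤ h-1-m+c ∨ p + q ≤ h-1-m+d ∨ p + q ≤ c + d ∨
          p + q ≤ 2*c+m-2*h+2 ∨ p + q ≤ 2*d+m-2*h+2 := by
      rintro p q c d _ _ _ _ _ _ (h1 | h1 | h1 | h1) (h2 | h2 | h2 | h2) <;> omega
    have k1 := k xy zw cxy czw (by linarith) (by linarith) h1 h2 (by linarith) (by linarith) bxy bzw
    have k2 := k xz yw cxz cyw (by linarith) (by linarith) h3 h4 (by linarith) (by linarith) bxz byw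
    have k3 := k yz xw cyz cxw (by linarith) (by linarith) h5 h6 (by linarith) (by linarith) byz bxw
    clear bxy bzw bxz byw byz bxw sxy sxz syz k h1 h2 h3 h4 h5 h6
    rcases k1 with k1 | k1 | k1 | k1 | k1 | k1 <;> rcases k2 with k2 | k2 | k2 | k2 | k2 | k2 <;>
      rcases k3 with k3 | k3 | k3 | k3 | k3 | k3 <;> linarith

set_option maxHeartbeats 4000000 in
/-- Merging two lists if the condition on two blocks is not needed. -/
theorem relaxed_arith (h a m tx ty tz tw xy xz yz xw yw zw cxy cxz cyz cxw cyw czw : ℤ)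
  (ha : 1 ≤ a) (hm0 : 0 ≤ m) (hm : m + a + 2 ≤ 2*h)
  (nx : 0 ≤ tx)
  (ny : 0 ≤ ty)
  (nz : 0 ≤ tz)
  (nw : 0 ≤ tw)
  (nxy : 0 ≤ xy) (ncxy : 0 ≤ cxy)
  (nczw : 0 ≤ czw)
  (ncxz : 0 ≤ cxz)
  (ncyw : 0 ≤ cyw)
  (ncyz : 0 ≤ cyz)
  (ncxw : 0 ≤ cxw)
  (hC0 : tx+ty+tz+tw ≤ a)  (hC : cxy + cxz + cyz + cxw + cyw + czw + tx+ty+tz+tw ≤ a+m)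
  (pot : 4*h-3 ≤ xy+xz+yz+xw+yw+zw + 2*(tx+ty+tz+tw))
  (bxy : xy + 2*h-2 ≤ zw + tx+ty + m ∨ xy = cxy)
  (bzw : zw + 2*h-2 ≤ xy + tz+tw + m ∨ zw = czw)
  (bxz : xz + 2*h-2 ≤ yw + tx+tz + m ∨ xz = cxz)
  (byw : yw + 2*h-2 ≤ xz + ty+tw + m ∨ yw = cyw)
  (byz : yz + 2*h-2 ≤ xw + ty+tz + m ∨ yz = cyz)
  (bxw : xw + 2*h-2 ≤ yz + tx+tw + m ∨ xw = cxw)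
  : False := by
  rcases bxy with bxy|bxy <;> rcases bzw with bzw|bzw <;> rcases bxz with bxz|bxz <;>
    rcases byw with byw|byw <;> rcases byz with byz|byz <;> rcases bxw with bxw|bxw <;> linarith

/-! ### Obstructions to merging, and leftover parts -/

section

variable {A : Fin 4 → Finset ℕ} {h a b m : ℕ} {C C₀ D : Finset ℕ} {i j k l : Fin 4}

theorem Quad.swap_right (q : Quad i j k l) : Quad i j l k := by
  simp_all [Quad, eq_comm]

theorem Quad.swap_left (q : Quad i j k l) : Quad j i k l := by
  simp_all [Quad, eq_comm]

theorem Quad.swap_mid (q : Quad i j k l) : Quad i k j l := by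
  simp_all [Quad, eq_comm]

theorem Quad.swap_pairs (q : Quad i j k l) : Quad k l i j := by
  simp_all [Quad, eq_comm]

theorem exists_sorted (t : Fin 4 → ℕ) :
    ∃ i j k l, Quad i j k l ∧ t j ≤ t i ∧ t k ≤ t j ∧ t l ≤ t k := by
  have hm := Tuple.monotone_sort t
  have q : Quad 3 2 1 0 := by decide
  exact ⟨_, _, _, _, q.map (Tuple.sort t), hm (by decide), hm (by decide), hm (by decide)⟩

theorem classes_le {n : ℕ} (hn : ∀ i, #(A i) = n) (q : Quad i j k l) :
    #(dbl A i j) + #(dbl A i k) + #(dbl A i l) + #(tri A j) + #(tri A k) + #(tri A l) ≤ n ∧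
    #(dbl A i j) + #(dbl A j k) + #(dbl A j l) + #(tri A i) + #(tri A k) + #(tri A l) ≤ n ∧
    #(dbl A i k) + #(dbl A j k) + #(dbl A k l) + #(tri A i) + #(tri A j) + #(tri A l) ≤ n ∧
    #(dbl A i l) + #(dbl A j l) + #(dbl A k l) + #(tri A i) + #(tri A j) + #(tri A k) ≤ n := by
  have h1 := card_classes_le (A := A) q
  have h2 := card_classes_le (A := A) q.swap_left
  have h3 := card_classes_le (A := A) q.swap_pairs
  have h4 := card_classes_le (A := A) q.swap_pairs.swap_left
  rw [hn] at h1 h2 h3 h4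
  rw [dbl_comm j i] at h2
  rw [dbl_comm k i, dbl_comm k j] at h3
  rw [dbl_comm l i, dbl_comm l j, dbl_comm l k] at h4
  refine ⟨h1, ?_, ?_, ?_⟩ <;> omega

/-- What remains to be used of a pair of lists when merging them does not help. -/
theorem pair_bad (hh : 2 ≤ h) (hn : ∀ i, #(A i) = 3 * h - 2) (hq : ∀ c, ∃ i, c ∉ A i)
    (hbad : ¬ Good h b m False A C D) (q : Quad i j k l) :
    #(dbl A i j) + #(tri A k) + m + 1 ≤ h ∨ #(dbl A i j) + #(tri A l) + m + 1 ≤ h ∨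
    2 * h - 1 + m ≤ #(dbl A k l) + #(tri A i) + #(tri A j) ∨
    #(dbl A i j) + 2 * h ≤ #(dbl A k l) + #(tri A i) + #(tri A j) + m + 2 ∨
    (#(dbl A i j) = #(dbl A i j ∩ C) ∧ #(tri A k ∩ C) = #(tri A k) ∧
      #(tri A l ∩ C) = #(tri A l)) := by
  by_contra hcon
  push Not at hcon
  obtain ⟨h1, h2, h3, h4, h5⟩ := hcon
  refine hbad (good_of_pair hh hn hq q ?_ (Or.inr ⟨?_, ?_, ?_⟩) ?_)
  · intro hC
    rw [inter_eq_union hq q] at hC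
    have s1 := union_subset_left hC
    have s2 := union_subset_left (union_subset_right hC)
    have s3 := union_subset_right (union_subset_right hC)
    refine h5 ?_ ?_ ?_
    · rw [inter_eq_left.2 s1]
    · rw [inter_eq_left.2 s2]
    · rw [inter_eq_left.2 s3]
  all_goals omega

/-- If four blocks do not fit, then some two, some three or all four lists overlap a lot. -/
theorem four_bad (hh : 2 ≤ h) (hn : ∀ i, #(A i) = 3 * h - 2) (hq : ∀ c, ∃ i, c ∉ A i)
    (hbad : ¬ Good h b m False A C D) :
    (∃ i j k l, Quad i j k l ∧ 2 * h - 1 + m ≤ #(dbl A i j) + #(tri A k) + #(tri A l)) ∨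
    (∃ i j k l, Quad i j k l ∧ 5 * h ≤ #(dbl A i j) + #(dbl A i k) + #(dbl A j k) + #(tri A i) +
      #(tri A j) + #(tri A k) + 2 * #(tri A l) + m + 4) ∨
    (∀ i j k l, Quad i j k l → 8 * h ≤ #(dbl A i j) + #(dbl A i k) + #(dbl A i l) + #(dbl A j k) +
      #(dbl A j l) + #(dbl A k l) + 2 * (#(tri A i) + #(tri A j) + #(tri A k) + #(tri A l)) +
      b + m + 6) := by
  by_contra! hcon
  obtain ⟨h1, h2, i, j, k, l, q, h3⟩ := hcon
  refine hbad (good_of_four hh hn hq (Or.inr fun i j k l q => ?_) (fun i j k l q => ?_)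
    (fun i' j' k' l' q' => ?_))
  · have := h1 i j k l q
    omega
  · have := h2 i j k l q
    omega
  · have e1 := card_union_all hn hq q
    have e2 := card_union_all hn hq q'
    omega

/-- The properties of a part that is left over when a largest set of parts with a triple of merged
lists (represented by the colors in `C₀`) has been chosen; `a` is the number of parts not left
over. -/
structure Leftover (h a : ℕ) (C₀ : Finset ℕ) (A : Fin 4 → Finset ℕ) : Prop where
  card_eq : ∀ i, #(A i) = 3 * h - 2
  not_all : ∀ c, ∃ i, c ∉ A i
  pot : #(univ.biUnion A) ≤ 8 * h - 5
  card_le : #C₀ ≤ a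
  weak : ∀ i j k l, Quad i j k l → #(A i ∩ A j) ≤ 2 * h - 2 ∨ #(A k ∩ A l) ≤ 2 * h - 2
  tri_le : ∀ i, #(tri A i) ≤ h - 1
  free : ∀ i, tri A i ⊆ C₀ ∨ #(tri A i) + h ≤ a + 1
  swap : ∀ i j, tri A i ⊆ C₀ ∨ #(tri A i) + h ≤ a ∨ #(tri A j) + h ≤ a + 1

namespace Leftover

/-- `τ` stands for `max 0 (a + 1 - h)`, a bound on the colors of a triple that are not forbidden. -/
theorem tri_sub_le (hA : Leftover h a C₀ A) (hC : C₀ ⊆ C) (i : Fin 4) {τ : ℕ} (hτ : a + 1 ≤ h + τ) :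
    #(tri A i) ≤ #(tri A i ∩ C) + τ := by
  rcases hA.free i with hi | hi
  · rw [inter_eq_left.2 (hi.trans hC)]
    omega
  · omega

/-- Two triples inside `C₀` are disjoint there; otherwise one has at most `a + 1 - h` colors and the
other at most `h - 1`. -/
theorem tri_add_le (hA : Leftover h a C₀ A) (ha : a + 2 ≤ 2 * h) (hij : i ≠ j) :
    #(tri A i) + #(tri A j) ≤ a := by
  have hi := hA.tri_le i
  have hj := hA.tri_le j
  rcases hA.free i with fi | fi <;> rcases hA.free j with fj | fj
  · rw [← card_union_of_disjoint (disjoint_tri hij)]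
    exact (card_le_card (union_subset fi fj)).trans hA.card_le
  all_goals omega

theorem tri_sum_lt (hA : Leftover h a C₀ A) (ha0 : 1 ≤ a) (ha : a + 3 ≤ 2 * h)
    (q : Quad i j k l) :
    #(tri A i) + #(tri A j) + #(tri A k) + #(tri A l) + 1 ≤ 2 * a := by
  have hc := card_classes_inter_le (A := A) q C₀
  have h0 := hA.card_le
  have key : ∀ i, #(tri A i) ≤ h - 1 ∧ (#(tri A i ∩ C₀) = #(tri A i) ∨ #(tri A i) + h ≤ a + 1) := by
    intro i
    refine ⟨hA.tri_le i, (hA.free i).imp_left fun hi => ?_⟩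
    rw [inter_eq_left.2 hi]
  obtain ⟨i1, i2⟩ := key i
  obtain ⟨j1, j2⟩ := key j
  obtain ⟨k1, k2⟩ := key k
  obtain ⟨l1, l2⟩ := key l
  rcases i2 with i2 | i2 <;> rcases j2 with j2 | j2 <;> rcases k2 with k2 | k2 <;>
    rcases l2 with l2 | l2 <;> omega

/-- An intersection of `2h - 1` colors exceeds the at most `2h - 2` forbidden ones, and by `weak`
the complementary pair overlaps little, so the merged part is large enough. From here on all
pairwise intersections may be assumed to have at most `2h - 2` colors. -/
theorem good_of_large (hA : Leftover h a C₀ A) (hh : 2 ≤ h) (hC : #C ≤ a + m) (ham : a + m + 2 ≤ 2 * h)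
    (q : Quad i j k l) (hl : 2 * h - 1 ≤ #(A i ∩ A j)) : Good h b m False A C D := by
  have h1 : #(A k ∩ A l) ≤ 2 * h - 2 := by
    rcases hA.weak i j k l q with h1 | h1
    · omega
    · exact h1
  have hkl := hA.tri_add_le (by omega) q.2.2.2.2.2
  have hk := hA.tri_le k
  have hl' := hA.tri_le l
  have e1 := card_inter hA.not_all q
  have e2 := card_inter hA.not_all q.swap_pairs
  refine good_of_pair hh hA.card_eq hA.not_all q (fun hs => ?_) (Or.inr ⟨?_, ?_, ?_⟩) ?_
  · have := card_le_card hs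
    omega
  all_goals omega

end Leftover

end

/-! ### Leftover parts at positive levels -/

section

variable {A : Fin 4 → Finset ℕ} {h a b m : ℕ} {C C₀ D : Finset ℕ} {i j k l : Fin 4}

/-- `hb` and `hb'` describe the failure of merging a pair and of merging its complement. If three
blocks are too small after the first merging, the complementary overlap is large; then, apart from
the first alternative, only forbidden colors, expressed by `G`, can prevent the second. -/
theorem pair_bad_reduce {p p' ti tj tk tl : ℕ} {F G : Prop} (ham : a + m + 2 ≤ 2 * h)
    (sik : ti + tk ≤ a) (sjk : tj + tk ≤ a)
    (hP : p' + ti + tj ≤ 2 * h - 2) (hP' : p + tk + tl ≤ 2 * h - 2)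
    (hs : ti + tj + tk + tl + 1 ≤ 2 * a)
    (hb : p + tk + m + 1 ≤ h ∨ p + tl + m + 1 ≤ h ∨ 2 * h - 1 + m ≤ p' + ti + tj ∨
      p + 2 * h ≤ p' + ti + tj + m + 2 ∨ F)
    (hb' : p' + ti + m + 1 ≤ h ∨ p' + tj + m + 1 ≤ h ∨ 2 * h - 1 + m ≤ p + tk + tl ∨
      p' + 2 * h ≤ p + tk + tl + m + 2 ∨ G) :
    p + tk + m + 1 ≤ h ∨ p + tl + m + 1 ≤ h ∨ (p + 2 * h ≤ p' + ti + tj + m + 2 ∧ G) ∨ F := by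
  rcases hb with hb | hb | hb | hb | hb
  · exact Or.inl hb
  · exact Or.inr (Or.inl hb)
  · omega
  · rcases hb' with hb' | hb' | hb' | hb' | hb'
    · left; omega
    · left; omega
    · omega
    · omega
    · exact Or.inr (Or.inr (Or.inl ⟨hb, hb'⟩))
  · exact Or.inr (Or.inr (Or.inr hb))

/-- Sorting the triples leaves only the bound with the smaller triple on each side, which gives the
six joint alternatives of `four_blocks_arith`. -/
theorem pair_bad_combine {p p' ti tj tk tl : ℕ} {F G : Prop} (oij : tj ≤ ti) (okl : tl ≤ tk)
    (hb : p + tk + m + 1 ≤ h ∨ p + tl + m + 1 ≤ h ∨ (p + 2 * h ≤ p' + ti + tj + m + 2 ∧ G) ∨ F)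
    (hb' : p' + ti + m + 1 ≤ h ∨ p' + tj + m + 1 ≤ h ∨ (p' + 2 * h ≤ p + tk + tl + m + 2 ∧ F) ∨ G) :
    (p + tl + m + 1 ≤ h ∧ p' + tj + m + 1 ≤ h) ∨ (p + tl + m + 1 ≤ h ∧ G) ∨
    (F ∧ p' + tj + m + 1 ≤ h) ∨ (F ∧ G) ∨ (p + 2 * h ≤ p' + ti + tj + m + 2 ∧ G) ∨
    (F ∧ p' + 2 * h ≤ p + tk + tl + m + 2) := by
  have hb : p + tl + m + 1 ≤ h ∨ (p + 2 * h ≤ p' + ti + tj + m + 2 ∧ G) ∨ F := by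
    rcases hb with hb | hb | hb
    · exact Or.inl (by omega)
    · exact Or.inl hb
    · exact Or.inr hb
  have hb' : p' + tj + m + 1 ≤ h ∨ (p' + 2 * h ≤ p + tk + tl + m + 2 ∧ F) ∨ G := by
    rcases hb' with hb | hb | hb
    · exact Or.inl (by omega)
    · exact Or.inl hb
    · exact Or.inr hb
  rcases hb with hb | hb | hb
  · rcases hb' with hb' | hb' | hb'
    · exact Or.inl ⟨hb, hb'⟩
    · exact Or.inr (Or.inr (Or.inr (Or.inr (Or.inr ⟨hb'.2, hb'.1⟩))))
    · exact Or.inr (Or.inl ⟨hb, hb'⟩)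
  · exact Or.inr (Or.inr (Or.inr (Or.inr (Or.inl hb))))
  · rcases hb' with hb' | hb' | hb'
    · exact Or.inr (Or.inr (Or.inl ⟨hb, hb'⟩))
    · exact Or.inr (Or.inr (Or.inr (Or.inr (Or.inr ⟨hb'.2, hb'.1⟩))))
    · exact Or.inr (Or.inr (Or.inr (Or.inl ⟨hb, hb'⟩)))

theorem Leftover.pair_bad (hA : Leftover h a C₀ A) (hh : 2 ≤ h) (ha : 1 ≤ a) (hb : a + 3 ≤ 2 * h)
    (ham : a + m + 2 ≤ 2 * h)
    (small : ∀ i j k l, Quad i j k l → #(A i ∩ A j) ≤ 2 * h - 2)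
    (hbad : ¬ Good h b m False A C D) (q : Quad i j k l) :
    #(dbl A i j) + #(tri A k) + m + 1 ≤ h ∨ #(dbl A i j) + #(tri A l) + m + 1 ≤ h ∨
    (#(dbl A i j) + 2 * h ≤ #(dbl A k l) + #(tri A i) + #(tri A j) + m + 2 ∧
      (#(dbl A k l) = #(dbl A k l ∩ C) ∧ #(tri A i ∩ C) = #(tri A i) ∧
        #(tri A j ∩ C) = #(tri A j))) ∨
    (#(dbl A i j) = #(dbl A i j ∩ C) ∧ #(tri A k ∩ C) = #(tri A k) ∧
      #(tri A l ∩ C) = #(tri A l)) := by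
  have s1 := small _ _ _ _ q
  have s2 := small _ _ _ _ q.swap_pairs
  rw [card_inter hA.not_all q] at s1
  rw [card_inter hA.not_all q.swap_pairs] at s2
  exact pair_bad_reduce ham (hA.tri_add_le (by omega) q.2.1)
    (hA.tri_add_le (by omega) q.2.2.2.1) s2 s1 (hA.tri_sum_lt ha hb q)
    (K4.pair_bad hh hA.card_eq hA.not_all hbad q)
    (K4.pair_bad hh hA.card_eq hA.not_all hbad q.swap_pairs)

/-- If three lists overlap too much, the failures of merging the three pairs among them contradict
`three_blocks_arith`. This covers level `0` as well. -/
theorem Leftover.not_three_bad (hA : Leftover h a C₀ A) (hh : 2 ≤ h) (ha : 1 ≤ a)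
    (hb : a + 3 ≤ 2 * h) (ham : a + m + 2 ≤ 2 * h) (hC₀ : C₀ ⊆ C) (hC : #C ≤ a + m)
    (small : ∀ i j k l, Quad i j k l → #(A i ∩ A j) ≤ 2 * h - 2)
    (hbad : ¬ Good h b m False A C D) (q : Quad i j k l) :
    #(dbl A i j) + #(dbl A i k) + #(dbl A j k) + #(tri A i) + #(tri A j) + #(tri A k) +
      2 * #(tri A l) + m + 4 < 5 * h := by
  by_contra! hcon
  have b₀ := hA.pair_bad hh ha hb ham small hbad q
  have b₁ := hA.pair_bad hh ha hb ham small hbad q.swap_mid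
  have b₂ := hA.pair_bad hh ha hb ham small hbad q.swap_left.swap_mid
  obtain ⟨L1, L2, L3, L4⟩ := classes_le hA.card_eq q
  have hcl := (card_classes_inter_le (A := A) q C).trans hC
  obtain ⟨τ, hτ⟩ : ∃ τ : ℕ, (h ≤ a + 1 ∧ τ + h = a + 1) ∨ (a + 1 ≤ h ∧ τ = 0) :=
    ⟨a + 1 - h, by omega⟩
  have hτ' : a + 1 ≤ h + τ := by omega
  have fi := hA.tri_sub_le hC₀ i hτ'
  have fj := hA.tri_sub_le hC₀ j hτ'
  have fk := hA.tri_sub_le hC₀ k hτ'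
  have fl := hA.tri_sub_le hC₀ l hτ'
  have ui := hA.tri_le i
  have uj := hA.tri_le j
  have uk := hA.tri_le k
  have ul := hA.tri_le l
  have sij := hA.tri_add_le (by omega) q.1
  have sik := hA.tri_add_le (by omega) q.2.1
  have sil := hA.tri_add_le (by omega) q.2.2.1
  have sjk := hA.tri_add_le (by omega) q.2.2.2.1
  have sjl := hA.tri_add_le (by omega) q.2.2.2.2.1
  have skl := hA.tri_add_le (by omega) q.2.2.2.2.2
  apply three_blocks_arith h a m τ (#(tri A i)) (#(tri A j)) (#(tri A k)) (#(tri A l))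
    (#(dbl A i j)) (#(dbl A i k)) (#(dbl A j k)) (#(dbl A i l)) (#(dbl A j l)) (#(dbl A k l))
    (#(dbl A i j ∩ C)) (#(dbl A i k ∩ C)) (#(dbl A j k ∩ C))
    (#(dbl A i l ∩ C)) (#(dbl A j l ∩ C)) (#(dbl A k l ∩ C)) (#(tri A i ∩ C)) (#(tri A j ∩ C)) (#(tri A k ∩ C)) (#(tri A l ∩ C))
  case b0 => clear * - b₀; omega
  case b1 => clear * - b₁; omega
  case b2 => clear * - b₂; omega
  case hτ => clear * - hτ; omega
  all_goals (clear b₀ b₁ b₂ hτ; omega)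

/-- Every leftover part suits every positive level. -/
theorem Leftover.good_pos (hA : Leftover h a C₀ A) (hh : 2 ≤ h) (ha : 1 ≤ a) (hm : 1 ≤ m)
    (ham : a + m + 2 ≤ 2 * h) (hC₀ : C₀ ⊆ C) (hC : #C ≤ a + m) :
    Good h (2 * h - 1 - a) m False A C D := by
  by_contra hbad
  have small : ∀ i j k l, Quad i j k l → #(A i ∩ A j) ≤ 2 * h - 2 := by
    intro i j k l q
    by_contra! hcon
    exact hbad (hA.good_of_large hh hC ham q (by omega))
  have hb : a + 3 ≤ 2 * h := by omega
  rcases four_bad hh hA.card_eq hA.not_all hbad with ⟨i, j, k, l, q, h1⟩ | ⟨i, j, k, l, q, h1⟩ | h1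
  · have := small i j k l q
    rw [card_inter hA.not_all q] at this
    omega
  · have := hA.not_three_bad hh ha hb ham hC₀ hC small hbad q
    omega
  obtain ⟨i, j, k, l, q, o1, o2, o3⟩ := exists_sorted fun i => #(tri A i)
  have quad := h1 i j k l q
  have b₀ := hA.pair_bad hh ha hb ham small hbad q
  have b₀' := hA.pair_bad hh ha hb ham small hbad q.swap_pairs
  have b₁ := hA.pair_bad hh ha hb ham small hbad q.swap_mid
  have b₁' := hA.pair_bad hh ha hb ham small hbad q.swap_mid.swap_pairs
  have q₂ : Quad j k i l := q.swap_left.swap_mid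
  have b₂ := hA.pair_bad hh ha hb ham small hbad q₂
  have b₂' := hA.pair_bad hh ha hb ham small hbad q₂.swap_pairs
  obtain ⟨L1, L2, L3, L4⟩ := classes_le hA.card_eq q
  have hcl := (card_classes_inter_le (A := A) q C).trans hC
  obtain ⟨τ, hτ⟩ : ∃ τ : ℕ, (h ≤ a + 1 ∧ τ + h = a + 1) ∨ (a + 1 ≤ h ∧ τ = 0) :=
    ⟨a + 1 - h, by omega⟩
  have hτ' : a + 1 ≤ h + τ := by omega
  have fi := hA.tri_sub_le hC₀ i hτ'
  have fj := hA.tri_sub_le hC₀ j hτ'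
  have fk := hA.tri_sub_le hC₀ k hτ'
  have fl := hA.tri_sub_le hC₀ l hτ'
  have ui := hA.tri_le i
  have sij := hA.tri_add_le (by omega) q.1
  have ssum := hA.tri_sum_lt ha hb q
  clear h1 small hbad
  apply four_blocks_arith h a m τ (#(tri A i)) (#(tri A j)) (#(tri A k)) (#(tri A l))
    (#(dbl A i j)) (#(dbl A i k)) (#(dbl A j k)) (#(dbl A i l)) (#(dbl A j l)) (#(dbl A k l))
    (#(dbl A i j ∩ C)) (#(dbl A i k ∩ C)) (#(dbl A j k ∩ C))
    (#(dbl A i l ∩ C)) (#(dbl A j l ∩ C)) (#(dbl A k l ∩ C)) (#(tri A i ∩ C)) (#(tri A j ∩ C)) (#(tri A k ∩ C)) (#(tri A l ∩ C))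
  case b0 =>
    have key := pair_bad_combine o1 o3 b₀ b₀'
    clear * - key
    rcases key with key | key | key | key | key | key
    · left; omega
    · right; left; omega
    · right; right; left; omega
    · right; right; right; left; omega
    · right; right; right; right; left; omega
    · right; right; right; right; right; omega
  case b1 =>
    have key := pair_bad_combine (o2.trans o1) (o3.trans o2) b₁ b₁'
    clear * - key
    rcases key with key | key | key | key | key | key
    · left; omega
    · right; left; omega
    · right; right; left; omega
    · right; right; right; left; omega
    · right; right; right; right; left; omega
    · right; right; right; right; right; omega
  case b2 =>
    have key := pair_bad_combine o2 (o3.trans (o2.trans o1)) b₂ b₂'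
    clear * - key
    rcases key with key | key | key | key | key | key
    · left; omega
    · right; left; omega
    · right; right; left; omega
    · right; right; right; left; omega
    · right; right; right; right; left; omega
    · right; right; right; right; right; omega
  case hτ => clear * - hτ; omega
  all_goals (clear b₀ b₁ b₂ b₀' b₁' b₂' hτ; omega)

end

/-! ### Leftover parts at level zero -/

section

variable {A : Fin 4 → Finset ℕ} {h a b m : ℕ} {C C₀ D : Finset ℕ} {i j k l : Fin 4}

theorem subset_of_card_union_le {X D : Finset ℕ} (hc : #(X ∪ D) ≤ #X) : D ⊆ X := by
  have := eq_of_subset_of_card_le (subset_union_left (s₁ := X) (s₂ := D)) hc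
  rw [this]
  exact subset_union_right

/-- What remains to be used at level `0` of a pair of lists when merging them does not help. -/
theorem pair_zero_bad (hh : 2 ≤ h) (hn : ∀ i, #(A i) = 3 * h - 2) (hq : ∀ c, ∃ i, c ∉ A i)
    (hbad : ¬ Good h b 0 False A C D) (q : Quad i j k l) (hC : ¬ A i ∩ A j ⊆ C)
    (h3 : #(dbl A k l) + #(tri A i) + #(tri A j) ≤ 2 * h - 2)
    (h4 : #(dbl A k l) + #(tri A i) + #(tri A j) + 3 ≤ #(dbl A i j) + 2 * h) :
    #(dbl A i j) + #(tri A k) + 2 ≤ h ∨ #(dbl A i j) + #(tri A l) + 2 ≤ h ∨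
    #(A i ∩ A j ∪ A k ∪ D) < 4 * h - 2 ∨ #(A i ∩ A j ∪ A l ∪ D) < 4 * h - 2 := by
  by_contra! hcon
  obtain ⟨h5, h6, h7, h8⟩ := hcon
  exact hbad (good_of_pair_zero hh hn hq q hC ⟨by omega, by omega, h3⟩ ⟨h7, h8⟩ h4)

/-- If merging two lists fails at level `0` by one color, then the known colors are confined. -/
theorem subset_of_pair_zero_bad (hh : 2 ≤ h) (hn : ∀ i, #(A i) = 3 * h - 2)
    (hq : ∀ c, ∃ i, c ∉ A i) (hbad : ¬ Good h b 0 False A C D) (q : Quad i j k l)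
    (hC : ¬ A i ∩ A j ⊆ C)
    (h1 : h ≤ #(dbl A i j) + #(tri A k) + 1) (h2 : h ≤ #(dbl A i j) + #(tri A l) + 1)
    (h3 : #(dbl A k l) + #(tri A i) + #(tri A j) ≤ 2 * h - 2)
    (h4 : #(dbl A k l) + #(tri A i) + #(tri A j) + 3 ≤ #(dbl A i j) + 2 * h) :
    (#(dbl A i j) + #(tri A k) + 1 = h ∧ D ⊆ A i ∩ A j ∪ A k) ∨
    (#(dbl A i j) + #(tri A l) + 1 = h ∧ D ⊆ A i ∩ A j ∪ A l) := by
  have key : ∀ {k l}, Quad i j k l → h ≤ #(dbl A i j) + #(tri A k) + 1 →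
      #(A i ∩ A j ∪ A k ∪ D) < 4 * h - 2 →
      #(dbl A i j) + #(tri A k) + 1 = h ∧ D ⊆ A i ∩ A j ∪ A k := by
    intro k l q h1 h2
    have e := card_pair_union hn hq q
    have e' := card_le_card (subset_union_left (s₁ := A i ∩ A j ∪ A k) (s₂ := D))
    exact ⟨by omega, subset_of_card_union_le (by omega)⟩
  rcases pair_zero_bad hh hn hq hbad q hC h3 h4 with h5 | h5 | h5 | h5
  · omega
  · omega
  · exact Or.inl (key q h1 h5)
  · exact Or.inr (key q.swap_right h2 h5)

theorem mem_union_tri (hq : ∀ c, ∃ i, c ∉ A i) (q : Quad i j k l) {c : ℕ} :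
    c ∈ tri A i ∪ tri A j ∪ (tri A k ∪ tri A l) ↔
      (c ∈ A i ∧ c ∈ A j ∧ c ∈ A k ∨ c ∈ A i ∧ c ∈ A j ∧ c ∈ A l ∨ c ∈ A i ∧ c ∈ A k ∧ c ∈ A l ∨
        c ∈ A j ∧ c ∈ A k ∧ c ∈ A l) := by
  have h0 : ¬ (c ∈ A i ∧ c ∈ A j ∧ c ∈ A k ∧ c ∈ A l) := fun hc => by
    obtain ⟨x, hx⟩ := hq c
    exact hx ((q.forall (P := fun x => c ∈ A x)).2 hc x)
  rw [mem_union, mem_union, mem_union, mem_tri q, mem_tri q.swap_right,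
    mem_tri q.swap_mid.swap_right, mem_tri q.swap_left.swap_mid.swap_right]
  clear * - h0
  tauto

theorem card_union_dbl_tri_le (i j k l x y x' y' : Fin 4) : #(dbl A x y ∪ dbl A x' y' ∪
    (tri A i ∪ tri A j ∪ (tri A k ∪ tri A l))) ≤ #(dbl A x y) + #(dbl A x' y') +
      (#(tri A i) + #(tri A j) + #(tri A k) + #(tri A l)) := by
  have e2 := card_union_le (dbl A x y ∪ dbl A x' y') (tri A i ∪ tri A j ∪ (tri A k ∪ tri A l))
  have e3 := card_union_le (dbl A x y) (dbl A x' y')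
  have e4 := card_union_le (tri A i ∪ tri A j) (tri A k ∪ tri A l)
  have e5 := card_union_le (tri A i) (tri A j)
  have e6 := card_union_le (tri A k) (tri A l)
  omega

/-- A color in all four unions lies in three lists, or exactly in `j` and `k`, or exactly in `k` and
`l`. In the first exceptional configuration this confines `D` to `2h - 1` colors. -/
theorem card_le_of_subset_four (hq : ∀ c, ∃ i, c ∉ A i) (q : Quad i j k l)
    (f₁ : D ⊆ A j ∩ A k ∪ A l) (f₂ : D ⊆ A j ∩ A l ∪ A k) (f₃ : D ⊆ A k ∩ A l ∪ A j)
    (f₄ : D ⊆ A i ∩ A j ∪ A k) : #D ≤ #(dbl A j k) + #(dbl A k l) +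
      (#(tri A i) + #(tri A j) + #(tri A k) + #(tri A l)) := by
  refine (card_le_card fun c hc => ?_).trans (card_union_dbl_tri_le i j k l _ _ _ _)
  have g₁ := f₁ hc
  have g₂ := f₂ hc
  have g₃ := f₃ hc
  have g₄ := f₄ hc
  rw [mem_union, mem_union, mem_union_tri hq q, mem_dbl q.swap_left.swap_mid, mem_dbl q.swap_pairs]
  rw [mem_union, mem_inter] at g₁ g₂ g₃ g₄
  clear * - g₁ g₂ g₃ g₄
  tauto

theorem card_le_of_subset_three (hq : ∀ c, ∃ i, c ∉ A i) (q : Quad i j k l)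
    (f₁ : D ⊆ A i ∩ A k ∪ A l) (f₂ : D ⊆ A i ∩ A l ∪ A k) (f₃ : D ⊆ A j ∩ A k ∪ A l) :
    #D ≤ #(dbl A i l) + #(dbl A k l) +
      (#(tri A i) + #(tri A j) + #(tri A k) + #(tri A l)) := by
  refine (card_le_card fun c hc => ?_).trans (card_union_dbl_tri_le i j k l _ _ _ _)
  have g₁ := f₁ hc
  have g₂ := f₂ hc
  have g₃ := f₃ hc
  rw [mem_union, mem_union, mem_union_tri hq q, mem_dbl q.swap_left.swap_mid.swap_pairs,
    mem_dbl q.swap_pairs]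
  rw [mem_union, mem_inter] at g₁ g₂ g₃
  clear * - g₁ g₂ g₃
  tauto

theorem Leftover.pair_bad_zero (hA : Leftover h a C₀ A) (hh : 2 ≤ h) (ha : 1 ≤ a)
    (hb : a + 3 ≤ 2 * h) (small : ∀ i j k l, Quad i j k l → #(A i ∩ A j) ≤ 2 * h - 2)
    (hbad : ¬ Good h b 0 False A C D) (q : Quad i j k l) (o : #(tri A l) ≤ #(tri A k)) :
    #(dbl A i j) + #(tri A l) + 1 ≤ h ∨ (#(dbl A i j) = #(dbl A i j ∩ C) ∧
      #(tri A k ∩ C) = #(tri A k) ∧ #(tri A l ∩ C) = #(tri A l)) := by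
  have s1 := small _ _ _ _ q.swap_pairs
  rw [card_inter hA.not_all q.swap_pairs] at s1
  have ul := hA.tri_le l
  rcases hA.pair_bad hh ha hb (by omega) small hbad q with h1 | h1 | h1 | h1
  · left; omega
  · left; omega
  · left; omega
  · exact Or.inr h1

/-- Every leftover part suits level `0`, unless it is the only one. -/
theorem Leftover.good_zero (hA : Leftover h a C₀ A) (hh : 2 ≤ h) (ha : 1 ≤ a)
    (hb : a + 3 ≤ 2 * h) (hD : 3 * h - 2 ≤ #D) : Good h (2 * h - 1 - a) 0 False A C₀ D := by
  by_contra hbad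
  have small : ∀ i j k l, Quad i j k l → #(A i ∩ A j) ≤ 2 * h - 2 := by
    intro i j k l q
    by_contra! hcon
    exact hbad (hA.good_of_large hh hA.card_le (by omega) q (by omega))
  have hn := hA.card_eq
  have hq := hA.not_all
  rcases four_bad hh hn hq hbad with ⟨i, j, k, l, q, h1⟩ | ⟨i, j, k, l, q, h1⟩ | h1
  · have := small i j k l q
    rw [card_inter hq q] at this
    omega
  · have := hA.not_three_bad hh ha hb (by omega) subset_rfl hA.card_le small hbad q
    omega
  obtain ⟨i, j, k, l, q, o1, o2, o3⟩ := exists_sorted fun i => #(tri A i)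
  have quad := h1 i j k l q
  have b₀ := hA.pair_bad_zero hh ha hb small hbad q o3
  have b₀' := hA.pair_bad_zero hh ha hb small hbad q.swap_pairs o1
  have b₁ := hA.pair_bad_zero hh ha hb small hbad q.swap_mid (o3.trans o2)
  have b₁' := hA.pair_bad_zero hh ha hb small hbad q.swap_mid.swap_pairs (o2.trans o1)
  have q₂ : Quad j k i l := q.swap_left.swap_mid
  have b₂ := hA.pair_bad_zero hh ha hb small hbad q₂ (o3.trans (o2.trans o1))
  have b₂' := hA.pair_bad_zero hh ha hb small hbad q₂.swap_pairs o2
  obtain ⟨L1, L2, L3, L4⟩ := classes_le hn q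
  have hcl := (card_classes_inter_le (A := A) q C₀).trans hA.card_le
  have free : ∀ x, #(tri A x ∩ C₀) = #(tri A x) ∨ #(tri A x) + h ≤ a ∨
      (#(tri A x) + h ≤ a + 1 ∧ #(tri A i) + h ≤ a + 1) := by
    intro x
    rcases hA.free x with h2 | h2
    · exact Or.inl (by rw [inter_eq_left.2 h2])
    rcases hA.swap x i with h3 | h3 | h3
    · exact Or.inl (by rw [inter_eq_left.2 h3])
    · exact Or.inr (Or.inl h3)
    · exact Or.inr (Or.inr ⟨h2, h3⟩)
  have fi := free i
  have fj := free j
  have fk := free k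
  have fl := free l
  have ui := hA.tri_le i
  have key : ((a : ℤ) = 1 ∧ (#(tri A i) : ℤ) = 1 ∧ (#(tri A j) : ℤ) = 0 ∧ (#(tri A k) : ℤ) = 0 ∧ (#(tri A l) : ℤ) = 0 ∧ (#(tri A i ∩ C₀) : ℤ) = 1 ∧ (#(dbl A i j) : ℤ) = h - 1 ∧ (#(dbl A i k) : ℤ) = h - 1 ∧ (#(dbl A j k) : ℤ) = h - 1 ∧ (#(dbl A i l) : ℤ) = h - 1 ∧ (#(dbl A j l) : ℤ) = h - 1 ∧ (#(dbl A k l) : ℤ) = h - 1) ∨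
      ((a : ℤ) = 2 ∧ (#(tri A i) : ℤ) = 1 ∧ (#(tri A j) : ℤ) = 1 ∧ (#(tri A k) : ℤ) = 0 ∧ (#(tri A l) : ℤ) = 0 ∧ (#(tri A i ∩ C₀) : ℤ) = 1 ∧ (#(tri A j ∩ C₀) : ℤ) = 1 ∧ (#(dbl A i j) : ℤ) = h - 1 ∧ (#(dbl A i k) : ℤ) = h - 1 ∧ (#(dbl A j k) : ℤ) = h - 1 ∧ (#(dbl A i l) : ℤ) = h - 1 ∧ (#(dbl A j l) : ℤ) = h - 1 ∧ (#(dbl A k l) : ℤ) = h - 2) := by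
    clear h1 small hbad free hA q q₂ hn hq
    apply four_blocks_zero_arith h a (#(tri A i)) (#(tri A j)) (#(tri A k)) (#(tri A l))
      (#(dbl A i j)) (#(dbl A i k)) (#(dbl A j k)) (#(dbl A i l)) (#(dbl A j l)) (#(dbl A k l))
      (#(dbl A i j ∩ C₀)) (#(dbl A i k ∩ C₀)) (#(dbl A j k ∩ C₀)) (#(dbl A i l ∩ C₀)) (#(dbl A j l ∩ C₀)) (#(dbl A k l ∩ C₀))
      (#(tri A i ∩ C₀)) (#(tri A j ∩ C₀)) (#(tri A k ∩ C₀)) (#(tri A l ∩ C₀))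
    case bxy => clear * - b₀; omega
    case bzw => clear * - b₀'; omega
    case bxz => clear * - b₁; omega
    case byw => clear * - b₁'; omega
    case byz => clear * - b₂; omega
    case bxw => clear * - b₂'; omega
    case fx => clear * - fi; omega
    case fy => clear * - fj; omega
    case fz => clear * - fk; omega
    case fw => clear * - fl; omega
    all_goals (clear b₀ b₁ b₂ b₀' b₁' b₂' fi fj fk fl; omega)
  clear b₀ b₁ b₂ b₀' b₁' b₂' fi fj fk fl quad L1 L2 L3 L4 o1 o2 o3
  have hC := hA.card_le
  have bound : ∀ X : Finset ℕ, #X < 3 * h - 2 → ¬ D ⊆ X := fun X hX hs => by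
    have := card_le_card hs
    omega
  have not_sub : ∀ {x y z w}, Quad x y z w → #C₀ < #(dbl A x y) + #(tri A z) + #(tri A w) →
      ¬ A x ∩ A y ⊆ C₀ := fun q h1 hs => by
    have := card_le_card hs
    rw [card_inter hq q] at this
    omega
  -- In both exceptional configurations the merged pairs used below fail by exactly one color, so
  -- `D` lies in the unions concerned and has at most `2h - 1 < 3h - 2` colors.
  rcases key with key | key
  · obtain ⟨k1, k2, k3, k4, k5, k0, k6, k7, k8, k9, k10, k11⟩ := key
    have f₁ := subset_of_pair_zero_bad hh hn hq hbad q₂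
      (not_sub q₂ (by omega)) (by omega) (by omega) (by omega) (by omega)
    have f₂ := subset_of_pair_zero_bad hh hn hq hbad q.swap_mid.swap_pairs
      (not_sub q.swap_mid.swap_pairs (by omega)) (by omega) (by omega) (by omega) (by omega)
    have f₃ := subset_of_pair_zero_bad hh hn hq hbad q.swap_pairs
      (not_sub q.swap_pairs (by omega)) (by omega) (by omega) (by omega) (by omega)
    have f₄ := subset_of_pair_zero_bad hh hn hq hbad q
      -- For `h = 2` a comparison of sizes would not do here. The one forbidden color already lies
      -- in `tri A i`, so it cannot cover the nonempty class `dbl A i j`.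
      (fun hs => by
        rw [inter_eq_union hq q] at hs
        rw [inter_eq_left.2 (union_subset_left hs)] at hcl
        omega) (by omega) (by omega) (by omega) (by omega)
    replace f₁ := (f₁.resolve_left (by omega)).2
    replace f₂ := (f₂.resolve_left (by omega)).2
    replace f₃ := (f₃.resolve_left (by omega)).2
    rcases f₄ with ⟨-, f₄⟩ | ⟨-, f₄⟩
    · have := card_le_of_subset_four hq q f₁ f₂ f₃ f₄
      omega
    · rw [inter_comm] at f₃
      have := card_le_of_subset_four hq q.swap_right f₂ f₁ f₃ f₄
      rw [dbl_comm l k] at this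
      omega
  · obtain ⟨k1, k2, k3, k4, k5, -, -, k6, k7, k8, k9, k10, k11⟩ := key
    have f₁ := subset_of_pair_zero_bad hh hn hq hbad q.swap_mid
      (not_sub q.swap_mid (by omega)) (by omega) (by omega) (by omega) (by omega)
    have f₂ := subset_of_pair_zero_bad hh hn hq hbad q₂.swap_pairs
      (not_sub q₂.swap_pairs (by omega)) (by omega) (by omega) (by omega) (by omega)
    have f₃ := subset_of_pair_zero_bad hh hn hq hbad q₂
      (not_sub q₂ (by omega)) (by omega) (by omega) (by omega) (by omega)
    have := card_le_of_subset_three hq q (f₁.resolve_left (by omega)).2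
      (f₂.resolve_left (by omega)).2 (f₃.resolve_left (by omega)).2
    omega

end

/-! ### A single leftover part -/

section

variable {A : Fin 4 → Finset ℕ} {h a b m : ℕ} {C C₀ D : Finset ℕ} {i j k l : Fin 4}

theorem exists_quad_sorted (t : Fin 4 → ℕ) (w : Fin 4) :
    ∃ x y z, Quad x y z w ∧ t y ≤ t x ∧ t z ≤ t y := by
  have : ∀ w : Fin 4, ∃ x y z, Quad x y z w := by decide
  obtain ⟨x, y, z, q⟩ := this w
  rcases le_total (t x) (t y) with h1 | h1 <;> rcases le_total (t y) (t z) with h2 | h2 <;>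
    rcases le_total (t x) (t z) with h3 | h3
  · exact ⟨z, y, x, q.swap_left.swap_mid.swap_left, h2, h1⟩
  · exact ⟨z, y, x, q.swap_left.swap_mid.swap_left, h2, h1⟩
  · exact ⟨y, z, x, q.swap_left.swap_mid, h2, h3⟩
  · exact ⟨y, x, z, q.swap_left, h1, h3⟩
  · exact ⟨z, x, y, q.swap_mid.swap_left, h3, h1⟩
  · exact ⟨x, z, y, q.swap_mid, h3, h2⟩
  · exact ⟨x, y, z, q, h1, h2⟩
  · exact ⟨x, y, z, q, h1, h2⟩

theorem union_three_eq (q : Quad i j k l) : A i ∪ A j ∪ A k = (univ.erase l).biUnion A := by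
  ext c
  simp only [mem_union, mem_biUnion, mem_erase, mem_univ, and_true]
  constructor
  · rintro ((hc | hc) | hc)
    · exact ⟨i, q.2.2.1, hc⟩
    · exact ⟨j, q.2.2.2.2.1, hc⟩
    · exact ⟨k, q.2.2.2.2.2, hc⟩
  · rintro ⟨x, hx, hc⟩
    rcases q.cover x with rfl | rfl | rfl | rfl
    · exact Or.inl (Or.inl hc)
    · exact Or.inl (Or.inr hc)
    · exact Or.inr hc
    · exact absurd rfl hx

theorem three_sum_eq {i' j' k' : Fin 4} (hn : ∀ i, #(A i) = 3 * h - 2) (hq : ∀ c, ∃ i, c ∉ A i)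
    (q : Quad i j k l) (q' : Quad i' j' k' l) :
    #(dbl A i j) + #(dbl A i k) + #(dbl A j k) + #(tri A i) + #(tri A j) + #(tri A k) +
      2 * #(tri A l) = #(dbl A i' j') + #(dbl A i' k') + #(dbl A j' k') + #(tri A i') +
        #(tri A j') + #(tri A k') + 2 * #(tri A l) := by
  have e := card_union_three hn hq q
  have e' := card_union_three hn hq q'
  rw [union_three_eq q] at e
  rw [union_three_eq q'] at e'
  omega

/-- By `hk` the merged block and `A k` reach `4h - 2` colors together with `D`, so they may miss it
by one color on their own. -/
theorem pair_last_bad (hh : 2 ≤ h) (hn : ∀ i, #(A i) = 3 * h - 2) (hq : ∀ c, ∃ i, c ∉ A i)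
    (small : ∀ i j k l, Quad i j k l → #(A i ∩ A j) ≤ 2 * h - 2)
    (hbad : ¬ Good h b 0 False A C D) (q : Quad i j k l) (hk : 4 * h - 2 ≤ #(A k ∪ D)) :
    #(dbl A i j) + #(tri A k) + 2 ≤ h ∨
    (#(dbl A i j) + #(tri A l) + 1 ≤ h ∧
      (#(dbl A i j) + #(tri A l) + 2 ≤ h ∨ ¬ 4 * h - 2 ≤ #(A l ∪ D))) ∨
    (#(dbl A i j) = 0 ∧ #(dbl A k l) + #(tri A i) + #(tri A j) + 2 = 2 * h) ∨
    (#(dbl A i j) = #(dbl A i j ∩ C) ∧ #(tri A k ∩ C) = #(tri A k) ∧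
      #(tri A l ∩ C) = #(tri A l)) := by
  by_cases hC : A i ∩ A j ⊆ C
  · rw [inter_eq_union hq q] at hC
    have s1 := union_subset_left hC
    have s2 := union_subset_left (union_subset_right hC)
    have s3 := union_subset_right (union_subset_right hC)
    rw [inter_eq_left.2 s1, inter_eq_left.2 s2, inter_eq_left.2 s3]
    exact Or.inr (Or.inr (Or.inr ⟨rfl, rfl, rfl⟩))
  have s := small _ _ _ _ q.swap_pairs
  rw [card_inter hq q.swap_pairs] at s
  by_cases h4 : #(dbl A k l) + #(tri A i) + #(tri A j) + 3 ≤ #(dbl A i j) + 2 * h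
  · have sub : ∀ k, #(A k ∪ D) ≤ #(A i ∩ A j ∪ A k ∪ D) := fun k =>
      card_le_card (union_subset_union_left subset_union_right)
    have e2 := card_pair_union hn hq q.swap_right
    have e3 := card_le_card (subset_union_left (s₁ := A i ∩ A j ∪ A l) (s₂ := D))
    have sk := sub k
    have sl := sub l
    rcases pair_zero_bad hh hn hq hbad q hC s h4 with h5 | h5 | h5 | h5
    · exact Or.inl h5
    · exact Or.inr (Or.inl ⟨by omega, Or.inl h5⟩)
    · omega
    · exact Or.inr (Or.inl ⟨by omega, Or.inr (by omega)⟩)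
  · right; right; left
    omega

/-- A single leftover part suits level `0` if many colors are known to be taken. -/
theorem Leftover.good_last (hA : Leftover h (2 * h - 2) C₀ A) (hh : 2 ≤ h)
    (hD : 4 * h - 3 ≤ #D) : Good h 1 0 False A C₀ D := by
  by_contra hbad
  have small : ∀ i j k l, Quad i j k l → #(A i ∩ A j) ≤ 2 * h - 2 := by
    intro i j k l q
    by_contra! hcon
    exact hbad (hA.good_of_large hh hA.card_le (by omega) q (by omega))
  have hn := hA.card_eq
  have hq := hA.not_all
  -- Two exceptional lists would both lie in `D`, which would have at most `4h - 3` colors, whereas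
  -- their union has at least `4h - 2`.
  obtain ⟨w, hw⟩ : ∃ w, ∀ i, i ≠ w → 4 * h - 2 ≤ #(A i ∪ D) := by
    by_cases hw : ∃ w, ¬ 4 * h - 2 ≤ #(A w ∪ D)
    · obtain ⟨w, hw⟩ := hw
      refine ⟨w, fun i hi => ?_⟩
      by_contra hi'
      have quad : ∀ i j : Fin 4, i ≠ j → ∃ k l, Quad i j k l := by decide
      obtain ⟨k, l, q⟩ := quad i w hi
      have s := small i w k l q
      rw [card_inter hq q] at s
      have e := card_union_two hn hq q
      have sub : ∀ i, ¬ 4 * h - 2 ≤ #(A i ∪ D) → A i ⊆ D := fun i h1 =>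
        subset_of_card_union_le (by rw [union_comm]; omega)
      have h1 := card_le_card (union_subset (sub i hi') (sub w hw))
      have h2 := card_le_card (subset_union_right (s₁ := A w) (s₂ := D))
      omega
    · push Not at hw
      exact ⟨0, fun i _ => hw i⟩
  obtain ⟨x, y, z, q, o1, o2⟩ := exists_quad_sorted (fun i => #(tri A i)) w
  have hT : ∀ i, i ≠ w → #(tri A i) + 2 ≤ h ∨ #(tri A i ∩ C₀) = #(tri A i) := by
    intro i hi
    by_contra! hcon
    refine hbad (good_of_tri hn (i := i) (fun hs => ?_) (by omega) ?_)
    · exact hcon.2 (by rw [inter_eq_left.2 hs])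
    · exact (hw i hi).trans (card_le_card (union_subset_union_left subset_union_left))
  have Tx := hT x q.2.2.1
  have Ty := hT y q.2.2.2.2.1
  have Tz := hT z q.2.2.2.2.2
  have Wx := hw x q.2.2.1
  have Wy := hw y q.2.2.2.2.1
  have Wz := hw z q.2.2.2.2.2
  -- The orders are such that the third list, to which `hk` refers, is never the exceptional list
  -- `w`.
  have q₁ : Quad x w y z := q.swap_right.swap_mid
  have q₂ : Quad y w x z := q.swap_left.swap_right.swap_mid
  have q₃ : Quad z w x y := q.swap_pairs
  have b₀ := pair_last_bad hh hn hq small hbad q Wz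
  have b₁ := pair_last_bad hh hn hq small hbad q.swap_mid Wy
  have b₂ := pair_last_bad hh hn hq small hbad q.swap_left.swap_mid Wx
  have b₃ := pair_last_bad hh hn hq small hbad q₁ Wy
  have b₄ := pair_last_bad hh hn hq small hbad q₂ Wx
  have b₅ := pair_last_bad hh hn hq small hbad q₃ Wx
  obtain ⟨L1, L2, L3, L4⟩ := classes_le hn q
  have hcl := (card_classes_inter_le (A := A) q C₀).trans hA.card_le
  have ux := hA.tri_le x
  have uy := hA.tri_le y
  have uz := hA.tri_le z
  have uw := hA.tri_le w
  have U : 8 * h ≤ #(dbl A x y) + #(dbl A x z) + #(dbl A x w) + #(dbl A y z) +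
        #(dbl A y w) + #(dbl A z w) + 2 * (#(tri A x) + #(tri A y) + #(tri A z) + #(tri A w)) +
        1 + 0 + 6 ∨
      5 * h ≤ #(dbl A x y) + #(dbl A x z) + #(dbl A y z) + #(tri A x) + #(tri A y) +
        #(tri A z) + 2 * #(tri A w) + 0 + 4 ∨
      5 * h ≤ #(dbl A x y) + #(dbl A x w) + #(dbl A y w) + #(tri A x) + #(tri A y) +
        #(tri A w) + 2 * #(tri A z) + 0 + 4 ∨
      5 * h ≤ #(dbl A x z) + #(dbl A x w) + #(dbl A z w) + #(tri A x) + #(tri A z) +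
        #(tri A w) + 2 * #(tri A y) + 0 + 4 ∨
      5 * h ≤ #(dbl A y z) + #(dbl A y w) + #(dbl A z w) + #(tri A y) + #(tri A z) +
        #(tri A w) + 2 * #(tri A x) + 0 + 4 := by
    rcases four_bad hh hn hq hbad with ⟨i, j, k, l, q', h1⟩ | ⟨i, j, k, l, q', h1⟩ | h1
    · have := small i j k l q'
      rw [card_inter hq q'] at this
      omega
    · right
      rcases q.cover l with rfl | rfl | rfl | rfl
      · rw [three_sum_eq hn hq q' q.swap_left.swap_mid.swap_right] at h1
        exact Or.inr (Or.inr (Or.inr h1))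
      · rw [three_sum_eq hn hq q' q.swap_mid.swap_right] at h1
        exact Or.inr (Or.inr (Or.inl h1))
      · rw [three_sum_eq hn hq q' q.swap_right] at h1
        exact Or.inr (Or.inl h1)
      · rw [three_sum_eq hn hq q' q] at h1
        exact Or.inl h1
    · exact Or.inl (h1 x y z w q)
  clear small hbad hT hn hq q q₁ q₂ q₃ hw hA
  apply last_level_arith h
      (#(tri A x)) (#(tri A y)) (#(tri A z)) (#(tri A w))
      (#(dbl A x y)) (#(dbl A x z)) (#(dbl A y z)) (#(dbl A x w)) (#(dbl A y w)) (#(dbl A z w))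
      (#(dbl A x y ∩ C₀)) (#(dbl A x z ∩ C₀)) (#(dbl A y z ∩ C₀)) (#(dbl A x w ∩ C₀)) (#(dbl A y w ∩ C₀)) (#(dbl A z w ∩ C₀))
      (#(tri A x ∩ C₀)) (#(tri A y ∩ C₀)) (#(tri A z ∩ C₀)) (#(tri A w ∩ C₀))
  case bxy => clear * - b₀; omega
  case bxz => clear * - b₁; omega
  case byz => clear * - b₂; omega
  case bxw => clear * - b₃ Wz o2; omega
  case byw => clear * - b₄ Wz o1 o2; omega
  case bzw => clear * - b₅ Wy o1; omega
  case U => clear * - U; omega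
  all_goals (clear b₀ b₁ b₂ b₃ b₄ b₅ U; omega)

end

/-! ### The relaxed condition, and parts without triples -/

section

variable {A : Fin 4 → Finset ℕ} {h a b m : ℕ} {C C₀ D : Finset ℕ} {i j k l : Fin 4}

theorem relaxed_pair_bad (hh : 2 ≤ h) (hn : ∀ i, #(A i) = 3 * h - 2) (hq : ∀ c, ∃ i, c ∉ A i)
    (hbad : ¬ Good h b m True A C D) (q : Quad i j k l) :
    #(dbl A i j) + 2 * h ≤ #(dbl A k l) + #(tri A i) + #(tri A j) + m + 2 ∨
    #(dbl A i j) = #(dbl A i j ∩ C) := by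
  by_contra! hcon
  refine hbad (good_of_pair hh hn hq q (fun hC => ?_) (Or.inl trivial) (by omega))
  rw [inter_eq_union hq q] at hC
  exact hcon.2 (by rw [inter_eq_left.2 (union_subset_left hC)])

/-- If the condition on two blocks is not needed, merging some two lists is always possible. -/
theorem good_relaxed (hh : 2 ≤ h) (hn : ∀ i, #(A i) = 3 * h - 2) (hq : ∀ c, ∃ i, c ∉ A i)
    (pot : #(univ.biUnion A) ≤ 8 * h - 5) (ha : 1 ≤ a) (ham : a + m + 2 ≤ 2 * h)
    (hC₀ : #C₀ ≤ a) (htri : ∀ i, tri A i ⊆ C₀) (hs : C₀ ⊆ C) (hC : #C ≤ a + m) :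
    Good h b m True A C D := by
  by_contra hbad
  obtain ⟨i, j, k, l, q⟩ : ∃ i j k l, Quad i j k l := ⟨0, 1, 2, 3, by decide⟩
  have b₀ := relaxed_pair_bad hh hn hq hbad q
  have b₀' := relaxed_pair_bad hh hn hq hbad q.swap_pairs
  have b₁ := relaxed_pair_bad hh hn hq hbad q.swap_mid
  have b₁' := relaxed_pair_bad hh hn hq hbad q.swap_mid.swap_pairs
  have q₂ : Quad j k i l := q.swap_left.swap_mid
  have b₂ := relaxed_pair_bad hh hn hq hbad q₂
  have b₂' := relaxed_pair_bad hh hn hq hbad q₂.swap_pairs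
  have e := card_union_all hn hq q
  have hcl := (card_classes_inter_le (A := A) q C).trans hC
  have hcl₀ := (card_classes_inter_le (A := A) q C₀).trans hC₀
  have s : ∀ i, tri A i ∩ C = tri A i := fun i => inter_eq_left.2 ((htri i).trans hs)
  have s₀ : ∀ i, tri A i ∩ C₀ = tri A i := fun i => inter_eq_left.2 (htri i)
  rw [s, s, s, s] at hcl
  rw [s₀, s₀, s₀, s₀] at hcl₀
  clear s s₀ q q₂ hbad htri hn hq
  apply relaxed_arith h a m
      (#(tri A i)) (#(tri A j)) (#(tri A k)) (#(tri A l))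
      (#(dbl A i j)) (#(dbl A i k)) (#(dbl A j k)) (#(dbl A i l)) (#(dbl A j l)) (#(dbl A k l))
      (#(dbl A i j ∩ C)) (#(dbl A i k ∩ C)) (#(dbl A j k ∩ C)) (#(dbl A i l ∩ C)) (#(dbl A j l ∩ C)) (#(dbl A k l ∩ C))
  case bxy => clear * - b₀; omega
  case bzw => clear * - b₀'; omega
  case bxz => clear * - b₁; omega
  case byw => clear * - b₁'; omega
  case byz => clear * - b₂; omega
  case bxw => clear * - b₂'; omega
  all_goals (clear b₀ b₁ b₂ b₀' b₁' b₂'; omega)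

theorem no_triples_bad (hh : 2 ≤ h) (hn : ∀ i, #(A i) = 3 * h - 2) (hq : ∀ c, ∃ i, c ∉ A i)
    (notri : ∀ i, #(tri A i) = 0) (hbad : ¬ Good h b m False A C D) (q : Quad i j k l) :
    #(dbl A i j) + m + 1 ≤ h ∨ 2 * h - 1 + m ≤ #(dbl A k l) ∨
    #(dbl A i j) + 2 * h ≤ #(dbl A k l) + m + 2 ∨ #(dbl A i j) = #(dbl A i j ∩ C) := by
  have h1 := notri i
  have h2 := notri j
  have h3 := notri k
  have h4 := notri l
  rcases pair_bad hh hn hq hbad q with h5 | h5 | h5 | h5 | h5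
  · left; omega
  · left; omega
  · right; left; omega
  · right; right; left; omega
  · exact Or.inr (Or.inr (Or.inr h5.1))

/-- A part without triples suits a level if there are few forbidden colors. -/
theorem good_no_triples (hh : 2 ≤ h) (hn : ∀ i, #(A i) = 3 * h - 2) (hq : ∀ c, ∃ i, c ∉ A i)
    (notri : ∀ i, #(tri A i) = 0)
    (weak : ∀ i j k l, Quad i j k l → #(A i ∩ A j) ≤ 2 * h - 2 ∨ #(A k ∩ A l) ≤ 2 * h - 2)
    (hm : m + 3 ≤ 2 * h) (hC : #C ≤ m + 2) : Good h (2 * h - 2) m False A C D := by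
  by_contra hbad
  have key : ∀ i j k l, Quad i j k l → ¬ (2 * h - 1 + m ≤ #(dbl A i j) ∨
      5 * h ≤ #(dbl A i j) + #(dbl A i k) + #(dbl A j k) + m + 4 ∨
      6 * h ≤ #(dbl A i j) + #(dbl A i k) + #(dbl A j k) + #(dbl A i l) + #(dbl A j l) +
        #(dbl A k l) + m + 4) := by
    intro i j k l q U
    have b₀ := no_triples_bad hh hn hq notri hbad q
    have b₀' := no_triples_bad hh hn hq notri hbad q.swap_pairs
    have b₁ := no_triples_bad hh hn hq notri hbad q.swap_mid
    have b₁' := no_triples_bad hh hn hq notri hbad q.swap_mid.swap_pairs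
    have q₂ : Quad j k i l := q.swap_left.swap_mid
    have b₂ := no_triples_bad hh hn hq notri hbad q₂
    have b₂' := no_triples_bad hh hn hq notri hbad q₂.swap_pairs
    have w₀ := weak _ _ _ _ q
    have w₁ := weak _ _ _ _ q.swap_mid
    have w₂ := weak _ _ _ _ q₂
    rw [card_inter hq q, card_inter hq q.swap_pairs] at w₀
    rw [card_inter hq q.swap_mid, card_inter hq q.swap_mid.swap_pairs] at w₁
    rw [card_inter hq q₂, card_inter hq q₂.swap_pairs] at w₂
    have hcl := (card_classes_inter_le (A := A) q C).trans hC
    obtain ⟨L1, L2, L3, L4⟩ := classes_le hn q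
    have h1 := notri i
    have h2 := notri j
    have h3 := notri k
    have h4 := notri l
    clear q q₂ hbad hn hq weak notri
    apply no_triples_arith h m
        (#(dbl A i j)) (#(dbl A i k)) (#(dbl A j k)) (#(dbl A i l)) (#(dbl A j l)) (#(dbl A k l))
        (#(dbl A i j ∩ C)) (#(dbl A i k ∩ C)) (#(dbl A j k ∩ C)) (#(dbl A i l ∩ C)) (#(dbl A j l ∩ C)) (#(dbl A k l ∩ C))
    case bxy => clear * - b₀; omega
    case bzw => clear * - b₀'; omega
    case bxz => clear * - b₁; omega
    case byw => clear * - b₁'; omega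
    case byz => clear * - b₂; omega
    case bxw => clear * - b₂'; omega
    case sxy => clear * - w₀ h1 h2 h3 h4 hh; omega
    case sxz => clear * - w₁ h1 h2 h3 h4 hh; omega
    case syz => clear * - w₂ h1 h2 h3 h4 hh; omega
    case U =>
      clear * - U
      rcases U with U | U | U
      · left; omega
      · iterate 6 right
        left; omega
      · iterate 10 right
        omega
    all_goals (clear b₀ b₁ b₂ b₀' b₁' b₂' w₀ w₁ w₂ U; omega)
  rcases four_bad hh hn hq hbad with ⟨i, j, k, l, q, h1⟩ | ⟨i, j, k, l, q, h1⟩ | h1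
  · rw [notri, notri] at h1
    exact key i j k l q (Or.inl h1)
  · rw [notri, notri, notri, notri] at h1
    exact key i j k l q (Or.inr (Or.inl h1))
  · have q : Quad 0 1 2 3 := by decide
    have := h1 0 1 2 3 q
    rw [notri, notri, notri, notri] at this
    exact key 0 1 2 3 q (Or.inr (Or.inr (by omega)))

/-- A part in which of any two complementary pairs of lists only one meets suits all levels. -/
theorem good_of_disjoint_pairs (hh : 2 ≤ h) (hn : ∀ i, #(A i) = 3 * h - 2)
    (hq : ∀ c, ∃ i, c ∉ A i) (pot : #(univ.biUnion A) ≤ 8 * h - 5) (notri : ∀ i, #(tri A i) = 0)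
    (disj : ∀ i j k l, Quad i j k l → #(dbl A i j) = 0 ∨ #(dbl A k l) = 0)
    (hm : m + 2 ≤ 2 * h) (hC : #C ≤ m) : Good h b m False A C D := by
  by_contra hbad
  have bad : ∀ i j k l, Quad i j k l → (#(dbl A i j) = 0 ∧ (#(dbl A k l) + m + 1 ≤ h ∨
      #(dbl A k l) ≤ #(dbl A k l ∩ C))) ∨ (#(dbl A k l) = 0 ∧ (#(dbl A i j) + m + 1 ≤ h ∨
      #(dbl A i j) ≤ #(dbl A i j ∩ C))) := by
    intro i j k l q
    have b₀ := no_triples_bad hh hn hq notri hbad q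
    have b₀' := no_triples_bad hh hn hq notri hbad q.swap_pairs
    rcases disj i j k l q with h0 | h0
    · refine Or.inl ⟨h0, ?_⟩
      omega
    · refine Or.inr ⟨h0, ?_⟩
      omega
  obtain ⟨i, j, k, l, q⟩ : ∃ i j k l, Quad i j k l := ⟨0, 1, 2, 3, by decide⟩
  have b₀ := bad _ _ _ _ q
  have b₁ := bad _ _ _ _ q.swap_mid
  have b₂ := bad _ _ _ _ q.swap_left.swap_mid
  have e := card_union_all hn hq q
  have hcl := (card_classes_inter_le (A := A) q C).trans hC
  obtain ⟨L1, L2, L3, L4⟩ := classes_le hn q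
  rw [notri, notri, notri, notri] at e
  rw [notri, notri, notri] at L1 L2 L3 L4
  clear q hbad hn hq bad notri disj
  rcases b₀ with ⟨b₀, b₀' | b₀'⟩ | ⟨b₀, b₀' | b₀'⟩ <;>
    rcases b₁ with ⟨b₁, b₁' | b₁'⟩ | ⟨b₁, b₁' | b₁'⟩ <;>
    rcases b₂ with ⟨b₂, b₂' | b₂'⟩ | ⟨b₂, b₂' | b₂'⟩ <;> omega

end

/-! ### Greedy choices of blocks and their assembly -/

/-- Blocks for a part, together with colors representing the merged ones. -/
structure Blocks where
  num : ℕ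
  block : Fin num → Finset ℕ
  reps : Finset ℕ

instance : Inhabited Blocks := ⟨⟨0, fun _ => ∅, ∅⟩⟩

/-- The blocks `s` suit level `m`. -/
def Blocks.GoodAt (s : Blocks) (h b m : ℕ) (relax : Prop) (A : Fin 4 → Finset ℕ)
    (C D : Finset ℕ) : Prop :=
  K4.GoodAt h b m relax A C D s.num s.block s.reps

/-- Block choices for a sequence of parts, found greedily. -/
theorem exists_blocks {h b : ℕ} {relax : Prop} {C₀ D : Finset ℕ} (E : ℕ → Fin 4 → Finset ℕ)
    (good : ∀ m < b, ∀ C, C₀ ⊆ C → #C ≤ #C₀ + m → (m = 0 → C = C₀) →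
      Good h b m relax (E m) C D) (j : ℕ) (hj : j ≤ b) :
    ∃ s : ℕ → Blocks, ∀ m < j,
      (s m).GoodAt h b m relax (E m) (C₀ ∪ (range m).biUnion fun x => (s x).reps) D := by
  induction j with
  | zero => exact ⟨fun _ => default, fun m hm => absurd hm (Nat.not_lt_zero m)⟩
  | succ j ih =>
    obtain ⟨s, hs⟩ := ih (by omega)
    obtain ⟨N, M, R, hg⟩ := good j (by omega) (C₀ ∪ (range j).biUnion fun x => (s x).reps)
      subset_union_left (by
        refine (card_union_le _ _).trans (Nat.add_le_add_left ?_ _)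
        refine (card_biUnion_le_card_mul _ _ 1 fun x hx => ?_).trans (by simp)
        exact (hs x (mem_range.1 hx)).2.2.2.2.2.2.1) (by rintro rfl; simp)
    refine ⟨Function.update s j ⟨N, M, R⟩, fun m hm => ?_⟩
    have e : ((range m).biUnion fun x => (Function.update s j ⟨N, M, R⟩ x).reps) =
        (range m).biUnion fun x => (s x).reps := by
      refine biUnion_congr rfl fun x hx => ?_
      rw [Function.update_of_ne]
      have := mem_range.1 hx
      omega
    rw [e]
    rcases Nat.lt_succ_iff_lt_or_eq.1 hm with h1 | rfl
    · rw [Function.update_of_ne (by omega)]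
      exact hs m h1
    · rw [Function.update_self]
      exact hg

/-- Small blocks satisfy Hall's condition if they have distinct representatives, or are very large
in the parts of `P`. -/
theorem small_of_reps {ι : Type*} [Fintype ι] [DecidableEq ι] {h : ℕ}
    (hι : Fintype.card ι = 2 * h - 1) (s : ι → Blocks) (P : Finset ι)
    (disj : ∀ X ∉ P, ∀ Y ∉ P, X ≠ Y → Disjoint (s X).reps (s Y).reps)
    (hP : P = ∅ ∨ ∀ X ∉ P, #(s X).reps ≤ 1)
    (reps : ∀ X ∉ P, ∀ J : Finset (Fin (s X).num), (∀ j ∈ J, #((s X).block j) < 3 * h - 2) →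
      #J ≤ #(J.biUnion (s X).block ∩ (s X).reps))
    (num : ∀ X ∈ P, (s X).num ≤ 2)
    (large : ∀ X ∈ P, ∀ J : Finset (Fin (s X).num), #J * (2 * h - 1) ≤ #(J.biUnion (s X).block))
    (J : ∀ X, Finset (Fin (s X).num)) (hJ : ∀ X, ∀ j ∈ J X, #((s X).block j) < 3 * h - 2) :
    ∑ X, #(J X) ≤ #(univ.biUnion fun X => (J X).biUnion (s X).block) := by
  set U := univ.biUnion fun X => (J X).biUnion (s X).block with hU
  have sub : ∀ X, (J X).biUnion (s X).block ⊆ U := fun X =>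
    subset_biUnion_of_mem (fun X => (J X).biUnion (s X).block) (mem_univ X)
  by_cases hz : ∀ X ∈ P, #(J X) = 0
  · rw [← sum_add_sum_compl P, sum_eq_zero hz, zero_add]
    refine (sum_le_sum fun X hX => reps X (mem_compl.1 hX) (J X) (hJ X)).trans ?_
    rw [← card_biUnion]
    · exact card_le_card (biUnion_subset.2 fun X _ => inter_subset_left.trans (sub X))
    · intro X hX Y hY hXY
      exact (disj X (mem_compl.1 hX) Y (mem_compl.1 hY) hXY).mono inter_subset_right
        inter_subset_right
  -- A block of a part in `P` alone has `2h - 1` colors, enough for one block from each part. Two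
  -- blocks of such a part have `4h - 2`, enough for two from each.
  push Not at hz
  obtain ⟨X₀, hX₀, h0⟩ := hz
  have one : ∀ X ∉ P, #(J X) ≤ 1 := fun X hX => by
    rcases hP with rfl | hP
    · simp at hX₀
    · exact (reps X hX (J X) (hJ X)).trans ((card_le_card inter_subset_right).trans (hP X hX))
  have two : ∀ X ∈ P, #(J X) ≤ 2 := fun X hX => (card_le_univ _).trans (by simpa using num X hX)
  have key : ∀ X ∈ P, #(J X) * (2 * h - 1) ≤ #U := fun X hX =>
    (large X hX (J X)).trans (card_le_card (sub X))
  by_cases hz2 : ∃ X ∈ P, 2 ≤ #(J X)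
  · obtain ⟨X, hX, h2⟩ := hz2
    have h3 : ∑ X, #(J X) ≤ ∑ X : ι, 2 := sum_le_sum fun X _ => by
      by_cases hX : X ∈ P
      · exact two X hX
      · exact (one X hX).trans (by norm_num)
    rw [sum_const, card_univ, hι, smul_eq_mul] at h3
    have := Nat.mul_le_mul_right (2 * h - 1) h2
    have := key X hX
    omega
  · push Not at hz2
    have h3 : ∑ X, #(J X) ≤ ∑ X : ι, 1 := sum_le_sum fun X _ => by
      by_cases hX : X ∈ P
      · have := hz2 X hX
        omega
      · exact one X hX
    rw [sum_const, card_univ, hι, smul_eq_mul] at h3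
    have := Nat.mul_le_mul_right (2 * h - 1) (Nat.one_le_iff_ne_zero.2 h0)
    have := key X₀ hX₀
    omega

/-- The parts of `A` keep their given blocks. The others are numbered arbitrarily, the number being
the level, and served greedily in that order; every new representative avoids `C₀` and all earlier
ones. -/
theorem partColorable_of_good {ι : Type*} [Fintype ι] [DecidableEq ι] {h : ℕ} (hh : 2 ≤ h)
    (hι : Fintype.card ι = 2 * h - 1) {L : ι → Fin 4 → Finset ℕ} {A P : Finset ι} (hPA : P ⊆ A)
    (w : ι → ℕ) (s : ι → Blocks) {relax : Prop} {C₀ : Finset ℕ}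
    (sub : ∀ X ∈ A, X ∉ P → (s X).reps ⊆ C₀)
    (disj : ∀ X ∈ A, X ∉ P → ∀ Y ∈ A, Y ∉ P → X ≠ Y → Disjoint (s X).reps (s Y).reps)
    (fits : ∀ X ∈ A, ∀ i, ∃ j, (s X).block j ⊆ L X i)
    (sched : ∀ F ⊆ A, h ≤ #F → ∃ Y ∈ F, #F + 1 ≤ h + w Y)
    (num : ∀ X ∈ A, (s X).num ≤ 2)
    (hA : ∀ X ∈ A, w X = 0 ∨ 3 * h - 2 + w X ≤ #(univ.biUnion (s X).block))
    (hrelax : relax → h ≤ #(A.filter (h ≤ w ·)))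
    (hP : P = ∅ ∨ ∀ X ∈ A, X ∉ P → #(s X).reps ≤ 1)
    (reps : ∀ X ∈ A, X ∉ P → ∀ J : Finset (Fin (s X).num),
      (∀ j ∈ J, #((s X).block j) < 3 * h - 2) → #J ≤ #(J.biUnion (s X).block ∩ (s X).reps))
    (large : ∀ X ∈ P, ∀ J : Finset (Fin (s X).num), #J * (2 * h - 1) ≤ #(J.biUnion (s X).block))
    (good : ∀ X ∉ A, ∀ m < 2 * h - 1 - #A, ∀ C, C₀ ⊆ C → #C ≤ #C₀ + m → (m = 0 → C = C₀) →
      Good h (2 * h - 1 - #A) m relax (L X) C (A.biUnion fun Y => univ.biUnion (s Y).block)) :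
    PartColorable L := by
  set D := A.biUnion fun Y => univ.biUnion (s Y).block with hD
  have hb : #Aᶜ = 2 * h - 1 - #A := by rw [card_compl, hι]
  obtain ⟨lev, hlev, hinj⟩ : ∃ lev : ι → ℕ, (∀ X ∉ A, lev X < 2 * h - 1 - #A) ∧
      Set.InjOn lev (Aᶜ : Finset ι) := by
    let e := (Aᶜ).equivFinOfCardEq hb
    refine ⟨fun X => if hX : X ∈ Aᶜ then e ⟨X, hX⟩ else 0, fun X hX => ?_, fun X hX Y hY hXY => ?_⟩
    · have hX' := mem_compl.2 hX
      simp only [hX', dif_pos]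
      exact (e _).2
    · rw [mem_coe] at hX hY
      simp only [hX, hY, dif_pos] at hXY
      simpa using e.injective (Fin.ext hXY)
  -- The inverse of `lev`; the value at numbers that are not levels is irrelevant.
  let E : ℕ → ι := fun m => if hm : ∃ X ∉ A, lev X = m then hm.choose else Classical.choice
    (Fintype.card_pos_iff.1 (by omega))
  have hE : ∀ X ∉ A, E (lev X) = X := by
    intro X hX
    have hm : ∃ Y ∉ A, lev Y = lev X := ⟨X, hX, rfl⟩
    have : E (lev X) = hm.choose := dif_pos hm
    rw [this]
    exact hinj (by simpa using hm.choose_spec.1) (by simpa using hX) hm.choose_spec.2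
  have hE' : ∀ m < 2 * h - 1 - #A, E m ∉ A := by
    intro m hm
    have hm : ∃ Y ∉ A, lev Y = m := by
      have h1 : (Aᶜ).image lev = range (2 * h - 1 - #A) := by
        refine eq_of_subset_of_card_le (fun x hx => ?_) ?_
        · obtain ⟨X, hX, rfl⟩ := mem_image.1 hx
          exact mem_range.2 (hlev X (mem_compl.1 hX))
        · rw [card_image_of_injOn hinj, card_range, hb]
      have h2 := mem_range.2 hm
      rw [← h1] at h2
      obtain ⟨X, hX, h3⟩ := mem_image.1 h2
      exact ⟨X, mem_compl.1 hX, h3⟩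
    have : E m = hm.choose := dif_pos hm
    rw [this]
    exact hm.choose_spec.1
  obtain ⟨f, hf⟩ := exists_blocks (fun m => L (E m))
    (fun m hm C => good (E m) (hE' m hm) m hm C) _ le_rfl
  have hf' : ∀ X ∉ A, (f (lev X)).GoodAt h (2 * h - 1 - #A) (lev X) relax (L X)
      (C₀ ∪ (range (lev X)).biUnion fun x => (f x).reps) D := by
    intro X hX
    have := hf (lev X) (hlev X hX)
    rwa [hE X hX] at this
  let g : ι → Blocks := fun X => if X ∈ A then s X else f (lev X)
  have gA : ∀ X ∈ A, g X = s X := fun X hX => if_pos hX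
  have gB : ∀ X ∉ A, g X = f (lev X) := fun X hX => if_neg hX
  have gG : ∀ X ∉ A, (g X).GoodAt h (2 * h - 1 - #A) (lev X) relax (L X)
      (C₀ ∪ (range (lev X)).biUnion fun x => (f x).reps) D := fun X hX => by
    rw [gB X hX]
    exact hf' X hX
  have hDg : D = A.biUnion fun Y => univ.biUnion (g Y).block :=
    biUnion_congr rfl fun Y hY => by rw [gA Y hY]
  have dBA : ∀ X ∉ A, ∀ Y ∈ A, Y ∉ P → Disjoint (g X).reps (g Y).reps := by
    intro X hX Y hY hYP
    rw [gA Y hY]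
    exact (gG X hX).2.2.2.2.2.2.2.mono_right ((sub Y hY hYP).trans subset_union_left)
  have dBB : ∀ X ∉ A, ∀ Y ∉ A, lev X < lev Y → Disjoint (g Y).reps (g X).reps := by
    intro X hX Y hY hXY
    refine (gG Y hY).2.2.2.2.2.2.2.mono_right ?_
    rw [gB X hX]
    exact (subset_biUnion_of_mem (fun x => (f x).reps) (mem_range.2 hXY)).trans subset_union_right
  refine partColorable_of_levels hh hι A w lev (fun X => (g X).num) (fun X => (g X).block)
    ?_ sched ?_ ?_ ?_ hlev hinj ?_ ?_ ?_ ?_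
  · intro X i
    by_cases hX : X ∈ A
    · rw [gA X hX]
      exact fits X hX i
    · exact (gG X hX).2.1 i
  · intro X hX
    rw [gA X hX]
    exact num X hX
  · intro X hX
    rw [gA X hX]
    exact hA X hX
  · exact fun X hX => (gG X hX).1
  · by_cases hr : relax
    · exact Or.inl (hrelax hr)
    · refine Or.inr fun X hX => ?_
      rw [← hDg]
      exact (gG X hX).2.2.1.resolve_left hr
  · exact fun X hX => (gG X hX).2.2.2.1
  · exact fun X hX => (gG X hX).2.2.2.2.1
  · refine small_of_reps hι g P ?_ ?_ ?_ ?_ ?_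
    · intro X hX Y hY hXY
      by_cases hXA : X ∈ A <;> by_cases hYA : Y ∈ A
      · rw [gA X hXA, gA Y hYA]
        exact disj X hXA hX Y hYA hY hXY
      · exact (dBA Y hYA X hXA hX).symm
      · exact dBA X hXA Y hYA hY
      · rcases lt_trichotomy (lev X) (lev Y) with h1 | h1 | h1
        · exact (dBB X hXA Y hYA h1).symm
        · exact absurd (hinj (by simpa using hXA) (by simpa using hYA) h1) hXY
        · exact dBB Y hYA X hXA h1
    · refine hP.imp_right fun hP X hX => ?_
      by_cases hXA : X ∈ A
      · rw [gA X hXA]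
        exact hP X hXA hX
      · exact (gG X hXA).2.2.2.2.2.2.1
    · intro X hX
      by_cases hXA : X ∈ A
      · rw [gA X hXA]
        exact reps X hXA hX
      · exact (gG X hXA).2.2.2.2.2.1
    · intro X hX
      rw [gA X (hPA hX)]
      exact num X (hPA hX)
    · intro X hX
      rw [gA X (hPA hX)]
      exact large X hX

/-! ### Largest selections of parts with a merged triple -/

section

theorem exists_max_of_bounded {α : Type*} {p : α → Prop} {f : α → ℕ} (b : ℕ)
    (hb : ∀ x, p x → f x ≤ b) (hp : ∃ x, p x) : ∃ x, p x ∧ ∀ y, p y → f y ≤ f x := by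
  have bdd : BddAbove (f '' {x | p x}) := ⟨b, by rintro _ ⟨x, hx, rfl⟩; exact hb x hx⟩
  obtain ⟨x, hx, hfx⟩ := Nat.sSup_mem (Set.Nonempty.image f hp) bdd
  exact ⟨x, hx, fun y hy => hfx ▸ le_csSup bdd ⟨y, hy, rfl⟩⟩

/-- Two disjoint pairs of lists have large intersections. -/
def Strong (h : ℕ) (A : Fin 4 → Finset ℕ) : Prop :=
  ∃ i j k l, Quad i j k l ∧ 2 * h - 1 ≤ #(A i ∩ A j) ∧ 2 * h - 1 ≤ #(A k ∩ A l)

/-- Any `r ≥ h` parts of `A` include one of weight more than `r - h`. -/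
def Sched {ι : Type*} (h : ℕ) (A : Finset ι) (w : ι → ℕ) : Prop :=
  ∀ F ⊆ A, h ≤ #F → ∃ Y ∈ F, #F + 1 ≤ h + w Y

section

variable {ι : Type*} [DecidableEq ι]

/-- The weight of a part of `P` is `h`, that of another part the size of the merged block. -/
def weight (h : ℕ) (L : ι → Fin 4 → Finset ℕ) (P : Finset ι) (i : ι → Fin 4) (X : ι) : ℕ :=
  if X ∈ P then h else #(tri (L X) (i X))

/-- A set `T` of parts in which the lists other than `i X` are merged and represented by `c X`. -/
structure IsSelection (h : ℕ) (L : ι → Fin 4 → Finset ℕ) (P T : Finset ι) (i : ι → Fin 4)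
    (c : ι → ℕ) : Prop where
  disj : Disjoint P T
  mem : ∀ X ∈ T, c X ∈ tri (L X) (i X)
  inj : Set.InjOn c T
  sched : Sched h (P ∪ T) (weight h L P i)

variable {h : ℕ} {L : ι → Fin 4 → Finset ℕ} {P T : Finset ι} {i : ι → Fin 4} {c : ι → ℕ}

theorem weight_update {X Y : ι} {x : Fin 4} (hXY : Y ≠ X) :
    weight h L P (Function.update i X x) Y = weight h L P i Y := by
  simp [weight, hXY]

theorem weight_update_self {X : ι} {x : Fin 4} (hX : X ∉ P) :
    weight h L P (Function.update i X x) X = #(tri (L X) x) := by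
  simp [weight, hX]

/-- The number of parts is maximized first, then the total weight. The empty selection is admissible
because parts of `P` have weight `h` and there are at most `2h - 1` parts. -/
theorem exists_selection [Fintype ι] (hι : Fintype.card ι ≤ 2 * h - 1) (hh : 2 ≤ h)
    (L : ι → Fin 4 → Finset ℕ) (P : Finset ι) : ∃ T i c, IsSelection h L P T i c ∧
      (∀ T' i' c', IsSelection h L P T' i' c' → #T' ≤ #T) ∧
      (∀ T' i' c', IsSelection h L P T' i' c' → #T' = #T →
        ∑ X ∈ T', weight h L P i' X ≤ ∑ X ∈ T, weight h L P i X) := by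
  obtain ⟨⟨T₁, i₁, c₁⟩, h1, h1'⟩ := exists_max_of_bounded (α := Finset ι × (ι → Fin 4) × (ι → ℕ))
    (p := fun x => IsSelection h L P x.1 x.2.1 x.2.2) (f := fun x => #x.1) (Fintype.card ι)
    (fun x _ => card_le_univ _) ⟨⟨∅, fun _ => 0, fun _ => 0⟩, by simp, by simp, by simp, by
      intro F hF hc
      rw [union_empty] at hF
      obtain ⟨Y, hY⟩ := card_pos.1 (by omega : 0 < #F)
      refine ⟨Y, hY, ?_⟩
      have := (card_le_univ F).trans hι
      rw [weight, if_pos (hF hY)]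
      omega⟩
  obtain ⟨⟨T₂, i₂, c₂⟩, ⟨h2, h3⟩, h2'⟩ := exists_max_of_bounded
    (α := Finset ι × (ι → Fin 4) × (ι → ℕ))
    (p := fun x => IsSelection h L P x.1 x.2.1 x.2.2 ∧ #x.1 = #T₁)
    (f := fun x => ∑ X ∈ x.1, weight h L P x.2.1 X) (∑ X, (h + ∑ j, #(tri (L X) j)))
    (fun x _ => (sum_le_sum_of_subset (subset_univ _)).trans (sum_le_sum fun X _ => by
      have := single_le_sum (f := fun j => #(tri (L X) j)) (fun _ _ => Nat.zero_le _)
        (mem_univ (x.2.1 X))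
      rw [weight]
      split_ifs <;> omega)) ⟨⟨T₁, i₁, c₁⟩, h1, rfl⟩
  refine ⟨T₂, i₂, c₂, h2, fun T' i' c' h' => ?_, fun T' i' c' h' he => ?_⟩
  · exact (h1' ⟨T', i', c'⟩ h').trans h3.ge
  · exact h2' ⟨T', i', c'⟩ ⟨h', he.trans h3⟩

/-- In a largest selection, a representative also in a triple of a part that is not selected has at
least the weight of that triple. -/
theorem IsSelection.le_weight (hs : IsSelection h L P T i c)
    (hmax : ∀ T' i' c', IsSelection h L P T' i' c' → #T' = #T →
        ∑ X ∈ T', weight h L P i' X ≤ ∑ X ∈ T, weight h L P i X)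
    {X Y : ι} (hXP : X ∉ P) (hXT : X ∉ T) (hY : Y ∈ T) {x : Fin 4} (hc : c Y ∈ tri (L X) x) :
    #(tri (L X) x) ≤ weight h L P i Y := by
  by_contra! hcon
  have hXY : Y ≠ X := by rintro rfl; exact hXT hY
  have hne : ∀ Z ∈ T, Z ≠ X := by rintro Z hZ rfl; exact hXT hZ
  have hXe : X ∉ T.erase Y := fun hX => hXT (mem_of_mem_erase hX)
  -- Otherwise `X` could replace `Y` with the same color, increasing the total weight.
  have key := hmax (insert X (T.erase Y)) (Function.update i X x) (Function.update c X (c Y))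
    ⟨?_, ?_, ?_, ?_⟩ (by
      rw [card_insert_of_notMem hXe, card_erase_of_mem hY]
      have := card_pos.2 ⟨Y, hY⟩
      omega)
  · rw [sum_insert hXe, weight_update_self hXP, ← add_sum_erase T _ hY] at key
    have : ∑ Z ∈ T.erase Y, weight h L P (Function.update i X x) Z =
        ∑ Z ∈ T.erase Y, weight h L P i Z :=
      sum_congr rfl fun Z hZ => weight_update (hne Z (mem_of_mem_erase hZ))
    omega
  · rw [disjoint_insert_right]
    exact ⟨hXP, hs.disj.mono_right (erase_subset _ _)⟩
  · intro Z hZ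
    rcases mem_insert.1 hZ with rfl | hZ
    · simpa using hc
    · have hZT := mem_of_mem_erase hZ
      rw [Function.update_of_ne (hne Z hZT), Function.update_of_ne (hne Z hZT)]
      exact hs.mem Z hZT
  · intro Z hZ Z' hZ' he
    rw [mem_coe, mem_insert] at hZ hZ'
    have diff : ∀ W ∈ T.erase Y, Function.update c X (c Y) W ≠ Function.update c X (c Y) X := by
      intro W hW hWe
      have hWT := mem_of_mem_erase hW
      rw [Function.update_of_ne (hne W hWT), Function.update_self] at hWe
      exact ne_of_mem_erase hW (hs.inj hWT hY hWe)
    rcases hZ with rfl | hZ <;> rcases hZ' with rfl | hZ'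
    · rfl
    · exact absurd he.symm (diff _ hZ')
    · exact absurd he (diff _ hZ)
    · have hZT := mem_of_mem_erase hZ
      have hZT' := mem_of_mem_erase hZ'
      rw [Function.update_of_ne (hne Z hZT), Function.update_of_ne (hne Z' hZT')] at he
      exact hs.inj hZT hZT' he
  · intro F hF hc
    -- The scheduling condition is inherited by exchanging `X` for `Y` in `F`: the weight of `X`
    -- exceeds that of `Y`.
    by_cases hX : X ∈ F
    · have hYF : Y ∉ F.erase X := by
        intro hYF
        have := hF (mem_of_mem_erase hYF)
        rw [mem_union, mem_insert] at this
        rcases this with h1 | h1 | h1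
        · exact disjoint_left.1 hs.disj h1 hY
        · exact hXY h1
        · exact (notMem_erase Y T) h1
      have hcard : #(insert Y (F.erase X)) = #F := by
        rw [card_insert_of_notMem hYF, card_erase_of_mem hX]
        have := card_pos.2 ⟨X, hX⟩
        omega
      obtain ⟨Z, hZ, hw⟩ := hs.sched (insert Y (F.erase X)) (by
        intro Z hZ
        rcases mem_insert.1 hZ with rfl | hZ
        · exact mem_union_right _ hY
        · have h1 := hF (mem_of_mem_erase hZ)
          rw [mem_union, mem_insert] at h1
          rw [mem_union]
          rcases h1 with h1 | h1 | h1
          · exact Or.inl h1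
          · exact absurd h1 (ne_of_mem_erase hZ)
          · exact Or.inr (mem_of_mem_erase h1)) (by omega)
      rw [hcard] at hw
      rcases mem_insert.1 hZ with rfl | hZ
      · refine ⟨X, hX, ?_⟩
        rw [weight_update_self hXP]
        omega
      · refine ⟨Z, mem_of_mem_erase hZ, ?_⟩
        rwa [weight_update (ne_of_mem_erase hZ)]
    · obtain ⟨Z, hZ, hw⟩ := hs.sched F (by
        intro Z hZ
        have h1 := hF hZ
        rw [mem_union, mem_insert] at h1
        rw [mem_union]
        rcases h1 with h1 | h1 | h1
        · exact Or.inl h1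
        · exact absurd (h1 ▸ hZ) hX
        · exact Or.inr (mem_of_mem_erase h1)) hc
      refine ⟨Z, hZ, ?_⟩
      rwa [weight_update]
      rintro rfl
      exact hX hZ

/-- In a largest selection, what prevents the addition of a part with an unused color. -/
theorem IsSelection.exists_obstacle (hs : IsSelection h L P T i c)
    (hmax : ∀ T' i' c', IsSelection h L P T' i' c' → #T' ≤ #T)
    {X : ι} (hXP : X ∉ P) (hXT : X ∉ T) {x : Fin 4} {d : ℕ} (hd : d ∈ tri (L X) x)
    (hdT : d ∉ T.image c) : ∃ F ⊆ insert X (P ∪ T), X ∈ F ∧ h ≤ #F ∧ h + #(tri (L X) x) ≤ #F ∧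
      ∀ Y ∈ F, Y ≠ X → h + weight h L P i Y ≤ #F := by
  by_contra! hcon
  have hne : ∀ Z ∈ T, Z ≠ X := by rintro Z hZ rfl; exact hXT hZ
  have key := hmax (insert X T) (Function.update i X x) (Function.update c X d) ⟨?_, ?_, ?_, ?_⟩
  · rw [card_insert_of_notMem hXT] at key
    omega
  · rw [disjoint_insert_right]
    exact ⟨hXP, hs.disj⟩
  · intro Z hZ
    rcases mem_insert.1 hZ with rfl | hZ
    · simpa using hd
    · rw [Function.update_of_ne (hne Z hZ), Function.update_of_ne (hne Z hZ)]
      exact hs.mem Z hZ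
  · intro Z hZ Z' hZ' he
    rw [mem_coe, mem_insert] at hZ hZ'
    have diff : ∀ W ∈ T, Function.update c X d W ≠ Function.update c X d X := by
      intro W hW hWe
      rw [Function.update_of_ne (hne W hW), Function.update_self] at hWe
      exact hdT (hWe ▸ mem_image_of_mem c hW)
    rcases hZ with rfl | hZ <;> rcases hZ' with rfl | hZ'
    · rfl
    · exact absurd he.symm (diff _ hZ')
    · exact absurd he (diff _ hZ)
    · rw [Function.update_of_ne (hne Z hZ), Function.update_of_ne (hne Z' hZ')] at he
      exact hs.inj hZ hZ' he
  · intro F hF hc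
    rw [union_insert] at hF
    by_cases hX : X ∈ F
    · by_cases hw : h + #(tri (L X) x) ≤ #F
      · obtain ⟨Y, hY, hYX, hYw⟩ := hcon F hF hX hc hw
        exact ⟨Y, hY, by rw [weight_update hYX]; omega⟩
      · exact ⟨X, hX, by rw [weight_update_self hXP]; omega⟩
    · obtain ⟨Z, hZ, hw⟩ := hs.sched F ((subset_insert_iff_of_notMem hX).1 hF) hc
      refine ⟨Z, hZ, ?_⟩
      rwa [weight_update]
      rintro rfl
      exact hX hZ

end

end

/-! ### An odd number of parts -/

section

variable {h a b m : ℕ} {i j k l : Fin 4}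

theorem exists_blocks_of_strong {A : Fin 4 → Finset ℕ} (hq : ∀ c, ∃ i, c ∉ A i)
    (hs : Strong h A) : ∃ s : Blocks, s.num = 2 ∧ (∀ i, ∃ j, s.block j ⊆ A i) ∧
      ∀ J : Finset (Fin s.num), #J * (2 * h - 1) ≤ #(J.biUnion s.block) := by
  obtain ⟨i, j, k, l, q, h1, h2⟩ := hs
  refine ⟨⟨2, ![A i ∩ A j, A k ∩ A l], ∅⟩, rfl, ?_, fun J => ?_⟩
  · rw [q.forall]
    exact ⟨⟨0, inter_subset_left⟩, ⟨0, inter_subset_right⟩, ⟨1, inter_subset_left⟩,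
      ⟨1, inter_subset_right⟩⟩
  · have hd : Disjoint (A i ∩ A j) (A k ∩ A l) := by
      rw [disjoint_left]
      intro c hc hc'
      rw [mem_inter] at hc hc'
      obtain ⟨x, hx⟩ := hq c
      exact hx ((q.forall (P := fun x => c ∈ A x)).2 ⟨hc.1, hc.2, hc'.1, hc'.2⟩ x)
    rw [card_biUnion]
    · rw [← smul_eq_mul]
      refine card_nsmul_le_sum _ _ _ fun x _ => ?_
      fin_cases x
      · exact h1
      · exact h2
    · intro x _ y _ hxy
      fin_cases x <;> fin_cases y
      · exact absurd rfl hxy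
      · exact hd
      · exact hd.symm
      · exact absurd rfl hxy

theorem Leftover.good {A : Fin 4 → Finset ℕ} {C₀ C D : Finset ℕ} (hA : Leftover h a C₀ A)
    (hh : 2 ≤ h) (ha : 1 ≤ a) (ham : m < 2 * h - 1 - a) (hs : C₀ ⊆ C) (hC : #C ≤ #C₀ + m)
    (hC' : m = 0 → C = C₀) (hD : 3 * h - 2 ≤ #D) (hD' : a = 2 * h - 2 → 4 * h - 3 ≤ #D) :
    Good h (2 * h - 1 - a) m False A C D := by
  have hc := hA.card_le
  rcases Nat.eq_zero_or_pos m with rfl | hm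
  · rw [hC' rfl]
    by_cases h1 : a = 2 * h - 2
    · subst h1
      have h2 : 2 * h - 1 - (2 * h - 2) = 1 := by omega
      rw [h2]
      exact hA.good_last hh (hD' rfl)
    · exact hA.good_zero hh ha (by omega) hD
  · exact hA.good_pos hh ha hm (by omega) hs (by omega)

section

variable {ι : Type*} [Fintype ι] [DecidableEq ι] {L : ι → Fin 4 → Finset ℕ} {P T : Finset ι}
  {f : ι → Fin 4} {c : ι → ℕ}

/-- An unused triple color creates an obstacle to adding `X`. It has at most `#(P ∪ T) + 1` parts
and so bounds the triple. A used color is controlled by the exchange bound `IsSelection.le_weight`.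
-/
theorem IsSelection.leftover (hs : IsSelection h L P T f c) (hh : 2 ≤ h)
    (hι : Fintype.card ι = 2 * h - 1)
    (hmax : ∀ T' i' c', IsSelection h L P T' i' c' → #T' ≤ #T)
    (hmax' : ∀ T' i' c', IsSelection h L P T' i' c' → #T' = #T →
        ∑ X ∈ T', weight h L P i' X ≤ ∑ X ∈ T, weight h L P f X)
    (hN : #((P ∪ T).filter (h ≤ weight h L P f ·)) < h) {X : ι}
    (hXP : X ∉ P) (hXT : X ∉ T) (hn : ∀ i, #(L X i) = 3 * h - 2)
    (hq : ∀ c, ∃ i, c ∉ L X i) (pot : #(univ.biUnion (L X)) ≤ 8 * h - 5)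
    (weak : ¬ Strong h (L X)) : Leftover h #(P ∪ T) (T.image c) (L X) := by
  have hXA : X ∉ P ∪ T := by simp [hXP, hXT]
  have ha : #(P ∪ T) + 1 ≤ 2 * h - 1 := by
    rw [← card_insert_of_notMem hXA, ← hι]
    exact card_le_univ _
  have obst : ∀ {x d}, d ∈ tri (L X) x → d ∉ T.image c → #(tri (L X) x) + h ≤ #(P ∪ T) + 1 := by
    intro x d hd hdT
    obtain ⟨F, hF, -, -, h1, -⟩ := hs.exists_obstacle hmax hXP hXT hd hdT
    have := card_le_card hF
    rw [card_insert_of_notMem hXA] at this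
    omega
  refine ⟨hn, hq, pot, ?_, ?_, ?_, ?_, ?_⟩
  · exact card_image_le.trans (card_le_card subset_union_right)
  · intro i j k l q
    by_contra! hcon
    exact weak ⟨i, j, k, l, q, by omega, by omega⟩
  · intro x
    by_contra! hcon
    -- A triple with at least `h` colors would be used up, each color by a part of weight at least
    -- `h`; there are fewer than `h` such parts.
    have hsub : tri (L X) x ⊆ T.image c := fun d hd => by
      by_contra hdT
      have := obst hd hdT
      omega
    have : tri (L X) x ⊆ ((P ∪ T).filter (h ≤ weight h L P f ·)).image c := by
      intro d hd
      obtain ⟨Y, hY, rfl⟩ := mem_image.1 (hsub hd)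
      have := hs.le_weight hmax' hXP hXT hY hd
      exact mem_image_of_mem c (mem_filter.2 ⟨mem_union_right _ hY, by omega⟩)
    have := (card_le_card this).trans card_image_le
    omega
  · intro x
    by_cases hsub : tri (L X) x ⊆ T.image c
    · exact Or.inl hsub
    · obtain ⟨d, hd, hdT⟩ := not_subset.1 hsub
      exact Or.inr (obst hd hdT)
  · intro x y
    by_cases hsub : tri (L X) x ⊆ T.image c
    · exact Or.inl hsub
    obtain ⟨d, hd, hdT⟩ := not_subset.1 hsub
    obtain ⟨F, hF, hXF, -, h1, h2⟩ := hs.exists_obstacle hmax hXP hXT hd hdT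
    have hcF := card_le_card hF
    rw [card_insert_of_notMem hXA] at hcF
    by_cases hcF' : #F ≤ #(P ∪ T)
    · exact Or.inr (Or.inl (by omega))
    refine Or.inr (Or.inr ?_)
    -- A full-size obstacle contains every selected part and hence bounds all their weights. This
    -- bounds any other triple, whether its color is used or not.
    have hFe : F = insert X (P ∪ T) := eq_of_subset_of_card_le hF (by
      rw [card_insert_of_notMem hXA]
      omega)
    rcases (tri (L X) y).eq_empty_or_nonempty with hy | ⟨e, he⟩
    · rw [hy, card_empty]
      omega
    by_cases heT : e ∈ T.image c
    · obtain ⟨Y, hY, rfl⟩ := mem_image.1 heT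
      have h3 := hs.le_weight hmax' hXP hXT hY he
      have h4 := h2 Y (by rw [hFe]; exact mem_insert_of_mem (mem_union_right _ hY))
        (by rintro rfl; exact hXT hY)
      omega
    · exact obst he heT

/-- The two blocks of a part of weight `w` cover at least `3h - 2 + w` colors: a list and its
disjoint triple in `T`, and two disjoint blocks of `2h - 1` colors in `P`, where `2(2h - 1) = 3h - 2
+ h`. -/
theorem IsSelection.partColorable (hs : IsSelection h L P T f c) (hh : 2 ≤ h)
    (hι : Fintype.card ι = 2 * h - 1)
    (hn : ∀ X i, #(L X i) = 3 * h - 2) (hq : ∀ X c, ∃ i, c ∉ L X i)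
    (hP : ∀ X ∈ P, Strong h (L X)) (relax : Prop)
    (hrelax : relax → h ≤ #((P ∪ T).filter (h ≤ weight h L P f ·)))
    (good : ∀ D, (∀ Y ∈ P ∪ T, 3 * h - 2 + weight h L P f Y ≤ #D) →
      ∀ X ∉ P ∪ T, ∀ m < 2 * h - 1 - #(P ∪ T), ∀ C, T.image c ⊆ C → #C ≤ #(T.image c) + m →
      (m = 0 → C = T.image c) → Good h (2 * h - 1 - #(P ∪ T)) m relax (L X) C D) :
    PartColorable L := by
  have ex : ∀ X, ∃ s : Blocks, (X ∈ P → s.num = 2 ∧ (∀ i, ∃ j, s.block j ⊆ L X i) ∧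
      ∀ J : Finset (Fin s.num), #J * (2 * h - 1) ≤ #(J.biUnion s.block)) ∧
      (X ∉ P → s = ⟨2, ![L X (f X), tri (L X) (f X)], {c X}⟩) := by
    intro X
    by_cases hX : X ∈ P
    · obtain ⟨s, hs⟩ := exists_blocks_of_strong (hq X) (hP X hX)
      exact ⟨s, fun _ => hs, fun h => absurd hX h⟩
    · exact ⟨_, fun h => absurd h hX, fun _ => rfl⟩
  choose s sP sT using ex
  have inT : ∀ X ∈ P ∪ T, X ∉ P → X ∈ T := fun X hX hXP => (mem_union.1 hX).resolve_left hXP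
  have hA : ∀ X ∈ P ∪ T, 3 * h - 2 + weight h L P f X ≤ #(univ.biUnion (s X).block) := by
    intro X hX
    by_cases hXP : X ∈ P
    · obtain ⟨h1, -, h2⟩ := sP X hXP
      have := h2 univ
      have h3 : #(univ : Finset (Fin (s X).num)) = 2 := by rw [card_univ, Fintype.card_fin, h1]
      rw [h3] at this
      rw [weight, if_pos hXP]
      omega
    · rw [weight, if_neg hXP, sT X hXP, ← card_union_tri (hn X)]
      refine card_le_card (union_subset ?_ ?_)
      · exact subset_biUnion_of_mem ![L X (f X), tri (L X) (f X)] (mem_univ (0 : Fin 2))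
      · exact subset_biUnion_of_mem ![L X (f X), tri (L X) (f X)] (mem_univ (1 : Fin 2))
  refine partColorable_of_good hh hι (P := P) (A := P ∪ T) subset_union_left (weight h L P f) s
    (relax := relax) (C₀ := T.image c) ?_ ?_ ?_ hs.sched ?_ (fun X hX => Or.inr (hA X hX))
    hrelax (Or.inr ?_) ?_ (fun X hX => (sP X hX).2.2) (good _ fun Y hY => (hA Y hY).trans ?_)
  · intro X hX hXP
    rw [sT X hXP, singleton_subset_iff]
    exact mem_image_of_mem c (inT X hX hXP)
  · intro X hX hXP Y hY hYP hXY
    rw [sT X hXP, sT Y hYP, disjoint_singleton]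
    exact fun he => hXY (hs.inj (inT X hX hXP) (inT Y hY hYP) he)
  · intro X hX
    by_cases hXP : X ∈ P
    · exact (sP X hXP).2.1
    · rw [sT X hXP]
      exact tri_fits _
  · intro X hX
    by_cases hXP : X ∈ P
    · exact (sP X hXP).1.le
    · rw [sT X hXP]
  · intro X hX hXP
    rw [sT X hXP, card_singleton]
  · intro X hX hXP
    rw [sT X hXP]
    exact tri_small (hn X) (hs.mem X (inT X hX hXP))
  · exact card_le_card (subset_biUnion_of_mem (fun Y => univ.biUnion (s Y).block) hY)

/-- Parts without triples, none of them strong. -/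
theorem partColorable_of_no_triples (hh : 2 ≤ h) (hι : Fintype.card ι = 2 * h - 1)
    (hn : ∀ X i, #(L X i) = 3 * h - 2) (hq : ∀ X c, ∃ i, c ∉ L X i)
    (pot : ∀ X, #(univ.biUnion (L X)) ≤ 8 * h - 5) (notri : ∀ X i, #(tri (L X) i) = 0)
    (weak : ∀ X, ¬ Strong h (L X)) : PartColorable L := by
  by_cases hX : ∃ X i j k l, Quad i j k l ∧ #(dbl (L X) i j) ≠ 0 ∧ #(dbl (L X) k l) ≠ 0
  · obtain ⟨X, i, j, k, l, q, h1, h2⟩ := hX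
    obtain ⟨d, hd⟩ := card_pos.1 (Nat.pos_of_ne_zero h1)
    obtain ⟨e, he⟩ := card_pos.1 (Nat.pos_of_ne_zero h2)
    rw [mem_dbl q] at hd
    rw [mem_dbl q.swap_pairs] at he
    have hde : d ≠ e := by
      rintro rfl
      exact hd.2.2.1 he.1
    -- This part alone is set aside as two merged pairs with representatives `d` and `e`. One part
    -- never activates the scheduling condition, so weight `0` is enough.
    refine partColorable_of_good hh hι (P := ∅) (A := {X}) (empty_subset _) (fun _ => 0)
      (fun _ => ⟨2, ![L X i ∩ L X j, L X k ∩ L X l], {d, e}⟩) (relax := False) (C₀ := {d, e})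
      (fun _ _ _ => subset_rfl) ?_ ?_ ?_ (fun _ _ => le_rfl) (fun _ _ => Or.inl rfl)
      False.elim (Or.inl rfl) ?_ (by simp) ?_
    · intro Y hY _ Z hZ _ hYZ
      rw [mem_singleton] at hY hZ
      exact absurd (hY.trans hZ.symm) hYZ
    · intro Y hY
      rw [mem_singleton] at hY
      subst hY
      rw [q.forall]
      exact ⟨⟨0, inter_subset_left⟩, ⟨0, inter_subset_right⟩, ⟨1, inter_subset_left⟩,
        ⟨1, inter_subset_right⟩⟩
    · intro F hF hc
      have := card_le_card hF
      rw [card_singleton] at this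
      omega
    · intro Y hY _ J _
      have hsub : J.image ![d, e] ⊆ J.biUnion ![L X i ∩ L X j, L X k ∩ L X l] ∩ {d, e} := by
        intro x hx
        obtain ⟨y, hy, rfl⟩ := mem_image.1 hx
        rw [mem_inter, mem_biUnion]
        refine ⟨⟨y, hy, ?_⟩, ?_⟩
        · fin_cases y
          · exact mem_inter.2 ⟨hd.1, hd.2.1⟩
          · exact mem_inter.2 ⟨he.1, he.2.1⟩
        · fin_cases y <;> simp
      rw [← card_image_of_injective J (f := ![d, e])]
      · exact card_le_card hsub
      · intro x y hxy
        fin_cases x <;> fin_cases y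
        · rfl
        · exact absurd hxy hde
        · exact absurd hxy.symm hde
        · rfl
    · intro Y hY m hm C _ hC _
      rw [card_singleton] at hm ⊢
      rw [card_pair hde] at hC
      have : 2 * h - 1 - 1 = 2 * h - 2 := by omega
      rw [this] at hm ⊢
      refine good_no_triples hh (hn Y) (hq Y) (notri Y) ?_ (by omega) (by omega)
      intro i j k l q
      by_contra! hcon
      exact weak Y ⟨i, j, k, l, q, by omega, by omega⟩
  · push Not at hX
    refine partColorable_of_good hh hι (P := ∅) (A := ∅) (empty_subset _) (fun _ => 0)
      (fun _ => default) (relax := False) (C₀ := ∅) (by simp) (by simp) (by simp) ?_ (by simp)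
      (by simp) False.elim (Or.inl rfl) (by simp) (by simp) ?_
    · intro F hF hc
      have := card_le_card hF
      rw [card_empty] at this
      omega
    · intro Y _ m hm C _ hC _
      rw [card_empty] at hm hC ⊢
      refine good_of_disjoint_pairs hh (hn Y) (hq Y) (pot Y) (notri Y) ?_ (by omega) (by omega)
      intro i j k l q
      by_contra! hcon
      exact hcon.2 (hX Y i j k l q hcon.1)

theorem partColorable_odd (hh : 2 ≤ h) (hι : Fintype.card ι = 2 * h - 1)
    (hn : ∀ X i, #(L X i) = 3 * h - 2) (hq : ∀ X c, ∃ i, c ∉ L X i)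
    (pot : ∀ X, #(univ.biUnion (L X)) ≤ 8 * h - 5) : PartColorable L := by
  classical
  set P : Finset ι := univ.filter fun X => Strong h (L X) with hPdef
  have hP : ∀ X, X ∈ P ↔ Strong h (L X) := by simp [hPdef]
  obtain ⟨T, f, c, hs, hmax, hmax'⟩ := exists_selection hι.le hh L P
  by_cases hA : P ∪ T = ∅
  · have hT := (union_eq_empty.1 hA).2
    have hP' := (union_eq_empty.1 hA).1
    refine partColorable_of_no_triples hh hι hn hq pot (fun X x => ?_) (fun X hX => ?_)
    · rw [card_eq_zero, eq_empty_iff_forall_notMem]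
      intro d hd
      obtain ⟨F, hF, -, h1, -⟩ := hs.exists_obstacle hmax (by simp [hP']) (X := X)
        (by simp [hT]) hd (by simp [hT])
      rw [hA] at hF
      have := card_le_card hF
      simp at this
      omega
    · have := (hP X).2 hX
      rw [hP'] at this
      exact absurd this (notMem_empty X)
  have ha : 1 ≤ #(P ∪ T) := card_pos.2 (nonempty_iff_ne_empty.2 hA)
  have ha' : #(T.image c) ≤ #(P ∪ T) := card_image_le.trans (card_le_card subset_union_right)
  -- With at least `h` heavy parts the condition on two blocks can be dropped; with fewer, the
  -- leftover properties hold.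
  by_cases hN : h ≤ #((P ∪ T).filter (h ≤ weight h L P f ·))
  · refine hs.partColorable hh hι hn hq (fun X => (hP X).1) True (fun _ => hN) ?_
    intro D _ X hX m hm C hC hcC _
    obtain ⟨hXP, hXT⟩ := notMem_union.1 hX
    refine good_relaxed hh (hn X) (hq X) (pot X) ha (by omega) ha' (fun x d hd => ?_) hC (by omega)
    by_contra hdT
    -- An obstacle has at most `2h - 1` parts and thus contains no part of `P ∪ T` of weight at
    -- least `h`. Without these it has at most `h - 1` parts, too few.
    obtain ⟨F, hF, hXF, h1, -, h2⟩ := hs.exists_obstacle hmax hXP hXT hd hdT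
    have hsub : F.erase X ⊆ (P ∪ T) \ (P ∪ T).filter (h ≤ weight h L P f ·) := by
      intro Y hY
      obtain ⟨hYX, hYF⟩ := mem_erase.1 hY
      have h3 := h2 Y hYF hYX
      have hYA := (mem_insert.1 (hF hYF)).resolve_left hYX
      have h4 := card_le_univ F
      rw [mem_sdiff, mem_filter]
      refine ⟨hYA, fun hcon => ?_⟩
      have := hcon.2
      omega
    have h3 := card_le_card hsub
    rw [card_erase_of_mem hXF, card_sdiff_of_subset (filter_subset _ _)] at h3
    omega
  · refine hs.partColorable hh hι hn hq (fun X => (hP X).1) False False.elim ?_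
    intro D hD X hX m hm C hC hcC hC'
    obtain ⟨hXP, hXT⟩ := notMem_union.1 hX
    have hl := hs.leftover hh hι hmax hmax' (not_le.1 hN) hXP hXT (hn X) (hq X) (pot X)
      (fun h1 => hXP ((hP X).2 h1))
    refine hl.good hh ha hm hC hcC hC' ?_ ?_
    · obtain ⟨Y, hY⟩ := card_pos.1 ha
      have := hD Y hY
      omega
    · intro he
      -- Scheduling all `2h - 2` parts forces a weight of at least `h - 1`, hence `4h - 3` colors in
      -- the blocks of that part.
      obtain ⟨Y, hY, hw⟩ := hs.sched (P ∪ T) subset_rfl (by omega)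
      have := hD Y hY
      omega

end

end

/-! ### An even number of parts -/

section

section even

variable {A : Fin 4 → Finset ℕ} {g : ℕ} {i j k l : Fin 4}

/-- A choice of at most three blocks such that two blocks have `4 * g` colors in their union and
three have `6 * g`, and blocks with less than `3 * g` colors are represented by `c`. -/
def EvenBlocks (g : ℕ) (A : Fin 4 → Finset ℕ) (c : ℕ) (s : Blocks) : Prop :=
  s.num ≤ 3 ∧ (∀ i, ∃ j, s.block j ⊆ A i) ∧
  (∀ J : Finset (Fin s.num), 2 ≤ #J → 4 * g ≤ #(J.biUnion s.block)) ∧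
  (∀ J : Finset (Fin s.num), 3 ≤ #J → 6 * g ≤ #(J.biUnion s.block)) ∧
  (∀ J : Finset (Fin s.num), (∀ j ∈ J, #(s.block j) < 3 * g) → #J ≤ #(J.biUnion s.block ∩ {c}))

theorem evenBlocks_of_pair (hn : ∀ i, #(A i) = 3 * g) (hq : ∀ c, ∃ i, c ∉ A i)
    (notri : ∀ i, #(tri A i) = 0) (q : Quad i j k l) (hkl : #(dbl A k l) = 0)
    (hij : g ≤ #(dbl A i j)) {c : ℕ} (hc : c ∈ dbl A i j) :
    ∃ s, EvenBlocks g A c s := by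
  have e1 := card_pair_union hn hq q
  have e2 := card_pair_union hn hq q.swap_right
  have e3 := card_union_two hn hq q.swap_pairs
  have e4 := card_pair_union_union hn hq q
  rw [notri] at e1 e2
  rw [notri, notri] at e3 e4
  refine ⟨⟨3, ![A i ∩ A j, A k, A l], {c}⟩, le_rfl, ?_, ?_, ?_, ?_⟩
  · rw [q.forall]
    exact ⟨⟨0, inter_subset_left⟩, ⟨0, inter_subset_right⟩, ⟨1, subset_rfl⟩, ⟨2, subset_rfl⟩⟩
  · intro J hJ
    have := le_card_biUnion_two (e := 4 * g) (D := ∅) (M := ![A i ∩ A j, A k, A l]) (by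
      intro x y hxy
      fin_cases x <;> fin_cases y <;> simp at hxy ⊢ <;> omega) J hJ
    rwa [union_empty] at this
  · intro J hJ
    have hJ : J = univ := eq_univ_of_card _ (le_antisymm (card_le_univ _) (by simpa using hJ))
    have : J.biUnion ![A i ∩ A j, A k, A l] = A i ∩ A j ∪ A k ∪ A l := by
      rw [hJ]
      ext x
      simp [Fin.exists_fin_succ]
    simp only
    rw [this]
    omega
  · intro J hJ
    have : J ⊆ {0} := by
      intro x hx
      have h6 := hJ x hx
      fin_cases x
      · simp
      · simp [hn] at h6
      · simp [hn] at h6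
    rcases subset_singleton_iff.1 this with rfl | rfl
    · simp
    · rw [mem_dbl q] at hc
      have h7 : c ∈ A i ∧ c ∈ A j := ⟨hc.1, hc.2.1⟩
      simp [h7, inter_singleton_of_mem]

/-- Since no two colors cover the part, there are no triples, and one of any two complementary pair
classes is empty. The small pot gives more than `4g` colors in the remaining three classes. These
cannot share a list, as it has only `3g` colors, so they are the pairs among three lists. Any two of
these classes have at most `3g` colors together, so each has at least `g` and may be merged; its
representative can be any color of the three classes. -/
theorem exists_evenBlocks (hg : 1 ≤ g) (hn : ∀ i, #(A i) = 3 * g)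
    (hd : ∀ c d, ∃ i, c ∉ A i ∧ d ∉ A i) (pot : #(univ.biUnion A) ≤ 8 * g - 1) :
    ∃ Q : Finset ℕ, 2 * g ≤ #Q ∧ ∀ c ∈ Q, ∃ s, EvenBlocks g A c s := by
  have hq : ∀ c, ∃ i, c ∉ A i := fun c => (hd c c).imp fun _ h => h.1
  have notri : ∀ i, #(tri A i) = 0 := by
    intro i
    rw [card_eq_zero, eq_empty_iff_forall_notMem]
    intro c hc
    obtain ⟨d, hdi⟩ := card_pos.1 (by rw [hn]; omega : 0 < #(A i))
    obtain ⟨x, hx, hx'⟩ := hd c d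
    by_cases hxi : x = i
    · exact hx' (hxi ▸ hdi)
    · exact hx (tri_subset hxi hc)
  have zero : ∀ i j k l, Quad i j k l → #(dbl A i j) = 0 ∨ #(dbl A k l) = 0 := by
    intro i j k l q
    by_contra! hcon
    obtain ⟨c, hc⟩ := card_pos.1 (Nat.pos_of_ne_zero hcon.1)
    obtain ⟨d, hd'⟩ := card_pos.1 (Nat.pos_of_ne_zero hcon.2)
    rw [mem_dbl q] at hc
    rw [mem_dbl q.swap_pairs] at hd'
    obtain ⟨x, hx, hx'⟩ := hd c d
    rcases q.cover x with rfl | rfl | rfl | rfl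
    · exact hx hc.1
    · exact hx hc.2.1
    · exact hx' hd'.1
    · exact hx' hd'.2.1
  have key : ∀ i j k l, Quad i j k l → #(dbl A i l) = 0 → #(dbl A j l) = 0 → #(dbl A k l) = 0 →
      ∃ Q : Finset ℕ, 2 * g ≤ #Q ∧ ∀ c ∈ Q, ∃ s, EvenBlocks g A c s := by
    intro i j k l q h1 h2 h3
    have e := card_union_all hn hq q
    obtain ⟨L1, L2, L3, L4⟩ := classes_le hn q
    rw [notri, notri, notri, notri] at e
    rw [notri, notri, notri] at L1 L2 L3 L4
    refine ⟨dbl A i j ∪ (dbl A i k ∪ dbl A j k), ?_, fun c hc => ?_⟩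
    · have := card_le_card (subset_union_left (s₁ := dbl A i j) (s₂ := dbl A i k ∪ dbl A j k))
      rw [card_union_of_disjoint, card_union_of_disjoint]
      · omega
      · rw [disjoint_left]
        intro c hc hc'
        rw [mem_dbl q.swap_mid] at hc
        rw [mem_dbl q.swap_left.swap_mid] at hc'
        exact hc.2.2.1 hc'.1
      · rw [disjoint_left]
        intro c hc hc'
        rw [mem_dbl q] at hc
        rw [mem_union, mem_dbl q.swap_mid, mem_dbl q.swap_left.swap_mid] at hc'
        rcases hc' with hc' | hc'
        · exact hc.2.2.1 hc'.2.1
        · exact hc.2.2.1 hc'.2.1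
    · rw [mem_union, mem_union] at hc
      rcases hc with hc | hc | hc
      · exact evenBlocks_of_pair hn hq notri q h3 (by omega) hc
      · exact evenBlocks_of_pair hn hq notri q.swap_mid h2 (by omega) hc
      · exact evenBlocks_of_pair hn hq notri q.swap_left.swap_mid h1 (by omega) hc
  have q : Quad 0 1 2 3 := by decide
  have e := card_union_all hn hq q
  obtain ⟨L1, L2, L3, L4⟩ := classes_le hn q
  rw [notri, notri, notri, notri] at e
  rw [notri, notri, notri] at L1 L2 L3 L4
  -- The cases closed by `omega` are those in which the three remaining classes share a list.
  rcases zero _ _ _ _ q with z₁ | z₁ <;> rcases zero _ _ _ _ q.swap_mid with z₂ | z₂ <;>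
    rcases zero _ _ _ _ q.swap_left.swap_mid with z₃ | z₃
  · omega
  · exact key 1 2 3 0 (by decide) (by rwa [dbl_comm]) (by rwa [dbl_comm]) (by rwa [dbl_comm])
  · exact key 0 2 3 1 (by decide) z₁ (by rwa [dbl_comm]) (by rwa [dbl_comm])
  · omega
  · exact key 0 1 3 2 (by decide) z₂ z₃ (by rwa [dbl_comm])
  · omega
  · omega
  · exact key 0 1 2 3 q z₃ z₂ z₁

/-- Each part offers `2g` possible representatives, so distinct ones exist for all `2g` parts.
Hall's condition then depends on the largest number of blocks from one part: three give `6g` colors,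
two give `4g`, a single block of size at least `3g` gives more than `2g`, and small blocks are
counted by representatives. -/
theorem partColorable_even {ι : Type*} [Fintype ι] [DecidableEq ι] (hg : 1 ≤ g)
    (hι : Fintype.card ι = 2 * g) {L : ι → Fin 4 → Finset ℕ} (hn : ∀ X i, #(L X i) = 3 * g)
    (hd : ∀ X c d, ∃ i, c ∉ L X i ∧ d ∉ L X i)
    (pot : ∀ X, #(univ.biUnion (L X)) ≤ 8 * g - 1) : PartColorable L := by
  choose Q hQ ex using fun X => exists_evenBlocks hg (hn X) (hd X) (pot X)
  obtain ⟨c, cinj, hc⟩ := (all_card_le_biUnion_card_iff_exists_injective Q).1 (by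
    intro S
    rcases S.eq_empty_or_nonempty with rfl | ⟨X, hX⟩
    · simp
    · have h1 := card_le_univ S
      rw [hι] at h1
      exact (h1.trans (hQ X)).trans (card_le_card (subset_biUnion_of_mem Q hX)))
  choose s num fits two three small using fun X => ex X (c X) (hc X)
  refine partColorable_of_hall (fun X => (s X).num) (fun X => (s X).block) fits fun J => ?_
  set U := univ.biUnion fun X => (J X).biUnion (s X).block with hU
  have sub : ∀ X, (J X).biUnion (s X).block ⊆ U := fun X =>
    subset_biUnion_of_mem (fun X => (J X).biUnion (s X).block) (mem_univ X)
  have total : ∀ r, (∀ X, #(J X) ≤ r) → ∑ X, #(J X) ≤ 2 * g * r := by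
    intro r hr
    have := sum_le_sum fun X (_ : X ∈ univ) => hr X
    rwa [sum_const, card_univ, hι, smul_eq_mul] at this
  by_cases h3 : ∃ X, 3 ≤ #(J X)
  · obtain ⟨X, hX⟩ := h3
    have h1 := total 3 fun X => (card_le_univ _).trans (by simpa using num X)
    have h2 := (three X (J X) hX).trans (card_le_card (sub X))
    omega
  push Not at h3
  by_cases h2 : ∃ X, 2 ≤ #(J X)
  · obtain ⟨X, hX⟩ := h2
    have h1 := total 2 fun X => by have := h3 X; omega
    have h2 := (two X (J X) hX).trans (card_le_card (sub X))
    omega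
  push Not at h2
  by_cases hs : ∀ X, ∀ j ∈ J X, #((s X).block j) < 3 * g
  · refine (sum_le_sum fun X _ => small X (J X) (hs X)).trans ?_
    rw [← card_biUnion]
    · exact card_le_card (biUnion_subset.2 fun X _ => inter_subset_left.trans (sub X))
    · intro X _ Y _ hXY
      exact Disjoint.mono inter_subset_right inter_subset_right
        (disjoint_singleton.2 fun he => hXY (cinj he))
  · push Not at hs
    obtain ⟨X, j, hj, hb⟩ := hs
    have h1 := total 1 fun X => by have := h2 X; omega
    have h2 := hb.trans (card_le_card ((subset_biUnion_of_mem (s X).block hj).trans (sub X)))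
    omega

end even

/-! ### The small pot and the induction on the number of parts -/

/-- It is enough to consider lists with fewer than `4 * k` colors in total. -/
theorem partColorable_of_small_pot {ι : Type*} [Fintype ι] [DecidableEq ι] {n : ℕ}
    (hs : ∀ L : ι → Fin 4 → Finset ℕ, (∀ X i, #(L X i) = n) →
      (∀ X, #(univ.biUnion (L X)) ≤ 4 * Fintype.card ι - 1) → PartColorable L)
    {L : ι → Fin 4 → Finset ℕ} (hn : ∀ X i, #(L X i) = n) : PartColorable L := by
  let N : Finset (ι × Fin 4) → Finset ℕ := fun S => S.biUnion fun v => L v.1 v.2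
  -- `S` violates Hall's condition the most. By maximality the vertices outside `S` have distinct
  -- representatives outside `N S`, so only `S` remains to be colored, from `N S`.
  obtain ⟨S, -, hmax⟩ := exists_max_image (univ : Finset (Finset (ι × Fin 4)))
    (fun S => (#S : ℤ) - #(N S)) ⟨∅, mem_univ _⟩
  replace hmax : ∀ S', (#S' : ℤ) - #(N S') ≤ #S - #(N S) := fun S' => hmax S' (mem_univ _)
  obtain ⟨f, finj, hf⟩ := (all_card_le_biUnion_card_iff_exists_injective
    (fun v : {v // v ∉ S} => L v.1.1 v.1.2 \ N S)).1 (by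
      intro T
      have hd : Disjoint S (T.map (Function.Embedding.subtype _)) := by
        rw [disjoint_right]
        intro v hv
        obtain ⟨w, -, rfl⟩ := mem_map.1 hv
        exact w.2
      have h1 := hmax (S ∪ T.map (Function.Embedding.subtype _))
      rw [card_union_of_disjoint hd, card_map] at h1
      have h2 : N (S ∪ T.map (Function.Embedding.subtype _)) ⊆
          N S ∪ T.biUnion fun v => L v.1.1 v.1.2 \ N S := by
        intro c hc
        by_cases hcS : c ∈ N S
        · exact mem_union_left _ hcS
        obtain ⟨v, hv, hcv⟩ := mem_biUnion.1 hc
        rcases mem_union.1 hv with hv | hv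
        · exact absurd (mem_biUnion.2 ⟨v, hv, hcv⟩) hcS
        · obtain ⟨w, hw, rfl⟩ := mem_map.1 hv
          exact mem_union_right _ (mem_biUnion.2 ⟨w, hw, mem_sdiff.2 ⟨hcv, hcS⟩⟩)
      have h3 := (card_le_card h2).trans (card_union_le _ _)
      omega)
  have inN : ∀ {v}, v ∈ S → L v.1 v.2 ⊆ N S := fun hv =>
    subset_biUnion_of_mem (fun v : ι × Fin 4 => L v.1 v.2) hv
  obtain ⟨g, hg, hgd⟩ : ∃ g : ι → Fin 4 → ℕ, (∀ X i, (X, i) ∈ S → g X i ∈ L X i) ∧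
      ∀ X Y i j, (X, i) ∈ S → (Y, j) ∈ S → X ≠ Y → g X i ≠ g Y j := by
    rcases S.eq_empty_or_nonempty with rfl | ⟨v₀, hv₀⟩
    · exact ⟨fun _ _ => 0, by simp, by simp⟩
    by_cases hN : #(N S) < #S
    -- Outside `S` a list from `S` is substituted, so that all lists lie in `N S`, which has fewer
    -- than `#S` colors.
    · obtain ⟨g, hg, hgd⟩ := hs (fun X i => if (X, i) ∈ S then L X i else L v₀.1 v₀.2)
        (fun X i => by split_ifs <;> exact hn _ _) (fun X => by
          have h1 : (univ.biUnion fun i => if (X, i) ∈ S then L X i else L v₀.1 v₀.2) ⊆ N S := by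
            refine biUnion_subset.2 fun i _ => ?_
            split_ifs with h
            · exact inN h
            · exact inN hv₀
          have h2 := card_le_card h1
          have h3 := card_le_univ S
          rw [Fintype.card_prod, Fintype.card_fin] at h3
          omega)
      refine ⟨g, fun X i hX => ?_, fun X Y i j _ _ hXY => hgd X Y i j hXY⟩
      have := hg X i
      dsimp only at this
      rwa [if_pos hX] at this
    -- The largest deficiency is not positive, so Hall's condition holds for all vertices.
    · obtain ⟨g, ginj, hg⟩ := (all_card_le_biUnion_card_iff_exists_injective
        (fun v : ι × Fin 4 => L v.1 v.2)).1 (fun T => by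
          have := hmax T
          have e : N T = T.biUnion fun v => L v.1 v.2 := rfl
          rw [← e]
          omega)
      refine ⟨fun X i => g (X, i), fun X i _ => hg (X, i), fun X Y i j _ _ hXY he => ?_⟩
      exact hXY (congrArg Prod.fst (ginj he))
  refine ⟨fun X i => if h : (X, i) ∈ S then g X i else f ⟨(X, i), h⟩, fun X i => ?_,
    fun X Y i j hXY => ?_⟩
  · dsimp only
    split_ifs with h
    · exact hg X i h
    · exact (mem_sdiff.1 (hf ⟨(X, i), h⟩)).1
  · dsimp only
    split_ifs with h1 h2 h2
    · exact hgd X Y i j h1 h2 hXY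
    · intro he
      exact (mem_sdiff.1 (hf ⟨(Y, j), h2⟩)).2 (he ▸ inN h1 (hg X i h1))
    · intro he
      exact (mem_sdiff.1 (hf ⟨(X, i), h1⟩)).2 (he ▸ inN h2 (hg Y j h2))
    · intro he
      exact hXY (congrArg (fun v => v.1.1) (finj he))

/-- A part that can be colored with the colors in `S` may be removed together with these colors. -/
theorem PartColorable.of_removed {ι : Type*} {L : ι → Fin 4 → Finset ℕ}
    {X : ι} {S : Finset ℕ} (hS : ∀ i, ∃ c ∈ S, c ∈ L X i)
    (h : PartColorable fun (Y : {Y // Y ≠ X}) i => L Y i \ S) : PartColorable L := by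
  classical
  obtain ⟨f, hf, hfd⟩ := h
  choose g hgS hg using hS
  refine ⟨fun Y i => if h : Y = X then g i else f ⟨Y, h⟩ i, fun Y i => ?_, fun Y Z i j hYZ => ?_⟩
  · dsimp only
    split_ifs with h
    · exact h ▸ hg i
    · exact (mem_sdiff.1 (hf ⟨Y, h⟩ i)).1
  · dsimp only
    split_ifs with h1 h2 h2
    · exact absurd (h1.trans h2.symm) hYZ
    · intro he
      exact (mem_sdiff.1 (hf ⟨Z, h2⟩ j)).2 (he ▸ hgS i)
    · intro he
      exact (mem_sdiff.1 (hf ⟨Y, h1⟩ i)).2 (he ▸ hgS j)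
    · exact hfd _ _ i j fun he => hYZ (congrArg Subtype.val he)

/-- Lists of size `3 * k / 2` suffice for `k` parts with four vertices. -/
theorem partColorable_of_card (k : ℕ) : ∀ (ι : Type) [Fintype ι] [DecidableEq ι],
    Fintype.card ι = k → ∀ L : ι → Fin 4 → Finset ℕ, (∀ X i, 3 * k / 2 ≤ #(L X i)) →
    PartColorable L := by
  induction k with
  | zero =>
    intro ι _ _ hι L _
    have := Fintype.card_eq_zero_iff.1 hι
    exact ⟨fun X => isEmptyElim X, fun X => isEmptyElim X, fun X => isEmptyElim X⟩
  | succ k ih =>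
    intro ι _ _ hι L' hL'
    choose L hL hn using fun X i => exists_subset_card_eq (hL' X i)
    suffices PartColorable L by
      obtain ⟨f, hf, hfd⟩ := this
      exact ⟨f, fun X i => hL X i (hf X i), hfd⟩
    clear hL hL' L'
    revert L hn
    suffices hs : ∀ L : ι → Fin 4 → Finset ℕ, (∀ X i, #(L X i) = 3 * (k + 1) / 2) →
        (∀ X, #(univ.biUnion (L X)) ≤ 4 * Fintype.card ι - 1) → PartColorable L from
      fun L hn => partColorable_of_small_pot hs hn
    intro L hn pot
    rw [hι] at pot
    have remove : ∀ (X : ι) (S : Finset ℕ), (∀ i, ∃ c ∈ S, c ∈ L X i) →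
        3 * k / 2 + #S ≤ 3 * (k + 1) / 2 → PartColorable L := by
      intro X S hS hc
      refine PartColorable.of_removed hS (ih _ ?_ _ fun Y i => ?_)
      · rw [Fintype.card_subtype_compl, hι, Fintype.card_subtype_eq]
        rfl
      · have := le_card_sdiff S (L Y i)
        rw [hn] at this
        omega
    by_cases hq : ∀ X c, ∃ i, c ∉ L X i
    swap
    · push Not at hq
      obtain ⟨X, c, hc⟩ := hq
      -- The list size grows by at least one with each new part, and by two when the new number of
      -- parts is even; hence two colors may be spent in that case below.
      refine remove X {c} (fun i => ⟨c, mem_singleton_self c, hc i⟩) ?_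
      rw [card_singleton]
      omega
    rcases Nat.even_or_odd' (k + 1) with ⟨g, hg | hg⟩
    · by_cases hd : ∀ X c d, ∃ i, c ∉ L X i ∧ d ∉ L X i
      · refine partColorable_even (g := g) (by omega) (by omega) (fun X i => ?_) hd (fun X => ?_)
        · rw [hn]
          omega
        · have := pot X
          omega
      · push Not at hd
        obtain ⟨X, c, d, hcd⟩ := hd
        refine remove X {c, d} (fun i => ?_) ?_
        · by_cases hc : c ∈ L X i
          · exact ⟨c, by simp, hc⟩
          · exact ⟨d, by simp, hcd i hc⟩
        · have := card_le_two (a := c) (b := d)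
          omega
    · rcases Nat.eq_zero_or_pos g with rfl | hg0
      · have hk : k = 0 := by omega
        subst hk
        have hne : ∀ X i, ∃ c, c ∈ L X i := fun X i => card_pos.1 (by rw [hn]; norm_num)
        choose f hf using hne
        refine ⟨f, hf, fun X Y _ _ hXY => absurd ?_ hXY⟩
        exact (Fintype.card_le_one_iff.1 hι.le) X Y
      · refine partColorable_odd (h := g + 1) (by omega) (by omega) (fun X i => ?_) hq (fun X => ?_)
        · rw [hn]
          omega
        · have := pot X
          omega

end

/-! ### The two bounds for the complete multipartite graph -/

theorem choosable_three_mul_div_two (k : ℕ) :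
    (SimpleGraph.completeEquipartiteGraph k 4).Choosable (3 * k / 2) := by
  intro L hL
  obtain ⟨f, hf, hfd⟩ := partColorable_of_card k (Fin k) (Fintype.card_fin k)
    (fun X i => L (X, i)) fun X i => by rw [hL]
  refine ⟨fun v => f v.1 v.2, fun v => hf v.1 v.2, fun v w hvw => ?_⟩
  exact hfd _ _ _ _ (SimpleGraph.completeEquipartiteGraph_adj.1 hvw)

theorem card_filter_mod_four_ne (N : ℕ) (i : Fin 4) :
    N ≤ #((range N).filter fun c => c % 4 ≠ (i : ℕ)) + (N + 3) / 4 := by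
  have h1 := card_filter_add_card_filter_not (s := range N) (fun c => c % 4 = (i : ℕ))
  have h2 : #((range N).filter fun c => c % 4 = (i : ℕ)) ≤ (N + 3) / 4 := by
    rw [← card_range ((N + 3) / 4)]
    refine card_le_card_of_injOn (fun c => c / 4) (fun c hc => ?_) (fun c hc d hd hcd => ?_)
    · rw [mem_coe, mem_filter, mem_range] at hc
      rw [mem_coe, mem_range]
      dsimp only
      omega
    · rw [mem_coe, mem_filter] at hc hd
      dsimp only at hcd
      omega
  rw [card_range] at h1
  simp only [ne_eq]
  omega

/-- Among `2k - 1` colors, those outside a residue class mod 4 number at least `⌊3k/2⌋ - 1`, so they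
contain lists of any smaller bad size `n`. Each part uses two colors or more, and different parts
use disjoint sets. -/
theorem le_of_choosable {k n : ℕ} (hn : (SimpleGraph.completeEquipartiteGraph k 4).Choosable n) :
    3 * k / 2 ≤ n := by
  by_contra! hlt
  have ex : ∀ i : Fin 4, ∃ S ⊆ (range (2 * k - 1)).filter fun c => c % 4 ≠ (i : ℕ), #S = n := by
    intro i
    have := card_filter_mod_four_ne (2 * k - 1) i
    exact exists_subset_card_eq (by omega)
  choose S hS hc using ex
  obtain ⟨f, hf, hfd⟩ := hn (fun v => S v.2) fun v => hc v.2
  have mem : ∀ X i, f (X, i) < 2 * k - 1 ∧ f (X, i) % 4 ≠ (i : ℕ) := fun X i => by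
    have := hS i (hf (X, i))
    rwa [mem_filter, mem_range] at this
  have two : ∀ X, 2 ≤ #(univ.image fun i => f (X, i)) := by
    intro X
    -- The vertex whose list excludes the residue of the color used at vertex `0`.
    let i : Fin 4 := ⟨f (X, 0) % 4, Nat.mod_lt _ (by norm_num)⟩
    refine one_lt_card.2 ⟨f (X, 0), mem_image_of_mem (fun i => f (X, i)) (mem_univ 0), f (X, i),
      mem_image_of_mem (fun i => f (X, i)) (mem_univ i), fun he => ?_⟩
    have h1 := (mem X i).2
    rw [← he] at h1
    exact h1 rfl
  have hdisj : #(univ.biUnion fun X => univ.image fun i => f (X, i)) =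
      ∑ X, #(univ.image fun i => f (X, i)) := by
    refine card_biUnion fun X _ Y _ hXY => ?_
    change Disjoint (univ.image fun i => f (X, i)) (univ.image fun i => f (Y, i))
    rw [disjoint_left]
    intro c hcX hcY
    obtain ⟨i, -, rfl⟩ := mem_image.1 hcX
    obtain ⟨j, -, hj⟩ := mem_image.1 hcY
    exact hfd (X, i) (Y, j) (SimpleGraph.completeEquipartiteGraph_adj.2 hXY) hj.symm
  have hsub : (univ.biUnion fun X => univ.image fun i => f (X, i)) ⊆ range (2 * k - 1) := by
    refine biUnion_subset.2 fun X _ c hcX => ?_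
    obtain ⟨i, -, rfl⟩ := mem_image.1 hcX
    exact mem_range.2 (mem X i).1
  have h1 := card_le_card hsub
  have h2 := sum_le_sum fun X (_ : X ∈ univ) => two X
  rw [hdisj, card_range] at h1
  rw [sum_const, card_univ, Fintype.card_fin, smul_eq_mul] at h2
  omega

theorem ceil_three_mul_sub_one_div_two {k : ℕ} (hk : 0 < k) :
    ⌈(3 * (k : ℚ) - 1) / 2⌉₊ = 3 * k / 2 := by
  rw [Nat.ceil_eq_iff (by omega)]
  have h1 : (((3 * k / 2 - 1 : ℕ) : ℚ)) + 1 = ((3 * k / 2 : ℕ) : ℚ) := by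
    rw [← Nat.cast_add_one]
    congr 1
    omega
  have h2 : 2 * ((3 * k / 2 : ℕ) : ℚ) ≤ 3 * k := by
    exact_mod_cast Nat.mul_div_le (3 * k) 2
  have h3 : (3 * k : ℚ) ≤ 2 * ((3 * k / 2 : ℕ) : ℚ) + 1 := by
    have : 3 * k ≤ 2 * (3 * k / 2) + 1 := by omega
    exact_mod_cast this
  constructor
  · linarith
  · linarith

end K4

theorem theorem3 (k : ℕ) (hk : 0 < k) :
    (SimpleGraph.completeEquipartiteGraph k 4).choiceNumber =
      ((⌈(3 * (k : ℚ) - 1) / 2⌉₊ : ℕ) : ℕ∞) := by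
  rw [K4.ceil_three_mul_sub_one_div_two hk]
  refine le_antisymm (iInf₂_le _ (K4.choosable_three_mul_div_two k)) (le_iInf₂ fun n hn => ?_)
  exact_mod_cast K4.le_of_choosable hn
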